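/- Let $\mathsf{RCA}_0^\omega$ be Kohlenbach's base theory of higher-order Reverse Mathematics: the theory, in classical logic and in the language of all finite types ($0$ for natural numbers, $1=0\to0$, $2=1\to0$, and so on, with prime formulas $s=_0t$ only and equality at higher types defined pointwise), whose axioms are the successor axioms, the defining equations of the combinators $\Pi,\Sigma$ (that is, $K,S$) and of the recursor $R_0$ for type $0$, extensionality for all types, induction for quantifier-free formulas, and $\mathsf{QF\text{-}AC}^{1,0}$: $\forall f^1\exists n^0\,\varphi(f,n)\to\exists F^2\forall f^1\,\varphi(f,F(f))$ for quantifier-free $\varphi$. In this theory real numbers are given by fast-converging Cauchy sequences of rationals, with $=_{\mathbb R}$, $<_{\mathbb R}$ defined as usual, and functions on $\mathbb R$ respect $=_{\mathbb R}$. A set $A\subseteq\mathbb R$ (resp. $A\subseteq 2^{\mathbb N}$) is given by a functional $A:\mathbb R\to\mathbb R$ (resp. $A:2^{\mathbb N}\to\mathbb R$), where $x\in A$ means $A(x)>_{\mathbb R}0$. Such an $A$ is strongly countable if there is $Y:\mathbb R\to\mathbb N$ (resp. $Y:2^{\mathbb N}\to\mathbb N$) which is injective on $A$ and satisfies $(\forall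 n\in\mathbb N)(\exists x\in A)(Y(x)=n)$. Consider the following principles. - $\mathsf{BWC}_1$: every strongly countable $A\subseteq2^{\mathbb N}$ has a least upper bound in $2^{\mathbb N}$ with respect to the lexicographic order. - $\mathsf{BWC}_1^{\mathsf{pwo}}$: every strongly countable $A\subseteq2^{\mathbb N}$ has a supremum for the pointwise order, i.e. there is $s\in2^{\mathbb N}$ such that $f(n)\le s(n)$ for all $f\in A$ and $n\in\mathbb N$, and such that for each $k\in\mathbb N$ with $s(k)=1$ there is $f\in A$ with $f(k)=1$. - $\mathsf{IND}_1$: for every functional $Y$, if $(\forall n\in\mathbb N)(\exists!f\in2^{\mathbb N})(Y(n,f)=0)$, then for every $n\in\mathbb N$ there is a finite sequence $w(0),\dots,w(n-1)$ of elements of $2^{\mathbb N}$ with $Y(i,w(i))=0$ for all $i<n$. - $\mathsf{cocode}_1$: for every strongly countable $A\subseteq[0,1]$ there is a sequence $(x_n)_{n\in\mathbb N}$ in $A$ such that $(\forall x\in\mathbb R)\big(x\in A\leftrightarrow(\exists n\in\mathbb N)(x_n=_{\mathbb R}x)\big)$. **Theorem.** $\mathsf{RCA}_0^\omega$ proves $$[\mathsf{BWC}_1+\mathsf{IND}_1]\leftrightarrow\mathsf{BWC}_1^{\mathsf{pwo}}\leftrightarrow\mathsf{cocode}_1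 .$$ -/

import Mathlib

/-! # Higher-order arithmetic: the language of all finite types, classical derivability, the base
theory `RCA₀^ω`, and the principles `BWC₁`, `BWC₁^pwo`, `IND₁`, `cocode₁` as formulas of it. -/

namespace HOA

/-! ## Syntax -/

/-- The finite types: `0` (natural numbers), and `σ ⇒ τ` (functionals from `σ` to `τ`). -/
inductive FT : Type
  | nat : FT
  | arrow : FT → FT → FT
  deriving DecidableEq

infixr:60 " ⇒ " => FT.arrow

/-- The base type `0`. -/
abbrev o : FT := FT.nat

/-- The type `1 = 0 → 0` of sequences of natural numbers. -/
abbrev one : FT := o ⇒ o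

/-- The type `2 = 1 → 0`. -/
abbrev two : FT := one ⇒ o

/-- Typed terms: variables, application, and the constants of Gödel-Kleene primitive recursion in
all finite types with the recursor for type `0` only. There are infinitely many variables
`var σ 0, var σ 1, …` of each type `σ`; they are used as de Bruijn indices, counted separately for
each type. -/
inductive Term : FT → Type
  | var (σ : FT) (n : ℕ) : Term σ
  | app {σ τ : FT} (s : Term (σ ⇒ τ)) (t : Term σ) : Term τ
  | zero : Term o
  | succ : Term (o ⇒ o)
  | K (σ τ : FT) : Term (σ ⇒ τ ⇒ σ)
  | S (ρ σ τ : FT) : Term ((ρ ⇒ σ ⇒ τ) ⇒ (ρ ⇒ σ) ⇒ ρ ⇒ τ)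
  | R : Term ((o ⇒ o ⇒ o) ⇒ o ⇒ o ⇒ o)

infixl:90 " ⬝ " => Term.app

/-- Formulas. The only prime formulas are `⊥` and equations between terms of type `0`.
The quantifier `all σ φ` binds the variable `var σ 0` of `φ`; the variable `var σ (n + 1)` of `φ`
is the variable `var σ n` of `all σ φ`, and variables of the other types keep their index. -/
inductive Formula : Type
  | eq (s t : Term o) : Formula
  | bot : Formula
  | imp (φ ψ : Formula) : Formula
  | all (σ : FT) (φ : Formula) : Formula

/-! ### Renaming and (capture-avoiding) substitution -/

namespace Term

def rename (r : FT → ℕ → ℕ) : {σ : FT} → Term σ → Term σ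
  | _, var σ n => var σ (r σ n)
  | _, app s t => app (rename r s) (rename r t)
  | _, zero => zero
  | _, succ => succ
  | _, K σ τ => K σ τ
  | _, S ρ σ τ => S ρ σ τ
  | _, R => R

/-- Raise by one the index of all variables of type `σ`: the term `t`, read below a new quantifier
over type `σ`. -/
def shift (σ : FT) {τ : FT} (t : Term τ) : Term τ :=
  t.rename fun ρ n => if ρ = σ then n + 1 else n

def subst (s : (σ : FT) → ℕ → Term σ) : {σ : FT} → Term σ → Term σ
  | _, var σ n => s σ n
  | _, app t u => app (subst s t) (subst s u)
  | _, zero => zero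
  | _, succ => succ
  | _, K σ τ => K σ τ
  | _, S ρ σ τ => S ρ σ τ
  | _, R => R

/-- The substitution `s`, carried below a quantifier over type `σ`. -/
def up (σ : FT) (s : (τ : FT) → ℕ → Term τ) : (τ : FT) → ℕ → Term τ := fun τ n =>
  if τ = σ then
    match n with
    | 0 => var τ 0
    | k + 1 => (s τ k).shift σ
  else (s τ n).shift σ

/-- The substitution that replaces `var σ 0` by `t` and lowers by one the index of the other
variables of type `σ`. -/
def single {σ : FT} (t : Term σ) : (τ : FT) → ℕ → Term τ := fun τ n =>
  if h : τ = σ then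
    match n with
    | 0 => h.symm ▸ t
    | k + 1 => var τ k
  else var τ n

end Term

namespace Formula

def subst : Formula → ((σ : FT) → ℕ → Term σ) → Formula
  | eq t u, s => eq (t.subst s) (u.subst s)
  | bot, _ => bot
  | imp φ ψ, s => imp (φ.subst s) (ψ.subst s)
  | all σ φ, s => all σ (φ.subst (Term.up σ s))

/-- The formula `φ`, read below a new quantifier over type `σ`. -/
def shift (σ : FT) (φ : Formula) : Formula :=
  φ.subst fun τ n => (Term.var τ n).shift σ

/-- `φ.inst t` is the instance at `t` of `all σ φ`. -/
def inst {σ : FT} (φ : Formula) (t : Term σ) : Formula :=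
  φ.subst (Term.single t)

/-- Quantifier-free formulas. -/
def QF : Formula → Prop
  | eq _ _ => True
  | bot => True
  | imp φ ψ => φ.QF ∧ ψ.QF
  | all _ _ => False

/-! ### The other connectives of classical logic -/

def neg (φ : Formula) : Formula := imp φ bot
def and (φ ψ : Formula) : Formula := neg (imp φ (neg ψ))
def or (φ ψ : Formula) : Formula := imp (neg φ) ψ
def iff (φ ψ : Formula) : Formula := and (imp φ ψ) (imp ψ φ)
def ex (σ : FT) (φ : Formula) : Formula := neg (all σ (neg φ))

end Formula

open Formula

infix:50 " ≐ " => Formula.eq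
prefix:max "∼" => Formula.neg
infixr:35 " ⋏ " => Formula.and
infixr:30 " ⋎ " => Formula.or
infixr:25 " ⊸ " => Formula.imp
infix:20 " ⟺ " => Formula.iff

/-- The variable of type `σ` bound by the innermost quantifier over type `σ`. -/
abbrev v0 (σ : FT) : Term σ := Term.var σ 0

/-- The variable of type `σ` bound by the second innermost quantifier over type `σ`. -/
abbrev v1 (σ : FT) : Term σ := Term.var σ 1

/-- Equality at type `σ`, defined as extensional (pointwise) equality. -/
def eqAt : (σ : FT) → Term σ → Term σ → Formula
  | FT.nat, s, t => s ≐ t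
  | FT.arrow σ τ, s, t => all σ (eqAt τ (s.shift σ ⬝ v0 σ) (t.shift σ ⬝ v0 σ))

/-! ## Derivability -/

/-- Classical natural deduction with equality at type `0`: `Derives T Δ φ` says that `φ` is
derivable from the assumptions `Δ` and the axioms `T`, where free variables in an axiom are read
as universally quantified. -/
inductive Derives (T : Set Formula) : List Formula → Formula → Prop
  | ax {Δ φ} : φ ∈ T → Derives T Δ φ
  | hyp {Δ φ} : φ ∈ Δ → Derives T Δ φ
  | impI {Δ φ ψ} : Derives T (φ :: Δ) ψ → Derives T Δ (φ ⊸ ψ)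
  | impE {Δ φ ψ} : Derives T Δ (φ ⊸ ψ) → Derives T Δ φ → Derives T Δ ψ
  | raa {Δ φ} : Derives T (∼φ :: Δ) bot → Derives T Δ φ
  | allI {Δ σ φ} : Derives T (Δ.map (Formula.shift σ)) φ → Derives T Δ (all σ φ)
  | allE {Δ σ φ} (t : Term σ) : Derives T Δ (all σ φ) → Derives T Δ (φ.inst t)
  | eqRefl {Δ} (t : Term o) : Derives T Δ (t ≐ t)
  | eqSubst {Δ} {s t : Term o} (φ : Formula) :
      Derives T Δ (s ≐ t) → Derives T Δ (φ.inst s) → Derives T Δ (φ.inst t)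

/-- `T` proves `φ`. -/
def Proves (T : Set Formula) (φ : Formula) : Prop := Derives T [] φ

infix:15 " ⊩ " => Proves

/-! ## The base theory -/

/-- The axioms of `RCA₀^ω`: successor axioms, the defining equations of the combinators and of the
recursor for type `0`, extensionality in all types, induction for quantifier-free formulas, and
the quantifier-free axiom of choice `QF-AC^{1,0}`. -/
inductive RCA0ω : Set Formula
  | succ_ne_zero (t : Term o) : RCA0ω (∼(Term.succ ⬝ t ≐ Term.zero))
  | succ_inj (s t : Term o) : RCA0ω ((Term.succ ⬝ s ≐ Term.succ ⬝ t) ⊸ (s ≐ t))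
  | K_eq (σ τ : FT) (x : Term σ) (y : Term τ) : RCA0ω (eqAt σ (Term.K σ τ ⬝ x ⬝ y) x)
  | S_eq (ρ σ τ : FT) (x : Term (ρ ⇒ σ ⇒ τ)) (y : Term (ρ ⇒ σ)) (z : Term ρ) :
      RCA0ω (eqAt τ (Term.S ρ σ τ ⬝ x ⬝ y ⬝ z) (x ⬝ z ⬝ (y ⬝ z)))
  | R_zero (f : Term (o ⇒ o ⇒ o)) (m : Term o) : RCA0ω (Term.R ⬝ f ⬝ m ⬝ Term.zero ≐ m)
  | R_succ (f : Term (o ⇒ o ⇒ o)) (m n : Term o) :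
      RCA0ω (Term.R ⬝ f ⬝ m ⬝ (Term.succ ⬝ n) ≐ f ⬝ n ⬝ (Term.R ⬝ f ⬝ m ⬝ n))
  | extensionality (σ τ : FT) (x y : Term σ) (z : Term (σ ⇒ τ)) :
      RCA0ω (eqAt σ x y ⊸ eqAt τ (z ⬝ x) (z ⬝ y))
  /-- `φ(0) → ∀ n (φ(n) → φ(n + 1)) → ∀ n φ(n)`, where `n` is `var 0 0` in `φ` -/
  | induction (φ : Formula) (hφ : φ.QF) :
      RCA0ω (φ.inst Term.zero ⊸
        all o (φ ⊸ φ.subst fun τ n =>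
          if h : τ = o then
            match n with
            | 0 => h.symm ▸ (Term.succ ⬝ v0 o)
            | k + 1 => Term.var τ (k + 1)
          else Term.var τ n) ⊸
        all o φ)
  /-- `∀ f ∃ n φ(f, n) → ∃ F ∀ f φ(f, F(f))`, where `f` is `var 1 0` and `n` is `var 0 0` in `φ` -/
  | choice (φ : Formula) (hφ : φ.QF) :
      RCA0ω (all one (ex o φ) ⊸ ex two (all one ((φ.shift two).inst (v0 two ⬝ v0 one))))

/-! ## Natural numbers -/

/-- `s + t` -/
def add (s t : Term o) : Term o :=
  Term.R ⬝ (Term.K (o ⇒ o) o ⬝ Term.succ) ⬝ s ⬝ t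

/-- `s * t`, by the recursion `p ↦ p + s` -/
def mul (s t : Term o) : Term o :=
  Term.R ⬝ (Term.K (o ⇒ o) o ⬝
      (Term.S o o o ⬝ (Term.R ⬝ (Term.K (o ⇒ o) o ⬝ Term.succ)) ⬝ (Term.K o o ⬝ s)))
    ⬝ Term.zero ⬝ t

/-- `2 ^ t`, by the recursion `p ↦ p + p` -/
def twoPow (t : Term o) : Term o :=
  Term.R ⬝ (Term.K (o ⇒ o) o ⬝
      (Term.S o o o ⬝ (Term.R ⬝ (Term.K (o ⇒ o) o ⬝ Term.succ)) ⬝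
        (Term.S o (o ⇒ o) o ⬝ Term.K o (o ⇒ o) ⬝ Term.K o o)))
    ⬝ (Term.succ ⬝ Term.zero) ⬝ t

def num : ℕ → Term o
  | 0 => Term.zero
  | k + 1 => Term.succ ⬝ num k

/-- `s < t` -/
def lt (s t : Term o) : Formula :=
  ex o (add (s.shift o) (Term.succ ⬝ v0 o) ≐ t.shift o)

/-- The pairing function `(s + t)² + s` on the natural numbers. -/
def pair (s t : Term o) : Term o := add (mul (add s t) (add s t)) s

/-! ## Rational and real numbers -/

/-- The code of the rational number `(a - b) / (c + 1)`. -/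
def ratCode (a b c : Term o) : Term o := pair (pair a b) c

def isRat (q : Term o) : Formula :=
  ex o (ex o (ex o (((q.shift o).shift o).shift o ≐
    ratCode (Term.var o 2) (Term.var o 1) (Term.var o 0))))

/-- For codes of rational numbers: `r - q > k / 2 ^ n`. In cleared form, with
`q = (a - b) / (c + 1)` and `r = (a' - b') / (c' + 1)`: the number
`2 ^ n (a (c' + 1) + b' (c + 1)) + k (c + 1) (c' + 1)` is less than
`2 ^ n (a' (c + 1) + b (c' + 1))`. -/
def gap (q r n : Term o) (k : ℕ) : Formula :=
  let w (t : Term o) : Term o :=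
    (((((t.shift o).shift o).shift o).shift o).shift o).shift o
  let a := Term.var o 5
  let b := Term.var o 4
  let c := Term.var o 3
  let a' := Term.var o 2
  let b' := Term.var o 1
  let c' := Term.var o 0
  let d := Term.succ ⬝ c
  let d' := Term.succ ⬝ c'
  ex o (ex o (ex o (ex o (ex o (ex o (
    (w q ≐ ratCode a b c) ⋏ (w r ≐ ratCode a' b' c') ⋏
    lt (add (mul (twoPow (w n)) (add (mul a d') (mul b' d))) (mul (num k) (mul d d')))
      (mul (twoPow (w n)) (add (mul a' d) (mul b d')))))))))

/-- A real number is (given by) a sequence `(q_n)` of (codes of) rational numbers such that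
`|q_n - q_{n+i}| ≤ 2^{-n}` for all `n, i`. -/
def isReal (x : Term one) : Formula :=
  all o (isRat (x.shift o ⬝ v0 o)) ⋏
  all o (all o (
    let q := (x.shift o).shift o ⬝ v1 o
    let q' := (x.shift o).shift o ⬝ add (v1 o) (v0 o)
    ∼(gap q q' (v1 o) 1) ⋏ ∼(gap q' q (v1 o) 1)))

/-- `x = y` for real numbers: `|q_n - r_n| ≤ 2^{-n+1}` for all `n`. -/
def realEq (x y : Term one) : Formula :=
  all o (∼(gap (x.shift o ⬝ v0 o) (y.shift o ⬝ v0 o) (v0 o) 2) ⋏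
    ∼(gap (y.shift o ⬝ v0 o) (x.shift o ⬝ v0 o) (v0 o) 2))

/-- `x < y` for real numbers: `r_n - q_n > 2^{-n+1}` for some `n`. -/
def realLt (x y : Term one) : Formula :=
  ex o (gap (x.shift o ⬝ v0 o) (y.shift o ⬝ v0 o) (v0 o) 2)

/-- `x ≤ y` for real numbers -/
def realLe (x y : Term one) : Formula := ∼(realLt y x)

/-- The natural number `k` as a real number (a constant sequence). -/
def realNum (k : ℕ) : Term one :=
  Term.K o o ⬝ ratCode (num k) Term.zero Term.zero

/-! ## Sets -/

/-- Membership in the set given by the (real-valued) functional `A`: `x ∈ A` iff `A(x) > 0`. -/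
def mem (x : Term one) (A : Term (one ⇒ one)) : Formula := realLt (realNum 0) (A ⬝ x)

/-! ### Sets of real numbers -/

/-- `A : ℝ → ℝ` represents a subset of `[0, 1]`: it maps reals to reals, respects equality of reals,
and all its elements lie in `[0, 1]`. -/
def isSubsetUnitInterval (A : Term (one ⇒ one)) : Formula :=
  let A' := A.shift one
  let A'' := (A.shift one).shift one
  all one (isReal (v0 one) ⊸ isReal (A' ⬝ v0 one)) ⋏
  all one (all one (isReal (v1 one) ⊸ isReal (v0 one) ⊸ realEq (v1 one) (v0 one) ⊸
    realEq (A'' ⬝ v1 one) (A'' ⬝ v0 one))) ⋏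
  all one (isReal (v0 one) ⊸ mem (v0 one) A' ⊸
    realLe (realNum 0) (v0 one) ⋏ realLe (v0 one) (realNum 1))

/-- `Y` is a function `ℝ → ℕ` which is injective on the set `A` of reals and maps `A` onto `ℕ`. -/
def bijectiveOnReals (A : Term (one ⇒ one)) (Y : Term two) : Formula :=
  let A'' := (A.shift one).shift one
  let Y'' := (Y.shift one).shift one
  all one (all one (isReal (v1 one) ⊸ isReal (v0 one) ⊸ realEq (v1 one) (v0 one) ⊸
    (Y'' ⬝ v1 one ≐ Y'' ⬝ v0 one))) ⋏
  all one (all one (isReal (v1 one) ⊸ isReal (v0 one) ⊸ mem (v1 one) A'' ⊸ mem (v0 one) A'' ⊸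
    (Y'' ⬝ v1 one ≐ Y'' ⬝ v0 one) ⊸ realEq (v1 one) (v0 one))) ⋏
  all o (ex one (isReal (v0 one) ⋏ mem (v0 one) ((A.shift o).shift one) ⋏
    ((Y.shift o).shift one ⬝ v0 one ≐ v0 o)))

/-! ### Sets in Cantor space -/

/-- `f ∈ 2^ℕ` -/
def binary (f : Term one) : Formula :=
  all o ((f.shift o ⬝ v0 o ≐ num 0) ⋎ (f.shift o ⬝ v0 o ≐ num 1))

/-- `A : 2^ℕ → ℝ` represents a subset of `2^ℕ`. -/
def isSubsetCantor (A : Term (one ⇒ one)) : Formula :=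
  all one (binary (v0 one) ⊸ isReal (A.shift one ⬝ v0 one))

/-- `Y : 2^ℕ → ℕ` is injective on the subset `A` of `2^ℕ` and maps `A` onto `ℕ`. -/
def bijectiveOnCantor (A : Term (one ⇒ one)) (Y : Term two) : Formula :=
  let A'' := (A.shift one).shift one
  let Y'' := (Y.shift one).shift one
  all one (all one (binary (v1 one) ⊸ binary (v0 one) ⊸ mem (v1 one) A'' ⊸ mem (v0 one) A'' ⊸
    (Y'' ⬝ v1 one ≐ Y'' ⬝ v0 one) ⊸ eqAt one (v1 one) (v0 one))) ⋏
  all o (ex one (binary (v0 one) ⋏ mem (v0 one) ((A.shift o).shift one) ⋏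
    ((Y.shift o).shift one ⬝ v0 one ≐ v0 o)))

/-- `f <_lex g` -/
def lexLt (f g : Term one) : Formula :=
  ex o (
    all o (lt (v0 o) (v1 o) ⊸
      ((f.shift o).shift o ⬝ v0 o ≐ (g.shift o).shift o ⬝ v0 o)) ⋏
    lt (f.shift o ⬝ v0 o) (g.shift o ⬝ v0 o))

/-- `f ≤_lex g` -/
def lexLe (f g : Term one) : Formula := lexLt f g ⋎ eqAt one f g

/-- `s ∈ 2^ℕ` is an upper bound of `A ⊆ 2^ℕ` for the lexicographic order. -/
def isLexUpperBound (A : Term (one ⇒ one)) (s : Term one) : Formula :=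
  all one (binary (v0 one) ⊸ mem (v0 one) (A.shift one) ⊸ lexLe (v0 one) (s.shift one))

/-- `s ∈ 2^ℕ` is the supremum of `A ⊆ 2^ℕ` for the lexicographic order. -/
def isLexSup (A : Term (one ⇒ one)) (s : Term one) : Formula :=
  binary s ⋏ isLexUpperBound A s ⋏
  all one (binary (v0 one) ⊸ isLexUpperBound (A.shift one) (v0 one) ⊸
    lexLe (s.shift one) (v0 one))

/-- `s ∈ 2^ℕ` is the supremum of `A ⊆ 2^ℕ` for the pointwise order: `f(n) ≤ s(n)` for all `f ∈ A`
and all `n`, and if `s(k) = 1`, then `f(k) = 1` for some `f ∈ A`. -/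
def isPointwiseSup (A : Term (one ⇒ one)) (s : Term one) : Formula :=
  binary s ⋏
  all one (binary (v0 one) ⊸ mem (v0 one) (A.shift one) ⊸
    all o (∼(lt ((s.shift one).shift o ⬝ v0 o) (v0 one ⬝ v0 o)))) ⋏
  all o ((s.shift o ⬝ v0 o ≐ num 1) ⊸
    ex one (binary (v0 one) ⋏ mem (v0 one) ((A.shift o).shift one) ⋏ (v0 one ⬝ v0 o ≐ num 1)))

/-! ## The principles -/

/-- Every strongly countable `A ⊆ 2^ℕ` has a supremum for the lexicographic order. -/
def BWC1 : Formula :=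
  all (one ⇒ one) (all two (
    let A := v0 (one ⇒ one)
    let Y := v0 two
    isSubsetCantor A ⊸ bijectiveOnCantor A Y ⊸ ex one (isLexSup A (v0 one))))

/-- Every strongly countable `A ⊆ 2^ℕ` has a supremum for the pointwise order. -/
def BWC1pwo : Formula :=
  all (one ⇒ one) (all two (
    let A := v0 (one ⇒ one)
    let Y := v0 two
    isSubsetCantor A ⊸ bijectiveOnCantor A Y ⊸ ex one (isPointwiseSup A (v0 one))))

/-- If for every `n` there is exactly one `f ∈ 2^ℕ` with `Y(n, f) = 0`, then for every `n` there is
a finite sequence `w(0), …, w(n-1)` in `2^ℕ` with `Y(i, w(i)) = 0` for all `i < n`. -/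
def IND1 : Formula :=
  all (o ⇒ one ⇒ o) (
    let Y := v0 (o ⇒ one ⇒ o)
    all o (
      ex one (binary (v0 one) ⋏ (Y ⬝ v0 o ⬝ v0 one ≐ num 0)) ⋏
      all one (all one (binary (v1 one) ⊸ binary (v0 one) ⊸
        (Y ⬝ v0 o ⬝ v1 one ≐ num 0) ⊸ (Y ⬝ v0 o ⬝ v0 one ≐ num 0) ⊸
        eqAt one (v1 one) (v0 one)))) ⊸
    all o (ex (o ⇒ one) (
      let w := v0 (o ⇒ one)
      all o (lt (v0 o) (v1 o) ⊸ binary (w ⬝ v0 o) ⋏ (Y ⬝ v0 o ⬝ (w ⬝ v0 o) ≐ num 0)))))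

/-- Every strongly countable `A ⊆ [0, 1]` can be enumerated: there is a sequence `(x_n)` of reals in
`A` such that for all reals `x`, `x ∈ A` iff `x = x_n` for some `n`. -/
def cocode1 : Formula :=
  all (one ⇒ one) (all two (
    let A := v0 (one ⇒ one)
    let Y := v0 two
    isSubsetUnitInterval A ⊸ bijectiveOnReals A Y ⊸
    ex (o ⇒ one) (
      let x := v0 (o ⇒ one)
      all o (isReal (x ⬝ v0 o) ⋏ mem (x ⬝ v0 o) A) ⋏
      all one (isReal (v0 one) ⊸
        (mem (v0 one) A ⟺ ex o (realEq (x ⬝ v0 o) (v0 one)))))))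

end HOA

set_option autoImplicit false

namespace HOA

/-! ## Substitution -/

/-! Everything passes through one principle of unique choice, `UAC`: if every W(n, ·) has exactly
one zero among the sequences of numbers, then these zeros form a sequence. Each side of the two
equivalences is shown to be equivalent to `UAC`.

Derivations are never written out. A Henkin construction gives completeness (`proves_of_sat`), so it
suffices to argue inside an arbitrary extensional model, whose numbers may be nonstandard. There
`Rep` tracks which functions and predicates are given by elements of the model, and the rationals of
the model are read in the ordered field of fractions of its semiring of numbers.

Strong third-order hypotheses come for free. A functional with exactly one zero f decides whether h
vanishes, by testing f + h; this yields ∃² (`hasE_of_unique`, with variants `hasE_of_unique_bin` and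
`hasE_of_unique_real`). A strongly countable set supplies such a functional: fix the element on
which Y is 0, together with one rational approximation that certifies its membership. Given ∃², all
arithmetical predicates have characteristic functions, so comprehension, induction and minimization
are available for them.

From `UAC`, inverting Y enumerates a strongly countable subset of Cantor space, and both suprema are
arithmetical in the enumeration (`UAC.pwo`, `UAC.bwc`); `UAC.ind` is immediate. For sets of reals a
canonical representative of each real, built from dyadic floors, makes unique choice applicable
(`exists_canonical`, `UAC.cocode`).

Conversely, one may assume that the unique zeros f_n are nonzero binary sequences (`BinUAC.uac`).
Put f_n into column n of an otherwise empty matrix. These matrices form a strongly countable set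
(`exists_columns`), and the pointwise supremum is the matrix with all columns f_n. For `cocode1` the
matrices are coded as reals through binary expansions with infinitely many zeros. For the
lexicographic order the n-th matrix carries f_0, …, f_{n-1}; it exists by `IND1`, the matrices
increase pointwise, and their lexicographic supremum is their union (`binUAC_of_bwc_ind`). -/

/-- The environment `e`, extended by a value for the variable bound by a new innermost quantifier
over type `σ`. -/
def push {D : FT → Type} {σ : FT} (x : D σ) (e : (τ : FT) → ℕ → D τ) : (τ : FT) → ℕ → D τ :=
  fun τ n =>
    if h : τ = σ then
      match n with
      | 0 => h.symm ▸ x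
      | k + 1 => e τ k
    else e τ n

section push
variable {D : FT → Type} {σ : FT} (x : D σ) (e : (τ : FT) → ℕ → D τ)

@[simp] theorem push_zero : push x e σ 0 = x := by simp [push]

@[simp] theorem push_succ (k : ℕ) : push x e σ (k + 1) = e σ k := by simp [push]

theorem push_of_ne {τ : FT} (h : τ ≠ σ) (n : ℕ) : push x e τ n = e τ n := by simp [push, h]

end push

namespace Term

theorem single_eq_push {σ : FT} (t : Term σ) : single t = push t var := by
  funext τ n
  unfold single push
  rfl

theorem rename_eq_subst (r : FT → ℕ → ℕ) {σ : FT} (t : Term σ) :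
    t.rename r = t.subst fun τ n => var τ (r τ n) := by
  induction t <;> simp_all [rename, subst]

theorem subst_subst (s s' : (τ : FT) → ℕ → Term τ) {σ : FT} (t : Term σ) :
    (t.subst s).subst s' = t.subst fun τ n => (s τ n).subst s' := by
  induction t <;> simp_all [subst]

@[simp] theorem subst_var {σ : FT} (t : Term σ) : t.subst var = t := by
  induction t <;> simp_all [subst]

theorem shift_eq_subst (σ : FT) {τ : FT} (t : Term τ) :
    t.shift σ = t.subst fun ρ n => var ρ (if ρ = σ then n + 1 else n) := rename_eq_subst _ t

theorem shift_subst_push {σ τ : FT} (u : Term σ) (s : (τ : FT) → ℕ → Term τ) (t : Term τ) :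
    (t.shift σ).subst (push u s) = t.subst s := by
  rw [shift_eq_subst, subst_subst]
  congr 1
  funext ρ n
  by_cases h : ρ = σ
  · subst h; simp [subst]
  · simp [subst, h, push_of_ne]

/-- Going below a binder, instantiation and environments all become instances of `push`, so the
composition laws need only a few computations. -/
theorem up_eq_push (σ : FT) (s : (τ : FT) → ℕ → Term τ) :
    up σ s = push (var σ 0) fun τ n => (s τ n).shift σ := by
  funext τ n
  by_cases h : τ = σ
  · subst h; cases n <;> simp [up]
  · simp [up, h, push_of_ne]

@[simp] theorem up_zero (σ : FT) (s : (τ : FT) → ℕ → Term τ) : up σ s σ 0 = var σ 0 := by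
  simp [up_eq_push]

theorem shift_subst_up (σ : FT) (s : (τ : FT) → ℕ → Term τ) {τ : FT} (t : Term τ) :
    (t.shift σ).subst (up σ s) = (t.subst s).shift σ := by
  rw [up_eq_push, shift_subst_push, shift_eq_subst, subst_subst]
  simp only [shift_eq_subst]

theorem push_subst {σ : FT} (u : Term σ) (s s' : (τ : FT) → ℕ → Term τ) :
    (fun τ n => (push u s τ n).subst s') = push (u.subst s') fun τ n => (s τ n).subst s' := by
  funext τ n
  by_cases h : τ = σ
  · subst h; cases n <;> simp
  · simp [h, push_of_ne]

theorem up_subst_push {σ : FT} (u : Term σ) (s s' : (τ : FT) → ℕ → Term τ) :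
    (fun τ n => (up σ s τ n).subst (push u s')) = push u fun τ n => (s τ n).subst s' := by
  rw [up_eq_push, push_subst]
  simp [subst, shift_subst_push]

theorem up_subst_up (σ : FT) (s s' : (τ : FT) → ℕ → Term τ) :
    (fun τ n => (up σ s τ n).subst (up σ s')) = up σ fun τ n => (s τ n).subst s' := by
  rw [up_eq_push σ s', up_subst_push, up_eq_push]
  congr 1
  funext τ n
  rw [shift_eq_subst, subst_subst]
  simp only [shift_eq_subst]

theorem up_var (σ : FT) : up σ var = var := by
  funext τ n
  by_cases h : τ = σ
  · subst h; cases n <;> simp [up, shift, rename]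
  · simp [up, h, shift, rename]

end Term

namespace Formula
open Term

theorem subst_subst (φ : Formula) (s s' : (τ : FT) → ℕ → Term τ) :
    (φ.subst s).subst s' = φ.subst fun τ n => (s τ n).subst s' := by
  induction φ generalizing s s' with
  | all σ φ ih => simp only [subst, ih, up_subst_up]
  | _ => simp_all [subst, Term.subst_subst]

@[simp] theorem subst_var (φ : Formula) : φ.subst var = φ := by
  induction φ with
  | all σ φ ih => simp [subst, up_var, ih]
  | _ => simp_all [subst]

theorem inst_eq {σ : FT} (φ : Formula) (t : Term σ) : φ.inst t = φ.subst (push t var) := by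
  rw [inst, single_eq_push]

theorem subst_up_inst {σ : FT} (φ : Formula) (s : (τ : FT) → ℕ → Term τ) (t : Term σ) :
    (φ.subst (up σ s)).inst t = φ.subst (push t s) := by
  rw [inst_eq, subst_subst, up_subst_push]
  simp

theorem inst_subst {σ : FT} (φ : Formula) (s : (τ : FT) → ℕ → Term τ) (t : Term σ) :
    (φ.inst t).subst s = (φ.subst (up σ s)).inst (t.subst s) := by
  rw [subst_up_inst, inst_eq, subst_subst, push_subst]
  simp [Term.subst]

theorem shift_subst_push {σ : FT} (φ : Formula) (s : (τ : FT) → ℕ → Term τ) (t : Term σ) :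
    (φ.shift σ).subst (push t s) = φ.subst s := by
  rw [shift, subst_subst]
  simp [Term.shift_subst_push, Term.subst]

theorem shift_subst_up (φ : Formula) (σ : FT) (s : (τ : FT) → ℕ → Term τ) :
    (φ.shift σ).subst (up σ s) = (φ.subst s).shift σ := by
  rw [up_eq_push, shift_subst_push, shift, subst_subst]
  congr 1
  funext τ n
  rw [shift_eq_subst]
  simp [shift_eq_subst, Term.subst]

end Formula

open Term (up push_subst up_subst_push shift_eq_subst rename)
open Formula (all ex bot)

@[simp] theorem eqAt_subst {σ : FT} (s t : Term σ) (e : (τ : FT) → ℕ → Term τ) :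
    (eqAt σ s t).subst e = eqAt σ (s.subst e) (t.subst e) := by
  induction σ generalizing e with
  | nat => rfl
  | arrow σ τ _ ih => simp [eqAt, Formula.subst, Term.subst, ih, Term.shift_subst_up]

theorem eqAt_arrow_inst {σ τ : FT} (s t : Term (σ ⇒ τ)) (u : Term σ) :
    (eqAt τ (s.shift σ ⬝ v0 σ) (t.shift σ ⬝ v0 σ)).inst u = eqAt τ (s ⬝ u) (t ⬝ u) := by
  simp [Formula.inst_eq, Term.subst, Term.shift_subst_push]

theorem QF.subst {φ : Formula} (h : φ.QF) (s : (τ : FT) → ℕ → Term τ) : (φ.subst s).QF := by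
  induction φ with
  | imp φ ψ h₁ h₂ => exact ⟨h₁ h.1, h₂ h.2⟩
  | all => exact h.elim
  | _ => trivial

/-- The substitution that replaces `var 0 0` by its successor. -/
def succSubst : (τ : FT) → ℕ → Term τ := fun τ n =>
  if h : τ = o then
    match n with
    | 0 => h.symm ▸ (Term.succ ⬝ v0 o)
    | k + 1 => Term.var τ (k + 1)
  else Term.var τ n

theorem succSubst_eq_push : succSubst = push (Term.succ ⬝ v0 o) fun τ n => (Term.var τ n).shift o := by
  funext τ n
  by_cases h : τ = o
  · subst h; cases n <;> simp [succSubst, Term.shift, rename]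
  · simp [succSubst, h, push_of_ne, Term.shift, rename]

/-- `RCA0ω` is closed under substitution. -/
theorem RCA0ω.subst_mem {φ : Formula} (h : φ ∈ RCA0ω) (s : (τ : FT) → ℕ → Term τ) :
    φ.subst s ∈ RCA0ω := by
  have h' : RCA0ω φ := h
  change RCA0ω _
  cases h' with
  | succ_ne_zero t => exact .succ_ne_zero (t.subst s)
  | succ_inj t u => exact .succ_inj (t.subst s) (u.subst s)
  | K_eq σ τ x y => simpa [Term.subst] using RCA0ω.K_eq σ τ (x.subst s) (y.subst s)
  | S_eq ρ σ τ x y z =>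
      simpa [Term.subst] using RCA0ω.S_eq ρ σ τ (x.subst s) (y.subst s) (z.subst s)
  | R_zero f m => exact .R_zero (f.subst s) (m.subst s)
  | R_succ f m n => exact .R_succ (f.subst s) (m.subst s) (n.subst s)
  | extensionality σ τ x y z =>
      simpa [Term.subst, Formula.subst] using
        RCA0ω.extensionality σ τ (x.subst s) (y.subst s) (z.subst s)
  | induction φ hφ =>
      have := RCA0ω.induction (φ.subst (up o s)) (QF.subst hφ _)
      change RCA0ω (_ ⊸ all o (_ ⊸ (φ.subst (up o s)).subst succSubst) ⊸ _) at this
      change RCA0ω ((φ.inst Term.zero).subst s ⊸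
        all o (φ.subst (up o s) ⊸ (φ.subst succSubst).subst (up o s)) ⊸ all o (φ.subst (up o s)))
      rw [Formula.inst_subst]
      change RCA0ω ((φ.subst (up o s)).inst Term.zero ⊸ _)
      convert this using 4
      rw [Formula.subst_subst, Formula.subst_subst, succSubst_eq_push, push_subst, up_subst_push]
      congr 1
      simp only [Term.shift_subst_up]
      simp [Term.subst, shift_eq_subst]
  | choice φ hφ =>
      have := RCA0ω.choice (φ.subst (up o (up one s))) (QF.subst hφ _)
      change RCA0ω (all one (ex o (φ.subst (up o (up one s)))) ⊸ ex two (all one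
        (((φ.shift two).inst (v0 two ⬝ v0 one)).subst (up one (up two s)))))
      convert this using 4
      rw [Formula.inst_subst]
      have h' : Term.subst (up one (up two s)) (v0 two ⬝ v0 one) = v0 two ⬝ v0 one := by
        simp [Term.subst, up, Term.shift, rename]
      have h1 : (fun τ n => ((Term.var τ n).shift two).subst (push (v0 two ⬝ v0 one) Term.var)) =
          push (v0 two ⬝ v0 one) fun τ n => (Term.var τ n).shift two := by
        funext τ n
        by_cases h0 : τ = o
        · subst h0; cases n <;> simp [Term.shift, rename, Term.subst]
        · simp [Term.shift, rename, Term.subst, h0, push_of_ne]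
      rw [h', Formula.inst_eq, Formula.inst_eq, Formula.shift, Formula.shift, Formula.subst_subst,
        Formula.subst_subst, Formula.subst_subst, Formula.subst_subst, h1, up_subst_push,
        up_subst_push]
      congr 1
      funext τ n
      have h2 (t : Term τ) : (t.subst fun τ n => (Term.var τ n).shift two) = t.shift two := by
        simp [shift_eq_subst, Term.subst]
      have h3 (t : Term τ) : (t.shift two).shift one = (t.shift one).shift two := by
        simp only [shift_eq_subst, Term.subst_subst, Term.subst]
        congr 1
        funext ρ n
        by_cases h : ρ = one <;> by_cases h' : ρ = two <;> simp [h, h']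
      -- Only variables of the types `o`, `one` and `two` meet a binder or an instantiation; any
      -- other type reduces to commuting two shifts.
      by_cases h4 : τ = o
      · subst h4
        rcases n with _ | n
        · simp [Term.shift, rename, Term.subst, up]
        · simp only [push_succ, h2]
          simp [Term.shift, rename, Term.subst, up]
          exact h3 _
      simp only [push_of_ne _ _ h4, h2]
      by_cases h5 : τ = one
      · subst h5
        cases n <;> simp [Term.shift, rename, Term.subst, up, push_of_ne] 
        exact h3 _
      by_cases h6 : τ = two
      · subst h6
        simp [Term.shift, rename, Term.subst, up, push_of_ne] 
        exact h3 _
      simp [Term.shift, rename, Term.subst, up, push_of_ne, h4, h5, h6] 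
      exact h3 _

/-! ## Derived rules -/

namespace Derives
variable {T : Set Formula} {Δ Δ' : List Formula} {φ ψ : Formula}

theorem weaken (h : Derives T Δ φ) (hs : Δ ⊆ Δ') : Derives T Δ' φ := by
  induction h generalizing Δ' with
  | ax h => exact .ax h
  | hyp h => exact .hyp (hs h)
  | impI _ ih => exact .impI (ih (List.cons_subset_cons _ hs))
  | impE _ _ ih₁ ih₂ => exact .impE (ih₁ hs) (ih₂ hs)
  | raa _ ih => exact .raa (ih (List.cons_subset_cons _ hs))
  | allI _ ih => exact .allI (ih (List.map_subset _ hs))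
  | allE t _ ih => exact .allE t (ih hs)
  | eqRefl t => exact .eqRefl t
  | eqSubst φ _ _ ih₁ ih₂ => exact .eqSubst φ (ih₁ hs) (ih₂ hs)

theorem subst (hT : ∀ φ ∈ T, ∀ s, φ.subst s ∈ T) (h : Derives T Δ φ)
    (s : (τ : FT) → ℕ → Term τ) : Derives T (Δ.map (·.subst s)) (φ.subst s) := by
  induction h generalizing s with
  | ax h => exact .ax (hT _ h s)
  | hyp h => exact .hyp (List.mem_map_of_mem h)
  | impI _ ih => exact .impI (ih s)
  | impE _ _ ih₁ ih₂ => exact .impE (ih₁ s) (ih₂ s)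
  | raa _ ih => exact .raa (ih s)
  | @allI Δ σ φ _ ih =>
      refine .allI ?_
      have := ih (up σ s)
      simpa [List.map_map, Function.comp_def, Formula.shift_subst_up] using this
  | allE t _ ih =>
      rw [Formula.inst_subst]
      exact .allE _ (ih s)
  | eqRefl t => exact .eqRefl _
  | eqSubst φ _ _ ih₁ ih₂ =>
      rw [Formula.inst_subst]
      have := ih₂ s
      rw [Formula.inst_subst] at this
      exact .eqSubst _ (ih₁ s) this

theorem botE (h : Derives T Δ bot) : Derives T Δ φ :=
  .raa (h.weaken (List.subset_cons_self _ _))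

theorem cut (h : Derives T Δ φ) (h' : Derives T (φ :: Δ) ψ) : Derives T Δ ψ :=
  .impE (.impI h') h

end Derives

/-! ## Bounds on free variables -/

/-- Only finitely many variables occur in a term. Phrasing this through substitutions avoids
defining the set of free variables. -/
theorem Term.exists_bound {σ : FT} (t : Term σ) : ∃ b, ∀ s s' : (τ : FT) → ℕ → Term τ,
    (∀ τ, ∀ n < b, s τ n = s' τ n) → t.subst s = t.subst s' := by
  induction t with
  | var σ n => exact ⟨n + 1, fun s s' h => h σ n n.lt_succ_self⟩
  | app t u ht hu =>
      obtain ⟨b, hb⟩ := ht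
      obtain ⟨c, hc⟩ := hu
      refine ⟨max b c, fun s s' h => ?_⟩
      simp only [Term.subst]
      rw [hb s s' fun τ n hn => h τ n (lt_max_of_lt_left hn),
        hc s s' fun τ n hn => h τ n (lt_max_of_lt_right hn)]
  | _ => exact ⟨0, fun _ _ _ => rfl⟩

theorem Formula.exists_bound (φ : Formula) : ∃ b, ∀ s s' : (τ : FT) → ℕ → Term τ,
    (∀ τ, ∀ n < b, s τ n = s' τ n) → φ.subst s = φ.subst s' := by
  induction φ with
  | eq t u =>
      obtain ⟨b, hb⟩ := t.exists_bound
      obtain ⟨c, hc⟩ := u.exists_bound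
      refine ⟨max b c, fun s s' h => ?_⟩
      simp only [Formula.subst]
      rw [hb s s' fun τ n hn => h τ n (lt_max_of_lt_left hn),
        hc s s' fun τ n hn => h τ n (lt_max_of_lt_right hn)]
  | bot => exact ⟨0, fun _ _ _ => rfl⟩
  | imp φ ψ hφ hψ =>
      obtain ⟨b, hb⟩ := hφ
      obtain ⟨c, hc⟩ := hψ
      refine ⟨max b c, fun s s' h => ?_⟩
      simp only [Formula.subst]
      rw [hb s s' fun τ n hn => h τ n (lt_max_of_lt_left hn),
        hc s s' fun τ n hn => h τ n (lt_max_of_lt_right hn)]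
  | all σ φ hφ =>
      obtain ⟨b, hb⟩ := hφ
      refine ⟨b, fun s s' h => ?_⟩
      simp only [Formula.subst]
      rw [hb (up σ s) (up σ s') fun τ n hn => ?_]
      by_cases hτ : τ = σ
      · subst hτ
        rcases n with _ | n
        · simp
        · simp [up, h τ n (by omega)]
      · simp [up, hτ, h τ n hn]

theorem exists_bound_list (Δ : List Formula) : ∃ b, ∀ φ ∈ Δ, ∀ s s' : (τ : FT) → ℕ → Term τ,
    (∀ τ, ∀ n < b, s τ n = s' τ n) → φ.subst s = φ.subst s' := by
  induction Δ with
  | nil => exact ⟨0, by simp⟩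
  | cons φ Δ ih =>
      obtain ⟨b, hb⟩ := ih
      obtain ⟨c, hc⟩ := φ.exists_bound
      refine ⟨max b c, fun ψ hψ s s' h => ?_⟩
      rcases List.mem_cons.1 hψ with rfl | hψ
      · exact hc s s' fun τ n hn => h τ n (lt_max_of_lt_right hn)
      · exact hb ψ hψ s s' fun τ n hn => h τ n (lt_max_of_lt_left hn)

/-- A fresh variable may be used as an eigenvariable. -/
theorem Derives.exists_fresh {T : Set Formula} (hT : ∀ φ ∈ T, ∀ s, φ.subst s ∈ T)
    (Δ : List Formula) (σ : FT) (φ : Formula) :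
    ∃ k, Derives T Δ (φ.inst (Term.var σ k)) → Derives T Δ (all σ φ) := by
  obtain ⟨b, hb⟩ := exists_bound_list (φ :: Δ)
  refine ⟨b, fun h => .allI ?_⟩
  -- The fresh variable becomes the bound variable 0 and the other variables of type `σ` move up by
  -- one, so on `Δ` this agrees with the shift that `allI` demands.
  let r : (τ : FT) → ℕ → Term τ := fun τ n =>
    if τ = σ then if n = b then Term.var τ 0 else Term.var τ (n + 1) else Term.var τ n
  have hr : ∀ τ, ∀ n < b, r τ n = (Term.var τ n).shift σ := by
    intro τ n hn
    by_cases hτ : τ = σ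
    · simp [r, hτ, hn.ne, Term.shift, Term.rename]
    · simp [r, hτ, Term.shift, Term.rename]
  have h1 := h.subst hT r
  have h2 : Δ.map (·.subst r) = Δ.map (Formula.shift σ) := by
    refine List.map_congr_left fun ψ hψ => ?_
    exact hb ψ (List.mem_cons_of_mem _ hψ) _ _ hr
  have h3 : (φ.inst (Term.var σ b)).subst r = φ := by
    rw [Formula.inst_subst, Formula.subst_up_inst]
    conv_rhs => rw [← Formula.subst_var φ]
    refine hb φ List.mem_cons_self _ _ fun τ n hn => ?_
    by_cases hτ : τ = σ
    · subst hτ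
      rcases n with _ | n
      · simp [Term.subst, r]
      · have : n ≠ b := by omega
        simp [r, this]
    · rw [push_of_ne _ _ hτ]
      simp [r, hτ]
  rwa [h2, h3] at h1

/-! ## Countability of the language -/

namespace FT

def code : FT → ℕ
  | nat => 0
  | arrow σ τ => Nat.pair σ.code τ.code + 1

theorem code_injective : Function.Injective code := by
  intro σ
  induction σ with
  | nat => intro τ h; cases τ <;> simp_all [code]
  | arrow σ τ h₁ h₂ =>
      intro ρ h
      cases ρ with
      | nat => simp [code] at h
      | arrow σ' τ' =>
          simp only [code, add_left_inj, Nat.pair_eq_pair] at h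
          rw [h₁ h.1, h₂ h.2]

instance : Countable FT := code_injective.countable

end FT

namespace Term

/-- The type of an application does not determine the type of its argument, hence the latter is
stored in the code. -/
def code : {σ : FT} → Term σ → ℕ
  | _, var σ n => Nat.pair 0 (Nat.pair σ.code n)
  | _, app (σ := σ) s t => Nat.pair 1 (Nat.pair σ.code (Nat.pair s.code t.code))
  | _, zero => Nat.pair 2 0
  | _, succ => Nat.pair 3 0
  | _, K σ τ => Nat.pair 4 (Nat.pair σ.code τ.code)
  | _, S ρ σ τ => Nat.pair 5 (Nat.pair ρ.code (Nat.pair σ.code τ.code))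
  | _, R => Nat.pair 6 0

theorem code_injective {σ : FT} : Function.Injective (code (σ := σ)) := by
  -- The induction needs a free type index, so the two terms are compared by heterogeneous equality.
  suffices H : ∀ {σ : FT} (s : Term σ) {τ : FT} (t : Term τ), σ = τ → s.code = t.code → HEq s t by
    exact fun s t h => eq_of_heq (H s t rfl h)
  clear σ
  intro σ s
  induction s with
  | app s u hs hu =>
      intro τ t hτ h
      cases t with
      | app s' u' =>
          simp only [code, Nat.pair_eq_pair, true_and] at h
          obtain rfl := FT.code_injective h.1
          subst hτ
          obtain rfl := eq_of_heq (hs s' rfl h.2.1)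
          obtain rfl := eq_of_heq (hu u' rfl h.2.2)
          rfl
      | _ => simp [code, Nat.pair_eq_pair] at h
  | var =>
      intro τ t hτ h
      subst hτ
      cases t <;> simp_all [code, Nat.pair_eq_pair]
  | K σ ρ =>
      intro τ t hτ h
      cases t <;> simp_all [code, Nat.pair_eq_pair, FT.code_injective.eq_iff]
      obtain ⟨rfl, rfl, -⟩ := hτ
      rfl
  | S =>
      intro τ t hτ h
      cases t <;> simp_all [code, Nat.pair_eq_pair, FT.code_injective.eq_iff]
      obtain ⟨⟨rfl, rfl, rfl⟩, -⟩ := hτ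
      rfl
  | _ =>
      intro τ t hτ h
      cases t <;> simp_all [code, Nat.pair_eq_pair]

end Term

namespace Formula

def code : Formula → ℕ
  | eq s t => Nat.pair 0 (Nat.pair s.code t.code)
  | bot => Nat.pair 1 0
  | imp φ ψ => Nat.pair 2 (Nat.pair φ.code ψ.code)
  | all σ φ => Nat.pair 3 (Nat.pair σ.code φ.code)

theorem code_injective : Function.Injective code := by
  intro φ
  induction φ with
  | eq s t =>
      intro ψ h
      cases ψ <;> simp_all [code, Nat.pair_eq_pair, Term.code_injective.eq_iff]
  | bot =>
      intro ψ h
      cases ψ <;> simp_all [code, Nat.pair_eq_pair]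
  | imp φ ψ h₁ h₂ =>
      intro χ h
      cases χ with
      | imp φ' ψ' =>
          simp only [code, Nat.pair_eq_pair, true_and] at h
          rw [h₁ h.1, h₂ h.2]
      | _ => simp [code, Nat.pair_eq_pair] at h
  | all σ φ h₁ =>
      intro χ h
      cases χ with
      | all σ' φ' =>
          simp only [code, Nat.pair_eq_pair, true_and] at h
          rw [FT.code_injective h.1, h₁ h.2]
      | _ => simp [code, Nat.pair_eq_pair] at h

instance : Countable Formula := code_injective.countable

end Formula

/-! ## Henkin sets -/

/-- Every consistent list of formulas is contained in a consistent, complete set of formulas in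
which every universal formula that fails has a counterexample. -/
theorem exists_henkin {T : Set Formula} (hT : ∀ φ ∈ T, ∀ s, φ.subst s ∈ T) {Δ₀ : List Formula}
    (h₀ : ¬ Derives T Δ₀ bot) :
    ∃ Γ : Set Formula, (∀ φ ∈ Δ₀, φ ∈ Γ) ∧
      (∀ Δ : List Formula, (∀ φ ∈ Δ, φ ∈ Γ) → ¬ Derives T Δ bot) ∧
      (∀ φ, φ ∈ Γ ∨ ∼φ ∈ Γ) ∧
      ∀ σ φ, all σ φ ∈ Γ ∨ ∃ t : Term σ, ∼(φ.inst t) ∈ Γ := by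
  have step : ∀ (Δ : {Δ : List Formula // ¬ Derives T Δ bot}) (p : FT × Formula),
      ∃ Δ' : {Δ : List Formula // ¬ Derives T Δ bot}, Δ.1 ⊆ Δ'.1 ∧
        (p.2 ∈ Δ'.1 ∨ ∼p.2 ∈ Δ'.1) ∧
        (all p.1 p.2 ∈ Δ'.1 ∨ ∃ t : Term p.1, ∼(p.2.inst t) ∈ Δ'.1) := by
    rintro ⟨Δ, hΔ⟩ ⟨σ, φ⟩
    obtain ⟨Δ₁, h₁, hs₁, hφ⟩ : ∃ Δ₁, ¬ Derives T Δ₁ bot ∧ Δ ⊆ Δ₁ ∧ (φ ∈ Δ₁ ∨ ∼φ ∈ Δ₁) := by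
      by_cases h : Derives T (φ :: Δ) bot
      · by_cases h' : Derives T (∼φ :: Δ) bot
        · exact absurd ((Derives.raa h').cut h) hΔ
        · exact ⟨∼φ :: Δ, h', List.subset_cons_self _ _, .inr List.mem_cons_self⟩
      · exact ⟨φ :: Δ, h, List.subset_cons_self _ _, .inl List.mem_cons_self⟩
    -- If the universal formula cannot be added, its failure at a fresh variable can: otherwise that
    -- instance would be derivable and could be generalized. As the lists are finite, variables
    -- serve as Henkin witnesses and no new constants are needed.
    by_cases h : Derives T (all σ φ :: Δ₁) bot
    · obtain ⟨k, hk⟩ := Derives.exists_fresh hT Δ₁ σ φ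
      refine ⟨⟨∼(φ.inst (Term.var σ k)) :: Δ₁, fun h' => h₁ ((hk (.raa h')).cut h)⟩,
        fun _ hx => List.mem_cons_of_mem _ (hs₁ hx), hφ.imp (List.mem_cons_of_mem _)
          (List.mem_cons_of_mem _), .inr ⟨_, List.mem_cons_self⟩⟩
    · exact ⟨⟨all σ φ :: Δ₁, h⟩, fun _ hx => List.mem_cons_of_mem _ (hs₁ hx),
        hφ.imp (List.mem_cons_of_mem _) (List.mem_cons_of_mem _), .inl List.mem_cons_self⟩
  choose next hsub hdec hall using step
  have : Nonempty (FT × Formula) := ⟨(o, bot)⟩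
  obtain ⟨enum, henum⟩ := exists_surjective_nat (FT × Formula)
  let seq : ℕ → {Δ : List Formula // ¬ Derives T Δ bot} :=
    fun n => Nat.rec ⟨Δ₀, h₀⟩ (fun n Δ => next Δ (enum n)) n
  have hmono : ∀ m n, m ≤ n → (seq m).1 ⊆ (seq n).1 := by
    intro m n h
    induction h with
    | refl => exact List.Subset.refl _
    | step _ ih => exact List.Subset.trans ih (hsub _ _)
  refine ⟨{φ | ∃ n, φ ∈ (seq n).1}, fun φ h => ⟨0, h⟩, fun Δ hΔ hbot => ?_, fun φ => ?_,
    fun σ φ => ?_⟩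
  · obtain ⟨n, hn⟩ : ∃ n, Δ ⊆ (seq n).1 := by
      clear hbot
      induction Δ with
      | nil => exact ⟨0, List.nil_subset _⟩
      | cons φ Δ ih =>
          obtain ⟨n, hn⟩ := ih fun ψ h => hΔ ψ (List.mem_cons_of_mem _ h)
          obtain ⟨m, hm⟩ := hΔ φ List.mem_cons_self
          exact ⟨max m n, List.cons_subset.2 ⟨hmono _ _ (le_max_left m n) hm,
            List.Subset.trans hn (hmono _ _ (le_max_right m n))⟩⟩
    exact (seq n).2 (hbot.weaken hn)
  · obtain ⟨n, hn⟩ := henum (o, φ)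
    have := hdec (seq n) (enum n)
    rw [hn] at this
    exact this.imp (fun h => ⟨n + 1, by simpa [seq, hn] using h⟩)
      fun h => ⟨n + 1, by simpa [seq, hn] using h⟩
  · obtain ⟨n, hn⟩ := henum (σ, φ)
    have := hall (seq n) (enum n)
    rw [hn] at this
    exact this.imp (fun h => ⟨n + 1, by simpa [seq, hn] using h⟩)
      fun ⟨t, h⟩ => ⟨t, n + 1, by simpa [seq, hn] using h⟩

end HOA

namespace HOA
open Term (up push_subst up_subst_push shift_eq_subst rename)
open Formula (all ex bot)

/-! ## Models -/

/-- An extensional applicative structure over all finite types. -/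
structure Struct where
  D : FT → Type
  ap : {σ τ : FT} → D (σ ⇒ τ) → D σ → D τ
  zero : D o
  succ : D (o ⇒ o)
  K (σ τ : FT) : D (σ ⇒ τ ⇒ σ)
  S (ρ σ τ : FT) : D ((ρ ⇒ σ ⇒ τ) ⇒ (ρ ⇒ σ) ⇒ ρ ⇒ τ)
  R : D ((o ⇒ o ⇒ o) ⇒ o ⇒ o ⇒ o)
  ext {σ τ : FT} {f g : D (σ ⇒ τ)} : (∀ x, ap f x = ap g x) → f = g
  succ_ne_zero (n : D o) : ap succ n ≠ zero
  succ_inj {m n : D o} : ap succ m = ap succ n → m = n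
  K_ap {σ τ : FT} (x : D σ) (y : D τ) : ap (ap (K σ τ) x) y = x
  S_ap {ρ σ τ : FT} (x : D (ρ ⇒ σ ⇒ τ)) (y : D (ρ ⇒ σ)) (z : D ρ) :
    ap (ap (ap (S ρ σ τ) x) y) z = ap (ap x z) (ap y z)
  R_zero (f : D (o ⇒ o ⇒ o)) (m : D o) : ap (ap (ap R f) m) zero = m
  R_succ (f : D (o ⇒ o ⇒ o)) (m n : D o) :
    ap (ap (ap R f) m) (ap succ n) = ap (ap f n) (ap (ap (ap R f) m) n)
namespace Struct

/-- The value of a term. -/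
def eval (M : Struct) (e : (σ : FT) → ℕ → M.D σ) : {σ : FT} → Term σ → M.D σ
  | _, .var σ n => e σ n
  | _, .app s t => M.ap (M.eval e s) (M.eval e t)
  | _, .zero => M.zero
  | _, .succ => M.succ
  | _, .K σ τ => M.K σ τ
  | _, .S ρ σ τ => M.S ρ σ τ
  | _, .R => M.R

/-- The truth of a formula. -/
def sat (M : Struct) : Formula → ((σ : FT) → ℕ → M.D σ) → Prop
  | .eq s t, e => M.eval e s = M.eval e t
  | .bot, _ => False
  | .imp φ ψ, e => M.sat φ e → M.sat ψ e
  | .all σ φ, e => ∀ x : M.D σ, M.sat φ (push x e)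

theorem push_eval (M : Struct) (e : (σ : FT) → ℕ → M.D σ) (s : (σ : FT) → ℕ → Term σ) {σ : FT}
    (u : Term σ) : (fun τ n => M.eval e (push u s τ n)) =
      push (D := M.D) (M.eval e u) fun τ n => M.eval e (s τ n) := by
  funext τ n
  by_cases h : τ = σ
  · subst h; cases n <;> simp
  · simp [h, push_of_ne]

theorem eval_subst (M : Struct) (e : (σ : FT) → ℕ → M.D σ) (s : (σ : FT) → ℕ → Term σ) {σ : FT}
    (t : Term σ) : M.eval e (t.subst s) = M.eval (fun τ n => M.eval e (s τ n)) t := by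
  induction t <;> simp_all [eval, Term.subst]

@[simp] theorem eval_shift (M : Struct) (e : (σ : FT) → ℕ → M.D σ) {σ τ : FT} (x : M.D σ)
    (t : Term τ) : M.eval (push x e) (t.shift σ) = M.eval e t := by
  rw [shift_eq_subst, eval_subst]
  congr 1
  funext ρ n
  by_cases h : ρ = σ
  · subst h; simp [eval]
  · simp [eval, h, push_of_ne]

theorem sat_subst (M : Struct) (φ : Formula) (e : (σ : FT) → ℕ → M.D σ)
    (s : (σ : FT) → ℕ → Term σ) :
    M.sat (φ.subst s) e ↔ M.sat φ fun τ n => M.eval e (s τ n) := by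
  induction φ generalizing e s with
  | eq s t => simp only [Formula.subst, sat, eval_subst]
  | bot => rfl
  | imp φ ψ hφ hψ => simp only [Formula.subst, sat, hφ, hψ]
  | all σ φ ih =>
      simp only [Formula.subst, sat, ih, Term.up_eq_push, push_eval, eval_shift]
      simp only [eval, push_zero]

theorem sat_inst (M : Struct) {σ : FT} (φ : Formula) (e : (σ : FT) → ℕ → M.D σ) (t : Term σ) :
    M.sat (φ.inst t) e ↔ M.sat φ (push (M.eval e t) e) := by
  rw [Formula.inst_eq, sat_subst, push_eval]
  rfl

@[simp] theorem sat_neg (M : Struct) (φ : Formula) (e) : M.sat (∼φ) e ↔ ¬ M.sat φ e := Iff.rfl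

@[simp] theorem sat_and (M : Struct) (φ ψ : Formula) (e) :
    M.sat (φ ⋏ ψ) e ↔ M.sat φ e ∧ M.sat ψ e := by
  simp [Formula.and, sat]

@[simp] theorem sat_or (M : Struct) (φ ψ : Formula) (e) :
    M.sat (φ ⋎ ψ) e ↔ M.sat φ e ∨ M.sat ψ e := by
  simp only [Formula.or, sat, sat_neg]
  tauto

@[simp] theorem sat_iff (M : Struct) (φ ψ : Formula) (e) :
    M.sat (φ ⟺ ψ) e ↔ (M.sat φ e ↔ M.sat ψ e) := by
  simp only [Formula.iff, sat, sat_and]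
  tauto

@[simp] theorem sat_ex (M : Struct) (σ : FT) (φ : Formula) (e) :
    M.sat (ex σ φ) e ↔ ∃ x : M.D σ, M.sat φ (push x e) := by
  simp [ex, sat]

@[simp] theorem sat_eqAt (M : Struct) {σ : FT} (s t : Term σ) (e) :
    M.sat (eqAt σ s t) e ↔ M.eval e s = M.eval e t := by
  induction σ generalizing e with
  | nat => rfl
  | arrow σ τ _ ih =>
      simp only [eqAt, sat, ih, eval, eval_shift, push_zero]
      exact ⟨fun h => M.ext h, fun h _ => by rw [h]⟩

end Struct

/-- A model of `RCA0ω`. Of induction and choice it is enough to have some simple instances. -/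
structure Model extends Struct where
  ind (f g h k : D one) : (ap f zero = ap g zero ∨ ap h zero = ap k zero) →
    (∀ n, (ap f n = ap g n ∨ ap h n = ap k n) →
      ap f (ap succ n) = ap g (ap succ n) ∨ ap h (ap succ n) = ap k (ap succ n)) →
    ∀ n, ap f n = ap g n ∨ ap h n = ap k n
  choice (g : D (one ⇒ o ⇒ o)) : (∀ f, ∃ n, ap (ap g f) n = zero) →
    ∃ F : D two, ∀ f, ap (ap g f) (ap F f) = zero
  eq_dec : ∃ F : D two, ∀ f, ap F f = zero ↔ ap f zero = ap f (ap succ zero)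

/-! ## Completeness -/

/-- A consistent complete set of formulas in which every universal formula that fails has a
counterexample. -/
structure Henkin (Γ : Set Formula) : Prop where
  consistent (Δ : List Formula) : (∀ φ ∈ Δ, φ ∈ Γ) → ¬ Derives RCA0ω Δ bot
  complete (φ : Formula) : φ ∈ Γ ∨ ∼φ ∈ Γ
  witness (σ : FT) (φ : Formula) : all σ φ ∈ Γ ∨ ∃ t : Term σ, ∼(φ.inst t) ∈ Γ

namespace Henkin
variable {Γ : Set Formula} (H : Henkin Γ)
include H

theorem mem_of_derives {Δ : List Formula} {φ : Formula} (hΔ : ∀ ψ ∈ Δ, ψ ∈ Γ)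
    (h : Derives RCA0ω Δ φ) : φ ∈ Γ := by
  rcases H.complete φ with h' | h'
  · exact h'
  · refine (H.consistent (∼φ :: Δ) ?_ (.impE (.hyp List.mem_cons_self)
      (h.weaken (List.subset_cons_self _ _)))).elim
    simpa [h'] using hΔ

theorem mem_ax {φ : Formula} (h : RCA0ω φ) : φ ∈ Γ :=
  H.mem_of_derives (Δ := []) (by simp) (.ax h)

theorem bot_notMem : bot ∉ Γ := fun h =>
  H.consistent [bot] (by simpa using h) (.hyp (by simp))

theorem mem_imp {φ ψ : Formula} : (φ ⊸ ψ) ∈ Γ ↔ (φ ∈ Γ → ψ ∈ Γ) := by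
  constructor
  · intro h h'
    exact H.mem_of_derives (Δ := [φ ⊸ ψ, φ]) (by simp [h, h'])
      (.impE (.hyp (by simp)) (.hyp (φ := φ) (by simp)))
  · intro h
    rcases H.complete φ with h' | h'
    · exact H.mem_of_derives (Δ := [ψ]) (by simp [h h']) (.impI (.hyp (by simp)))
    · exact H.mem_of_derives (Δ := [∼φ]) (by simp [h'])
        (.impI (Derives.botE (.impE (.hyp (φ := ∼φ) (by simp)) (.hyp (by simp)))))

theorem mem_all {σ : FT} {φ : Formula} : all σ φ ∈ Γ ↔ ∀ t : Term σ, φ.inst t ∈ Γ := by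
  constructor
  · intro h t
    exact H.mem_of_derives (Δ := [all σ φ]) (by simp [h]) (.allE t (.hyp (by simp)))
  · intro h
    rcases H.witness σ φ with h' | ⟨t, h'⟩
    · exact h'
    · exact (H.bot_notMem (H.mem_imp.1 h' (h t))).elim

omit H in
/-- The equality of the term model. -/
def eqv (Γ : Set Formula) : (σ : FT) → Term σ → Term σ → Prop
  | .nat, s, t => (s ≐ t) ∈ Γ
  | .arrow _ τ, s, t => ∀ u, eqv Γ τ (s ⬝ u) (t ⬝ u)

theorem eqAt_mem {σ : FT} (s t : Term σ) : eqAt σ s t ∈ Γ ↔ eqv Γ σ s t := by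
  induction σ with
  | nat => rfl
  | arrow σ τ _ ih => simp only [eqAt, eqv, H.mem_all, eqAt_arrow_inst, ih]

theorem eqv_refl {σ : FT} (s : Term σ) : eqv Γ σ s s := by
  induction σ with
  | nat => exact H.mem_of_derives (Δ := []) (by simp) (.eqRefl s)
  | arrow σ τ _ ih => exact fun u => ih _

theorem eqv_symm {σ : FT} {s t : Term σ} (h : eqv Γ σ s t) : eqv Γ σ t s := by
  induction σ with
  | nat =>
      refine H.mem_of_derives (Δ := [s ≐ t]) (by simpa [eqv] using h) ?_
      have := Derives.eqSubst (T := RCA0ω) (Δ := [s ≐ t]) (s := s) (t := t) (v0 o ≐ s.shift o)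
        (.hyp (by simp))
      simp only [Formula.inst_eq, Formula.subst, Term.shift_subst_push, Term.subst, push_zero,
        Term.subst_var] at this
      exact this (.eqRefl s)
  | arrow σ τ _ ih => exact fun u => ih (h u)

theorem eqv_trans {σ : FT} {s t u : Term σ} (h : eqv Γ σ s t) (h' : eqv Γ σ t u) :
    eqv Γ σ s u := by
  induction σ with
  | nat =>
      refine H.mem_of_derives (Δ := [s ≐ t, t ≐ u]) (by simpa using ⟨h, h'⟩) ?_
      have := Derives.eqSubst (T := RCA0ω) (Δ := [s ≐ t, t ≐ u]) (s := t) (t := u)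
        (s.shift o ≐ v0 o) (.hyp (by simp))
      simp only [Formula.inst_eq, Formula.subst, Term.shift_subst_push, Term.subst, push_zero,
        Term.subst_var] at this
      exact this (.hyp (by simp))
  | arrow σ τ _ ih => exact fun v => ih (h v) (h' v)

/-- Congruence in the function is built into `eqv`; congruence in the argument is the extensionality
axiom. -/
theorem eqv_app {σ τ : FT} {s s' : Term (σ ⇒ τ)} {t t' : Term σ} (h : eqv Γ (σ ⇒ τ) s s')
    (h' : eqv Γ σ t t') : eqv Γ τ (s ⬝ t) (s' ⬝ t') := by
  refine H.eqv_trans ?_ (h t')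
  have := H.mem_ax (.extensionality σ τ t t' s)
  rw [H.mem_imp, H.eqAt_mem, H.eqAt_mem] at this
  exact this h'

/-- The equality of the term model at type `σ`. -/
def setoid (σ : FT) : Setoid (Term σ) :=
  ⟨eqv Γ σ, H.eqv_refl, H.eqv_symm, H.eqv_trans⟩

/-- The class of a term in the term model. -/
def cls {σ : FT} (t : Term σ) : Quotient (H.setoid σ) := Quotient.mk _ t

/-- Application in the term model. -/
def ap {σ τ : FT} : Quotient (H.setoid (σ ⇒ τ)) → Quotient (H.setoid σ) → Quotient (H.setoid τ) :=
  Quotient.map₂ Term.app fun _ _ h _ _ h' => H.eqv_app h h'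

theorem mk_eq {σ : FT} {s t : Term σ} : H.cls s = H.cls t ↔ eqv Γ σ s t := Quotient.eq (r := H.setoid σ)

theorem mk_surj {σ : FT} (x : Quotient (H.setoid σ)) : ∃ t, x = H.cls t :=
  (Quotient.exists_rep x).imp fun _ h => h.symm

theorem mk_eq_nat {s t : Term o} : H.cls s = H.cls t ↔ (s ≐ t) ∈ Γ := H.mk_eq

theorem mk_eq_of_ax {σ : FT} {s t : Term σ} (h : RCA0ω (eqAt σ s t)) : H.cls s = H.cls t :=
  H.mk_eq.2 ((H.eqAt_mem s t).1 (H.mem_ax h))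

/-- The term structure of a Henkin set. -/
def struct : Struct where
  D σ := Quotient (H.setoid σ)
  ap := H.ap
  zero := H.cls .zero
  succ := H.cls .succ
  K σ τ := H.cls (.K σ τ)
  S ρ σ τ := H.cls (.S ρ σ τ)
  R := H.cls .R
  ext {σ τ f g} h := by
    obtain ⟨s, rfl⟩ := H.mk_surj f
    obtain ⟨t, rfl⟩ := H.mk_surj g
    exact H.mk_eq.2 fun u => H.mk_eq.1 (h (H.cls u))
  succ_ne_zero n h := by
    obtain ⟨t, rfl⟩ := H.mk_surj n
    exact H.bot_notMem (H.mem_imp.1 (H.mem_ax (.succ_ne_zero t)) (H.mk_eq.1 h))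
  succ_inj {m n} h := by
    obtain ⟨s, rfl⟩ := H.mk_surj m
    obtain ⟨t, rfl⟩ := H.mk_surj n
    exact H.mk_eq.2 (H.mem_imp.1 (H.mem_ax (.succ_inj s t)) (H.mk_eq.1 h))
  K_ap x y := by
    obtain ⟨s, rfl⟩ := H.mk_surj x
    obtain ⟨t, rfl⟩ := H.mk_surj y
    exact H.mk_eq_of_ax (.K_eq _ _ s t)
  S_ap x y z := by
    obtain ⟨s, rfl⟩ := H.mk_surj x
    obtain ⟨t, rfl⟩ := H.mk_surj y
    obtain ⟨u, rfl⟩ := H.mk_surj z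
    exact H.mk_eq_of_ax (.S_eq _ _ _ s t u)
  R_zero f m := by
    obtain ⟨s, rfl⟩ := H.mk_surj f
    obtain ⟨t, rfl⟩ := H.mk_surj m
    exact H.mk_eq_nat.2 (H.mem_ax (.R_zero s t))
  R_succ f m n := by
    obtain ⟨s, rfl⟩ := H.mk_surj f
    obtain ⟨t, rfl⟩ := H.mk_surj m
    obtain ⟨u, rfl⟩ := H.mk_surj n
    exact H.mk_eq_nat.2 (H.mem_ax (.R_succ s t u))

theorem eval_mk (e : (σ : FT) → ℕ → Term σ) {σ : FT} (t : Term σ) :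
    H.struct.eval (fun σ n => H.cls (e σ n)) t = H.cls (t.subst e) := by
  induction t with
  | app s t hs ht => simp only [Struct.eval, hs, ht]; rfl
  | _ => rfl

theorem push_mk (e : (σ : FT) → ℕ → Term σ) {σ : FT} (t : Term σ) :
    push (D := H.struct.D) (H.cls t) (fun σ n => H.cls (e σ n)) = fun σ n => H.cls (push t e σ n) := by
  funext τ n
  by_cases h : τ = σ
  · subst h
    cases n
    · rw [push_zero]; exact push_zero (D := H.struct.D) _ _
    · rw [push_succ]; exact push_succ (D := H.struct.D) _ _ _
  · rw [push_of_ne _ _ h]; exact push_of_ne (D := H.struct.D) _ _ h _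

/-- The truth lemma. The universal case works because every element of the term model is the class
of a term. -/
theorem sat_iff (e : (σ : FT) → ℕ → Term σ) (φ : Formula) :
    H.struct.sat φ (fun σ n => H.cls (e σ n)) ↔ φ.subst e ∈ Γ := by
  induction φ generalizing e with
  | eq s t => simp only [Struct.sat, eval_mk, Formula.subst]; exact H.mk_eq_nat
  | bot => exact ⟨False.elim, H.bot_notMem⟩
  | imp φ ψ hφ hψ => simp only [Struct.sat, Formula.subst, H.mem_imp, hφ, hψ]
  | all σ φ ih =>
      simp only [Struct.sat, Formula.subst, H.mem_all, Formula.subst_up_inst, ← ih]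
      constructor
      · intro h t
        rw [← H.push_mk]
        exact h (H.cls t)
      · intro h x
        obtain ⟨t, rfl⟩ := H.mk_surj x
        rw [H.push_mk]
        exact h t

theorem exists_env (e : (σ : FT) → ℕ → H.struct.D σ) :
    ∃ e' : (σ : FT) → ℕ → Term σ, e = fun σ n => H.cls (e' σ n) := by
  choose e' h using fun σ n => H.mk_surj (e σ n)
  exact ⟨e', funext fun σ => funext fun n => h σ n⟩

theorem nonempty_env : Nonempty ((σ : FT) → ℕ → H.struct.D σ) :=
  ⟨fun σ n => H.cls (Term.var σ n)⟩

theorem sat_ax {φ : Formula} (h : RCA0ω φ) (e) : H.struct.sat φ e := by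
  obtain ⟨e', rfl⟩ := H.exists_env e
  exact (H.sat_iff e' φ).2 (H.mem_ax (RCA0ω.subst_mem h e'))

theorem sat_choice (φ : Formula) (hφ : φ.QF) (e) (h : ∀ f : H.struct.D one, ∃ n : H.struct.D o,
    H.struct.sat φ (push n (push f e))) : ∃ F : H.struct.D two, ∀ f : H.struct.D one,
      H.struct.sat φ (push (H.struct.ap F f) (push f e)) := by
  have := H.sat_ax (.choice φ hφ) e
  simp only [Struct.sat, Struct.sat_ex, Struct.sat_inst] at this
  obtain ⟨F, hF⟩ := this h
  refine ⟨F, fun f => ?_⟩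
  have h1 := hF f
  rw [Formula.shift, Struct.sat_subst] at h1
  convert h1 using 1
  funext τ n
  simp only [Struct.eval, push_zero]
  by_cases h0 : τ = o
  · subst h0
    cases n <;> simp [Term.shift, rename, Struct.eval, push_of_ne]
  by_cases h1 : τ = one
  · subst h1; cases n <;> simp [Term.shift, rename, Struct.eval, push_of_ne]
  by_cases h2 : τ = two
  · subst h2; cases n <;> simp [Term.shift, rename, Struct.eval, push_of_ne]
  simp [Term.shift, rename, Struct.eval, push_of_ne, h0, h1, h2]

/-- The term model of a Henkin set. -/
def model : Model where
  toStruct := H.struct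
  ind f g h k := by
    obtain ⟨e⟩ := H.nonempty_env
    -- The disjunction of two equations is written classically as an implication, which keeps the
    -- formula quantifier-free.
    have := H.sat_ax (.induction (∼(Term.var one 0 ⬝ v0 o ≐ Term.var one 1 ⬝ v0 o) ⊸
      (Term.var one 2 ⬝ v0 o ≐ Term.var one 3 ⬝ v0 o)) ⟨⟨trivial, trivial⟩, trivial⟩)
      (push f (push g (push h (push k e))))
    change H.struct.sat (_ ⊸ all o (_ ⊸ Formula.subst _ succSubst) ⊸ _) _ at this
    simp only [Struct.sat, Struct.sat_inst, Struct.sat_subst, Struct.sat_neg, Struct.eval,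
      succSubst_eq_push, push_zero] at this
    simp [push_of_ne, Struct.eval, Term.shift, rename] at this
    simpa only [imp_iff_not_or, not_not] using this
  choice g h := by
    obtain ⟨e⟩ := H.nonempty_env
    have := H.sat_choice (Term.var (one ⇒ o ⇒ o) 0 ⬝ v0 one ⬝ v0 o ≐ Term.zero) trivial
      (push g e)
    simp [push_of_ne, Struct.eval, Struct.sat] at this
    exact this h
  eq_dec := by
    obtain ⟨e⟩ := H.nonempty_env
    -- Classical logic decides the equation for each `f`; quantifier-free choice collects the
    -- decisions into a functional.
    have := H.sat_choice ((v0 one ⬝ Term.zero ≐ v0 one ⬝ (Term.succ ⬝ Term.zero)) ⟺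
      (v0 o ≐ Term.zero)) ⟨⟨⟨trivial, trivial⟩, ⟨trivial, trivial⟩, trivial⟩, trivial⟩
      e
    simp [push_of_ne, Struct.eval, Struct.sat] at this
    obtain ⟨F, hF⟩ := this fun f => by
      by_cases h : H.struct.ap f H.struct.zero =
          H.struct.ap f (H.struct.ap H.struct.succ H.struct.zero)
      · exact ⟨H.struct.zero, by simp [h]⟩
      · exact ⟨H.struct.ap H.struct.succ H.struct.zero, by simp [h, H.struct.succ_ne_zero]⟩
    exact ⟨F, fun f => (hF f).symm⟩

end Henkin

/-- Completeness: a formula that is true in all models is provable. -/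
theorem proves_of_sat {φ : Formula} (h : ∀ (M : Model) e, M.sat φ e) : RCA0ω ⊩ φ := by
  by_contra hφ
  have h₀ : ¬ Derives RCA0ω [∼φ] bot := fun h' => hφ (.raa h')
  obtain ⟨Γ, h₁, h₂, h₃, h₄⟩ := exists_henkin (fun φ hφ s => RCA0ω.subst_mem hφ s) h₀
  have H : Henkin Γ := ⟨h₂, h₃, h₄⟩
  have h₅ := (H.sat_iff Term.var φ).1 (h H.model _)
  rw [Formula.subst_var] at h₅
  exact H.bot_notMem (H.mem_imp.1 (h₁ (∼φ) (by simp)) h₅)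

end HOA

namespace HOA
open scoped Classical

/-! ## Representable functions -/

instance (M : Model) (σ τ : FT) : CoeFun (M.D (σ ⇒ τ)) fun _ => M.D σ → M.D τ := ⟨M.ap⟩

/-- A type for which it makes sense that a function from it to a type of the model is represented
in the model. -/
class Obj (M : Model) (X : Type) where
  rep : {τ : FT} → (X → M.D τ) → Prop
  rep_const {τ : FT} (c : M.D τ) : rep fun _ => c
  rep_ap {σ τ : FT} {f : X → M.D (σ ⇒ τ)} {g : X → M.D σ} :
    rep f → rep g → rep fun x => M.ap (f x) (g x)

variable {M : Model} {X Y Z : Type} [Obj M X] [Obj M Y] [Obj M Z] {ρ σ τ : FT}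

instance : Obj M (M.D σ) where
  rep f := ∃ c : M.D (σ ⇒ _), ∀ x, c x = f x
  rep_const c := ⟨M.K _ _ c, M.K_ap c⟩
  rep_ap := by
    rintro τ τ' f g ⟨c, hc⟩ ⟨d, hd⟩
    exact ⟨M.S _ _ _ c d, fun x => by rw [M.S_ap, hc, hd]⟩

/-- The model has no product types, so functions of several arguments are represented in curried
form. -/
instance : Obj M (X × M.D σ) where
  rep f := ∃ g : X → M.D (σ ⇒ _), Obj.rep g ∧ ∀ x y, g x y = f (x, y)
  rep_const c := ⟨fun _ => M.K _ _ c, Obj.rep_const _, fun _ => M.K_ap c⟩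
  rep_ap := by
    rintro τ τ' f g ⟨c, hc, hc'⟩ ⟨d, hd, hd'⟩
    exact ⟨fun x => M.S _ _ _ (c x) (d x), Obj.rep_ap (Obj.rep_ap (Obj.rep_const _) hc) hd,
      fun x y => by rw [M.S_ap, hc', hd']⟩

/-- Since every function on `Prop` is admitted, `Rep M P` for a predicate `P` says that definition
by cases on `P` is possible with constant values of every type. -/
instance : Obj M Prop where
  rep _ := True
  rep_const _ := trivial
  rep_ap _ _ := trivial

/-- The function `f` is represented in the model. -/
@[fun_prop]
def Rep {X Y : Type} (M : Model) [Obj M X] [Obj M Y] (f : X → Y) : Prop :=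
  ∀ (τ : FT) (k : Y → M.D τ), Obj.rep k → Obj.rep fun x => k (f x)

namespace Rep

theorem iff_rep {f : X → M.D σ} : Rep M f ↔ Obj.rep f := by
  constructor
  · intro h
    -- The combinator S K K represents the identity.
    exact h _ id ⟨M.S _ _ (σ) (M.K _ (σ ⇒ σ)) (M.K σ σ), fun x => by rw [M.S_ap, M.K_ap]; rfl⟩
  · rintro h τ k ⟨c, hc⟩
    simp only [← hc]
    exact Obj.rep_ap (Obj.rep_const c) h

@[fun_prop]
theorem id : Rep M (fun x : X => x) := fun _ _ h => h

@[fun_prop]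
theorem const (c : Y) : Rep M fun _ : X => c := fun _ k _ => Obj.rep_const (k c)

@[fun_prop]
theorem comp {g : Y → Z} {f : X → Y} (hg : Rep M g) (hf : Rep M f) : Rep M fun x => g (f x) :=
  fun τ k hk => hf τ _ (hg τ k hk)

@[fun_prop]
theorem fst : Rep M (Prod.fst : X × M.D σ → X) :=
  fun _ k hk => ⟨fun x => M.K _ _ (k x), Obj.rep_ap (Obj.rep_const _) hk, fun _ _ => M.K_ap _ _⟩

@[fun_prop]
theorem snd : Rep M (Prod.snd : X × M.D σ → M.D σ) :=
  fun _ _ ⟨c, hc⟩ => ⟨fun _ => c, Obj.rep_const c, fun _ => hc⟩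

@[fun_prop]
theorem mk {f : X → Y} {g : X → M.D σ} (hf : Rep M f) (hg : Rep M g) : Rep M fun x => (f x, g x) := by
  rintro τ k ⟨c, hc, hk⟩
  simp only [← hk]
  exact Obj.rep_ap (hf _ c hc) (iff_rep.1 hg)

@[fun_prop]
theorem ap {f : X → M.D (σ ⇒ τ)} {g : X → M.D σ} (hf : Rep M f) (hg : Rep M g) :
    Rep M fun x => M.ap (f x) (g x) :=
  iff_rep.2 (Obj.rep_ap (iff_rep.1 hf) (iff_rep.1 hg))

theorem exists_curry {F : X → M.D σ → M.D τ} (h : Rep M fun p : X × M.D σ => F p.1 p.2) :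
    ∃ G : X → M.D (σ ⇒ τ), Rep M G ∧ ∀ x y, G x y = F x y := by
  obtain ⟨g, hg, h'⟩ := iff_rep.1 h
  exact ⟨g, iff_rep.2 hg, h'⟩

theorem exists_one {F : M.D σ → M.D τ} (h : Rep M F) : ∃ c : M.D (σ ⇒ τ), ∀ x, c x = F x :=
  iff_rep.1 h

theorem exists_two {F : M.D ρ → M.D σ → M.D τ} (h : Rep M fun p : M.D ρ × M.D σ => F p.1 p.2) :
    ∃ c : M.D (ρ ⇒ σ ⇒ τ), ∀ x y, c x y = F x y := by
  obtain ⟨G, hG, hF⟩ := exists_curry h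
  obtain ⟨c, hc⟩ := exists_one hG
  exact ⟨c, fun x y => by rw [hc, hF]⟩

theorem exists_three {υ : FT} {F : M.D ρ → M.D σ → M.D τ → M.D υ}
    (h : Rep M fun p : (M.D ρ × M.D σ) × M.D τ => F p.1.1 p.1.2 p.2) :
    ∃ c : M.D (ρ ⇒ σ ⇒ τ ⇒ υ), ∀ x y z, c x y z = F x y z := by
  obtain ⟨G, hG, hF⟩ := exists_curry (F := fun p : M.D ρ × M.D σ => F p.1 p.2) h
  obtain ⟨c, hc⟩ := exists_two (F := fun x y => G (x, y)) hG
  exact ⟨c, fun x y z => by rw [hc, hF]⟩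

end Rep

/-! ### Primitive recursive arithmetic in a model -/

namespace Model

instance : Zero (M.D o) := ⟨M.zero⟩
instance : One (M.D o) := ⟨M.succ M.zero⟩
instance : Add (M.D o) := ⟨fun a b => M.R (M.K (o ⇒ o) o M.succ) a b⟩

/-- The predecessor. -/
def pd (n : M.D o) : M.D o := M.R (M.K o o) 0 n

instance : Sub (M.D o) := ⟨fun a b => M.R (M.K (o ⇒ o) o
  (M.S _ _ _ (M.K _ _ (M.R (M.K o o) 0)) (M.S o (o ⇒ o) o (M.K _ _) (M.K o o)))) a b⟩

instance : Mul (M.D o) := ⟨fun a b => M.R (M.K (o ⇒ o) o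
  (M.S o o o (M.R (M.K (o ⇒ o) o M.succ)) (M.K o o a))) 0 b⟩

theorem zero_def : M.zero = 0 := rfl
theorem add_zero' (a : M.D o) : a + 0 = a := M.R_zero _ _
theorem add_succ' (a b : M.D o) : a + M.succ b = M.succ (a + b) :=
  (M.R_succ _ _ _).trans (by rw [M.K_ap]; rfl)
theorem succ_eq (a : M.D o) : M.succ a = a + 1 := by
  rw [show (1 : M.D o) = M.succ 0 from rfl, add_succ', add_zero']
theorem add_one' (a b : M.D o) : a + (b + 1) = a + b + 1 := by
  rw [← succ_eq b, ← succ_eq, add_succ']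
theorem add_one_ne_zero (a : M.D o) : a + 1 ≠ 0 := by
  rw [← succ_eq]; exact M.succ_ne_zero a
theorem add_one_inj {a b : M.D o} (h : a + 1 = b + 1) : a = b := by
  rw [← succ_eq, ← succ_eq] at h; exact M.succ_inj h
theorem rec_zero (f : M.D (o ⇒ o ⇒ o)) (m : M.D o) : M.R f m 0 = m := M.R_zero _ _
theorem rec_succ (f : M.D (o ⇒ o ⇒ o)) (m n : M.D o) : M.R f m (n + 1) = f n (M.R f m n) := by
  rw [← succ_eq, M.R_succ]
theorem pd_zero : pd (0 : M.D o) = 0 := rec_zero _ _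
theorem pd_succ (n : M.D o) : pd (n + 1) = n := by rw [pd, rec_succ, M.K_ap]
theorem sub_zero' (a : M.D o) : a - 0 = a := M.R_zero _ _
theorem sub_succ' (a b : M.D o) : a - (b + 1) = pd (a - b) :=
  (rec_succ _ _ _).trans (by rw [M.K_ap, M.S_ap, M.K_ap, M.S_ap, M.K_ap]; rfl)
theorem mul_zero' (a : M.D o) : a * 0 = 0 := M.R_zero _ _
theorem mul_succ' (a b : M.D o) : a * (b + 1) = a * b + a :=
  (rec_succ _ _ _).trans (by rw [M.K_ap, M.S_ap, M.K_ap]; rfl)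

end Model

open Model

namespace Rep

@[fun_prop]
theorem add {f g : X → M.D o} (hf : Rep M f) (hg : Rep M g) : Rep M fun x => f x + g x := by
  change Rep M fun x => M.R _ (f x) (g x)
  fun_prop

@[fun_prop]
theorem sub {f g : X → M.D o} (hf : Rep M f) (hg : Rep M g) : Rep M fun x => f x - g x := by
  change Rep M fun x => M.R _ (f x) (g x)
  fun_prop

@[fun_prop]
theorem mul {f g : X → M.D o} (hf : Rep M f) (hg : Rep M g) : Rep M fun x => f x * g x := by
  change Rep M fun x => M.R (M.K _ _ (M.S _ _ _ _ (M.K _ _ (f x)))) 0 (g x)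
  fun_prop

@[fun_prop]
theorem pd {f : X → M.D o} (hf : Rep M f) : Rep M fun x => pd (f x) := by
  change Rep M fun x => M.R _ _ (f x)
  fun_prop

end Rep

namespace Model

/-- Two equations are allowed because `eq_zero_or` has to be proved before predicates can be coded
by characteristic functions. -/
theorem ind_eq_or {f g h k : M.D o → M.D o} (hf : Rep M f) (hg : Rep M g) (hh : Rep M h)
    (hk : Rep M k) (h0 : f 0 = g 0 ∨ h 0 = k 0)
    (h1 : ∀ n, (f n = g n ∨ h n = k n) → f (n + 1) = g (n + 1) ∨ h (n + 1) = k (n + 1)) (n) :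
    f n = g n ∨ h n = k n := by
  obtain ⟨f', hf⟩ := hf.exists_one
  obtain ⟨g', hg⟩ := hg.exists_one
  obtain ⟨h', hh⟩ := hh.exists_one
  obtain ⟨k', hk⟩ := hk.exists_one
  have := M.ind f' g' h' k'
  simp only [hf, hg, hh, hk, succ_eq, zero_def] at this
  exact this h0 h1 n

theorem eq_zero_or (n : M.D o) : n = 0 ∨ ∃ m, n = m + 1 := by
  have := ind_eq_or (M := M) (f := fun n => n) (g := fun _ => 0) (h := fun n => n)
    (k := fun n => pd n + 1) (by fun_prop) (by fun_prop) (by fun_prop) (by fun_prop)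
    (.inl rfl) (fun n _ => .inr (by rw [pd_succ])) n
  exact this.imp_right fun h => ⟨_, h⟩

/-- The recursor produces numbers only. Case distinction at an arrow type is reduced to the value
type by applying both branches to an argument and using extensionality. -/
theorem exists_cond (τ : FT) : ∃ c : M.D (τ ⇒ τ ⇒ o ⇒ τ), ∀ a b,
    c a b 0 = a ∧ ∀ n, c a b (n + 1) = b := by
  induction τ with
  | nat =>
      obtain ⟨c, hc⟩ := Rep.exists_three (M := M)
        (F := fun (a b n : M.D o) => M.R (M.K _ _ (M.K _ _ b)) a n) (by fun_prop)
      exact ⟨c, fun a b => ⟨by rw [hc, rec_zero], fun n => by rw [hc, rec_succ, M.K_ap, M.K_ap]⟩⟩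
  | arrow σ τ _ ih =>
      obtain ⟨c, hc⟩ := ih
      obtain ⟨G, hG, hG'⟩ := Rep.exists_curry (M := M)
        (X := (M.D (σ ⇒ τ) × M.D (σ ⇒ τ)) × M.D o)
        (F := fun p (x : M.D σ) => c (p.1.1 x) (p.1.2 x) p.2) (by fun_prop)
      obtain ⟨d, hd⟩ := Rep.exists_three (M := M) (F := fun a b n => G ((a, b), n)) hG
      refine ⟨d, fun a b => ⟨M.ext fun x => ?_, fun n => M.ext fun x => ?_⟩⟩
      · rw [hd, hG', (hc _ _).1]
      · rw [hd, hG', (hc _ _).2]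

theorem exists_eq_dec : ∃ e : M.D (o ⇒ o ⇒ o), ∀ a b, e a b = 0 ↔ a = b := by
  obtain ⟨F, hF⟩ := M.eq_dec
  -- The two numbers are packed into one sequence, with `a` at 0 and `b` at every successor, so that
  -- `eq_dec` applies.
  obtain ⟨p, hp⟩ := Rep.exists_three (M := M)
    (F := fun (a b n : M.D o) => M.R (M.K _ _ (M.K _ _ b)) a n) (by fun_prop)
  obtain ⟨e, he⟩ := Rep.exists_two (M := M) (F := fun a b => F (p a b)) (by fun_prop)
  refine ⟨e, fun a b => ?_⟩
  rw [he]
  refine (hF _).trans ?_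
  rw [zero_def, succ_eq, hp, hp, rec_zero, rec_succ, M.K_ap, M.K_ap]

end Model

/-! ### Representable predicates and definition by cases -/

namespace Rep

theorem of_iff {P : X → Prop} {f : X → M.D o} (hf : Rep M f) (h : ∀ x, P x ↔ f x = 0) :
    Rep M P := by
  intro τ k _
  obtain ⟨c, hc⟩ := exists_cond (M := M) τ
  have : (fun x => k (P x)) = fun x => c (k True) (k False) (f x) := by
    funext x
    rcases eq_zero_or (f x) with h' | ⟨m, h'⟩
    · rw [h', (hc _ _).1, show P x = True by simp [h, h']]
    · rw [h', (hc _ _).2, show P x = False by simp [h, h', add_one_ne_zero]]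
  rw [this]
  exact iff_rep.1 (by fun_prop)

theorem chi {P : X → Prop} (hP : Rep M P) : Rep M fun x => if P x then (0 : M.D o) else 1 :=
  iff_rep.2 (hP _ (fun p => if p then (0 : M.D o) else 1) trivial)

theorem one_ne_zero' : (1 : M.D o) ≠ 0 := M.succ_ne_zero _

/-- Definition by cases. -/
@[fun_prop]
theorem ite {P : X → Prop} {f g : X → M.D τ} [∀ x, Decidable (P x)] (hP : Rep M P) (hf : Rep M f)
    (hg : Rep M g) : Rep M fun x => if P x then f x else g x := by
  obtain ⟨c, hc⟩ := exists_cond (M := M) τ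
  have h1 : (1 : M.D o) = 0 + 1 := by rw [← succ_eq]; rfl
  have : (fun x => if P x then f x else g x) =
      fun x => c (f x) (g x) (if P x then (0 : M.D o) else 1) := by
    funext x
    by_cases h : P x
    · simp [h, (hc _ _).1]
    · simp only [h, if_false]; rw [h1, (hc _ _).2]
  rw [this]
  refine ap (by fun_prop) ?_
  convert hP.chi

@[fun_prop]
theorem bool {P : X → Prop} (B : Prop → Prop) (hP : Rep M P) : Rep M fun x => B (P x) :=
  fun τ k _ => hP τ (fun p => k (B p)) trivial

theorem bool₂ {P Q : X → Prop} (B : Prop → Prop → Prop) (hP : Rep M P) (hQ : Rep M Q) :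
    Rep M fun x => B (P x) (Q x) := by
  intro τ k _
  have : (fun x => k (B (P x) (Q x))) =
      fun x => if P x then k (B True (Q x)) else k (B False (Q x)) := by
    funext x
    by_cases h : P x <;> simp [h]
  rw [this]
  exact iff_rep.1 (Rep.ite hP (iff_rep.2 (hQ _ (fun q => k (B True q)) trivial))
    (iff_rep.2 (hQ _ (fun q => k (B False q)) trivial)))

@[fun_prop]
theorem not {P : X → Prop} (hP : Rep M P) : Rep M fun x => ¬ P x := hP.bool Not

@[fun_prop]
theorem and {P Q : X → Prop} (hP : Rep M P) (hQ : Rep M Q) : Rep M fun x => P x ∧ Q x :=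
  bool₂ And hP hQ

@[fun_prop]
theorem or {P Q : X → Prop} (hP : Rep M P) (hQ : Rep M Q) : Rep M fun x => P x ∨ Q x :=
  bool₂ Or hP hQ

@[fun_prop]
theorem imp {P Q : X → Prop} (hP : Rep M P) (hQ : Rep M Q) : Rep M fun x => (P x → Q x) :=
  bool₂ (fun p q => p → q) hP hQ

@[fun_prop]
theorem eq {f g : X → M.D o} (hf : Rep M f) (hg : Rep M g) : Rep M fun x => f x = g x := by
  obtain ⟨e, he⟩ := exists_eq_dec (M := M)
  exact of_iff (f := fun x => e (f x) (g x)) (by fun_prop) fun x => (he _ _).symm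

end Rep

/-! ### The numbers of a model as an ordered semiring -/

namespace Model

/-- Induction for representable predicates. -/
theorem ind' {P : M.D o → Prop} (hP : Rep M P) (h0 : P 0) (h1 : ∀ n, P n → P (n + 1)) (n) : P n := by
  have := ind_eq_or (M := M) (f := fun n => if P n then 0 else 1) (g := fun _ => 0)
    (h := fun n => if P n then 0 else 1) (k := fun _ => 0) (by fun_prop) (by fun_prop) (by fun_prop)
    (by fun_prop)
  simp only [or_self, ite_eq_left_iff, Rep.one_ne_zero', imp_false, not_not] at this
  exact this h0 h1 n

theorem zero_add' (a : M.D o) : 0 + a = a := by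
  induction a using ind' with
  | hP => fun_prop
  | h0 => exact add_zero' _
  | h1 n h => rw [add_one', h]

theorem succ_add' (a b : M.D o) : a + 1 + b = a + b + 1 := by
  induction b using ind' with
  | hP => fun_prop
  | h0 => rw [add_zero', add_zero']
  | h1 n h => rw [add_one', h, add_one']

theorem add_comm' (a b : M.D o) : a + b = b + a := by
  induction b using ind' with
  | hP => fun_prop
  | h0 => rw [add_zero', zero_add']
  | h1 n h => rw [add_one', h, succ_add']

theorem add_assoc' (a b c : M.D o) : a + b + c = a + (b + c) := by
  induction c using ind' with
  | hP => fun_prop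
  | h0 => rw [add_zero', add_zero']
  | h1 n h => rw [add_one', h, add_one', add_one']

theorem add_cancel' {a b c : M.D o} (h : b + a = c + a) : b = c := by
  revert h
  induction a using ind' with
  | hP => fun_prop
  | h0 => rw [add_zero', add_zero']; exact _root_.id
  | h1 n ih => rw [add_one', add_one']; exact fun h => ih (add_one_inj h)

instance : AddCommMonoid (M.D o) where
  add_assoc := add_assoc'
  zero_add := zero_add'
  add_zero := add_zero'
  add_comm := add_comm'
  nsmul := nsmulRec

theorem left_distrib' (a b c : M.D o) : a * (b + c) = a * b + a * c := by
  induction c using ind' with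
  | hP => fun_prop
  | h0 => rw [mul_zero', add_zero', add_zero']
  | h1 n h => rw [add_one', mul_succ', h, mul_succ', add_assoc']

theorem mul_assoc' (a b c : M.D o) : a * b * c = a * (b * c) := by
  induction c using ind' with
  | hP => fun_prop
  | h0 => rw [mul_zero', mul_zero', mul_zero']
  | h1 n h => rw [mul_succ', h, mul_succ', left_distrib']

theorem zero_mul' (a : M.D o) : 0 * a = 0 := by
  induction a using ind' with
  | hP => fun_prop
  | h0 => rw [mul_zero']
  | h1 n h => rw [mul_succ', h, add_zero']

theorem succ_mul' (a b : M.D o) : (a + 1) * b = a * b + b := by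
  induction b using ind' with
  | hP => fun_prop
  | h0 => rw [mul_zero', mul_zero', add_zero']
  | h1 n h => rw [mul_succ', h, mul_succ']; abel

theorem mul_comm' (a b : M.D o) : a * b = b * a := by
  induction b using ind' with
  | hP => fun_prop
  | h0 => rw [mul_zero', zero_mul']
  | h1 n h => rw [mul_succ', h, succ_mul']

theorem one_mul' (a : M.D o) : 1 * a = a := by
  rw [show (1 : M.D o) = 0 + 1 from (zero_add' _).symm, succ_mul', zero_mul', zero_add']

instance : CommSemiring (M.D o) where
  mul_assoc := mul_assoc'
  one_mul := one_mul'
  mul_one a := by rw [mul_comm', one_mul']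
  left_distrib := left_distrib'
  right_distrib a b c := by rw [mul_comm', left_distrib', mul_comm', mul_comm' c]
  zero_mul := zero_mul'
  mul_zero := mul_zero'
  mul_comm := mul_comm'

theorem succ_sub_succ' (a b : M.D o) : a + 1 - (b + 1) = a - b := by
  induction b using ind' with
  | hP => fun_prop
  | h0 => rw [sub_succ', sub_zero', sub_zero', pd_succ]
  | h1 n h => rw [sub_succ', h, sub_succ']

theorem add_sub_cancel_left' (a b : M.D o) : a + b - a = b := by
  induction a using ind' with
  | hP => fun_prop
  | h0 => rw [zero_add, sub_zero']
  | h1 n h => rw [succ_add', succ_sub_succ', h]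

/-- Linearity of the order, with truncated subtraction in place of the existential quantifier so
that induction applies. -/
theorem add_sub_or (a b : M.D o) : a + (b - a) = b ∨ b + (a - b) = a := by
  induction a using ind' with
  | hP => fun_prop
  | h0 => rw [sub_zero', zero_add]; exact .inl rfl
  | h1 a h =>
      rcases h with h | h
      · rcases eq_zero_or (b - a) with h' | ⟨m, h'⟩
        · rw [h', add_zero] at h
          rw [h, add_sub_cancel_left']
          exact .inr rfl
        · left
          rw [sub_succ', h', pd_succ, succ_add', ← add_one', ← h', h]
      · right
        conv_rhs => rw [← h]
        conv_lhs => rw [← h]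
        rw [add_assoc', add_sub_cancel_left']

instance : LE (M.D o) := ⟨fun a b => ∃ c, b = a + c⟩

theorem le_def {a b : M.D o} : a ≤ b ↔ ∃ c, b = a + c := Iff.rfl

/-- The witness is computed by subtraction, which makes the order representable. -/
theorem le_iff_sub {a b : M.D o} : a ≤ b ↔ a + (b - a) = b := by
  constructor
  · rintro ⟨c, rfl⟩
    rw [add_sub_cancel_left']
  · exact fun h => ⟨_, h.symm⟩

theorem eq_zero_of_add {a b : M.D o} (h : a + b = 0) : a = 0 := by
  rcases eq_zero_or b with rfl | ⟨c, rfl⟩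
  · simpa using h
  · exact (add_one_ne_zero _ ((add_one' _ _).symm.trans h)).elim

noncomputable instance : LinearOrder (M.D o) where
  le_refl a := ⟨0, (add_zero a).symm⟩
  le_trans := by
    rintro a _ _ ⟨c, rfl⟩ ⟨d, rfl⟩
    exact ⟨c + d, add_assoc _ _ _⟩
  le_antisymm := by
    rintro a _ ⟨c, rfl⟩ ⟨d, h⟩
    have : c + d = 0 := by
      refine add_cancel' (a := a) ?_
      rw [zero_add, add_comm, ← add_assoc, ← h]
    rw [eq_zero_of_add this, add_zero]
  le_total a b := (add_sub_or a b).imp le_iff_sub.2 le_iff_sub.2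
  toDecidableLE := Classical.decRel _

theorem lt_iff {a b : M.D o} : a < b ↔ ∃ c, b = a + (c + 1) := by
  constructor
  · intro h
    obtain ⟨c, rfl⟩ := h.le
    rcases eq_zero_or c with rfl | ⟨d, rfl⟩
    · simp at h
    · exact ⟨d, rfl⟩
  · rintro ⟨c, rfl⟩
    refine lt_of_le_of_ne ⟨_, rfl⟩ fun h => add_one_ne_zero c (add_cancel' (a := a) ?_)
    rw [zero_add, add_comm, ← h]

theorem mul_ne_zero' {a b : M.D o} (ha : a ≠ 0) (hb : b ≠ 0) : a * b ≠ 0 := by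
  obtain ⟨c, rfl⟩ := (eq_zero_or a).resolve_left ha
  obtain ⟨d, rfl⟩ := (eq_zero_or b).resolve_left hb
  rw [mul_succ', ← add_assoc]
  exact add_one_ne_zero _

instance : CanonicallyOrderedAdd (M.D o) where
  exists_add_of_le h := h
  le_add_self _ b := ⟨b, add_comm _ _⟩
  le_self_add _ b := ⟨b, rfl⟩

instance : IsOrderedCancelAddMonoid (M.D o) where
  add_le_add_left := by
    rintro a _ ⟨c, rfl⟩ b
    exact ⟨c, by abel⟩
  le_of_add_le_add_left := by
    rintro a b c ⟨d, h⟩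
    exact ⟨d, add_cancel' (a := a) (by rw [add_comm, h]; abel)⟩

instance : Nontrivial (M.D o) := ⟨1, 0, Rep.one_ne_zero'⟩

instance : IsStrictOrderedRing (M.D o) where
  zero_le_one := zero_le
  mul_lt_mul_of_pos_left a ha b c h := by
    obtain ⟨d, rfl⟩ := lt_iff.1 h
    rw [mul_add]
    exact lt_add_of_pos_right _ (zero_le.lt_of_ne' (mul_ne_zero' ha.ne' (add_one_ne_zero d)))
  mul_lt_mul_of_pos_right a ha b c h := by
    obtain ⟨d, rfl⟩ := lt_iff.1 h
    rw [add_mul]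
    exact lt_add_of_pos_right _ (zero_le.lt_of_ne' (mul_ne_zero' (add_one_ne_zero d) ha.ne'))

theorem lt_add_one_iff {a b : M.D o} : a < b + 1 ↔ a ≤ b := by
  constructor
  · intro h
    obtain ⟨c, hc⟩ := lt_iff.1 h
    rw [← add_assoc] at hc
    exact ⟨c, add_one_inj hc⟩
  · rintro ⟨c, rfl⟩
    exact lt_iff.2 ⟨c, add_assoc _ _ _⟩

theorem add_one_le_iff {a b : M.D o} : a + 1 ≤ b ↔ a < b := by
  rw [← lt_add_one_iff, add_lt_add_iff_right]

theorem sub_eq_of_eq_add' {a b c : M.D o} (h : a = b + c) : a - b = c := by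
  rw [h, add_sub_cancel_left']

theorem sub_add_self' (a d : M.D o) : a - (a + d) = 0 := by
  induction d using ind' with
  | hP => fun_prop
  | h0 => rw [add_zero]; exact sub_eq_of_eq_add' (add_zero a).symm
  | h1 n h => rw [← add_assoc, sub_succ', h, pd_zero]

instance : OrderedSub (M.D o) where
  tsub_le_iff_right a b c := by
    rcases le_total a b with h | h
    · have : a - b = 0 := by
        obtain ⟨d, rfl⟩ := h
        exact sub_add_self' a d
      simp only [this, zero_le, true_iff]
      exact h.trans le_add_self
    · obtain ⟨d, rfl⟩ := h
      rw [add_sub_cancel_left', add_comm c, add_le_add_iff_left]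

end Model

namespace Rep

@[fun_prop]
theorem le {f g : X → M.D o} (hf : Rep M f) (hg : Rep M g) : Rep M fun x => f x ≤ g x := by
  simp only [le_iff_sub]
  fun_prop

@[fun_prop]
theorem lt {f g : X → M.D o} (hf : Rep M f) (hg : Rep M g) : Rep M fun x => f x < g x := by
  simp only [← not_le]
  fun_prop

end Rep
end HOA

namespace HOA
open scoped Classical
open Model

variable {M : Model} {X Y Z : Type} [Obj M X] [Obj M Y] [Obj M Z] {ρ σ τ : FT}

/-! ## Pairs, powers of two, and real numbers in a model -/

namespace Model

/-- The pairing function. -/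
def pr (a b : M.D o) : M.D o := (a + b) * (a + b) + a

/-- `2 ^ n` -/
def tp (n : M.D o) : M.D o :=
  M.R (M.K (o ⇒ o) o (M.S o o o (M.R (M.K (o ⇒ o) o M.succ))
    (M.S o (o ⇒ o) o (M.K o (o ⇒ o)) (M.K o o)))) 1 n

/-- The code of a rational number. -/
def rc (a b c : M.D o) : M.D o := pr (pr a b) c

def Gap (q r n : M.D o) (k : ℕ) : Prop :=
  ∃ a b c a' b' c' : M.D o, q = rc a b c ∧ r = rc a' b' c' ∧
    tp n * (a * (c' + 1) + b' * (c + 1)) + k * ((c + 1) * (c' + 1)) <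
      tp n * (a' * (c + 1) + b * (c' + 1))

def IsRat (q : M.D o) : Prop := ∃ a b c, q = rc a b c

def IsReal (x : M.D one) : Prop :=
  (∀ n, IsRat (x n)) ∧ ∀ n i, ¬ Gap (x n) (x (n + i)) n 1 ∧ ¬ Gap (x (n + i)) (x n) n 1

def REq (x y : M.D one) : Prop := ∀ n, ¬ Gap (x n) (y n) n 2 ∧ ¬ Gap (y n) (x n) n 2

def RLt (x y : M.D one) : Prop := ∃ n, Gap (x n) (y n) n 2

/-- The natural number `k` as a real number. -/
def rnum (M : Model) (k : ℕ) : M.D one := M.K o o (rc k 0 0)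

def Mem (x : M.D one) (A : M.D (one ⇒ one)) : Prop := RLt (rnum M 0) (A x)

/-- `f ∈ 2^ℕ` -/
def Bin (f : M.D one) : Prop := ∀ n, f n = 0 ∨ f n = 1

def SubsetCantor (A : M.D (one ⇒ one)) : Prop := ∀ f, Bin f → IsReal (A f)

def BijCantor (A : M.D (one ⇒ one)) (Y : M.D two) : Prop :=
  (∀ f g, Bin f → Bin g → Mem f A → Mem g A → Y f = Y g → f = g) ∧
    ∀ n, ∃ f, Bin f ∧ Mem f A ∧ Y f = n

def LexLt (f g : M.D one) : Prop := ∃ n, (∀ m < n, f m = g m) ∧ f n < g n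

def LexSup (A : M.D (one ⇒ one)) (s : M.D one) : Prop :=
  Bin s ∧ (∀ f, Bin f → Mem f A → LexLt f s ∨ f = s) ∧
    ∀ g, Bin g → (∀ f, Bin f → Mem f A → LexLt f g ∨ f = g) → LexLt s g ∨ s = g

def PointwiseSup (A : M.D (one ⇒ one)) (s : M.D one) : Prop :=
  Bin s ∧ (∀ f, Bin f → Mem f A → ∀ n, ¬ s n < f n) ∧
    ∀ n, s n = 1 → ∃ f, Bin f ∧ Mem f A ∧ f n = 1

def SubsetUnitInterval (A : M.D (one ⇒ one)) : Prop :=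
  (∀ x, IsReal x → IsReal (A x)) ∧
    (∀ x y, IsReal x → IsReal y → REq x y → REq (A x) (A y)) ∧
    ∀ x, IsReal x → Mem x A → ¬ RLt x (rnum M 0) ∧ ¬ RLt (rnum M 1) x

def BijReals (A : M.D (one ⇒ one)) (Y : M.D two) : Prop :=
  (∀ x y, IsReal x → IsReal y → REq x y → Y x = Y y) ∧
    (∀ x y, IsReal x → IsReal y → Mem x A → Mem y A → Y x = Y y → REq x y) ∧
    ∀ n, ∃ x, IsReal x ∧ Mem x A ∧ Y x = n

def BWC (M : Model) : Prop :=
  ∀ (A : M.D (one ⇒ one)) (Y : M.D two), SubsetCantor A → BijCantor A Y → ∃ s, LexSup A s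

def PWO (M : Model) : Prop :=
  ∀ (A : M.D (one ⇒ one)) (Y : M.D two), SubsetCantor A → BijCantor A Y → ∃ s, PointwiseSup A s

def IND (M : Model) : Prop :=
  ∀ Y : M.D (o ⇒ one ⇒ o), (∀ n, (∃ f, Bin f ∧ Y n f = 0) ∧
      ∀ f g, Bin f → Bin g → Y n f = 0 → Y n g = 0 → f = g) →
    ∀ n, ∃ w : M.D (o ⇒ one), ∀ i < n, Bin (w i) ∧ Y i (w i) = 0

def Cocode (M : Model) : Prop :=
  ∀ (A : M.D (one ⇒ one)) (Y : M.D two), SubsetUnitInterval A → BijReals A Y →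
    ∃ x : M.D (o ⇒ one), (∀ n, IsReal (x n) ∧ Mem (x n) A) ∧
      ∀ y, IsReal y → (Mem y A ↔ ∃ n, REq (x n) y)

/-! ### Truth of the formulas -/

section sat
variable (e : (σ : FT) → ℕ → M.D σ)

@[simp] theorem eval_var (σ : FT) (n : ℕ) : M.eval e (Term.var σ n) = e σ n := rfl
@[simp] theorem eval_zero : M.eval e Term.zero = 0 := rfl
@[simp] theorem eval_app {σ τ : FT} (s : Term (σ ⇒ τ)) (t : Term σ) :
    M.eval e (s ⬝ t) = M.ap (M.eval e s) (M.eval e t) := rfl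
@[simp] theorem eval_succ : M.eval e Term.succ = M.succ := rfl
@[simp] theorem eval_add (s t : Term o) : M.eval e (add s t) = M.eval e s + M.eval e t := rfl
@[simp] theorem eval_mul (s t : Term o) : M.eval e (mul s t) = M.eval e s * M.eval e t := rfl
@[simp] theorem eval_twoPow (t : Term o) : M.eval e (twoPow t) = tp (M.eval e t) := rfl
@[simp] theorem eval_num (k : ℕ) : M.eval e (num k) = k := by
  induction k with
  | zero => simp [num]
  | succ k ih => simp [num, ih, succ_eq]
@[simp] theorem eval_ratCode (a b c : Term o) :
    M.eval e (ratCode a b c) = rc (M.eval e a) (M.eval e b) (M.eval e c) := rfl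
@[simp] theorem eval_realNum (k : ℕ) : M.eval e (realNum k) = rnum M k := by
  show M.K o o (M.eval e (ratCode (num k) Term.zero Term.zero)) = _
  simp [rnum]

@[simp] theorem sat_eq (s t : Term o) : M.sat (s ≐ t) e ↔ M.eval e s = M.eval e t := Iff.rfl
@[simp] theorem sat_imp (φ ψ : Formula) : M.sat (φ ⊸ ψ) e ↔ (M.sat φ e → M.sat ψ e) := Iff.rfl
@[simp] theorem sat_all (σ : FT) (φ : Formula) :
    M.sat (Formula.all σ φ) e ↔ ∀ x : M.D σ, M.sat φ (push x e) := Iff.rfl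
@[simp] theorem sat_lt (s t : Term o) : M.sat (lt s t) e ↔ M.eval e s < M.eval e t := by
  simp [HOA.lt, lt_iff, eq_comm, succ_eq]

@[simp] theorem sat_gap (q r n : Term o) (k : ℕ) :
    M.sat (gap q r n k) e ↔ Gap (M.eval e q) (M.eval e r) (M.eval e n) k := by
  simp [gap, Gap, succ_eq]

@[simp] theorem sat_isRat (q : Term o) : M.sat (isRat q) e ↔ IsRat (M.eval e q) := by
  simp [isRat, IsRat]

@[simp] theorem sat_isReal (x : Term one) : M.sat (isReal x) e ↔ IsReal (M.eval e x) := by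
  simp [isReal, IsReal]

@[simp] theorem sat_realEq (x y : Term one) :
    M.sat (realEq x y) e ↔ REq (M.eval e x) (M.eval e y) := by
  simp [realEq, REq]

@[simp] theorem sat_realLt (x y : Term one) :
    M.sat (realLt x y) e ↔ RLt (M.eval e x) (M.eval e y) := by
  simp [realLt, RLt]

@[simp] theorem sat_realLe (x y : Term one) :
    M.sat (realLe x y) e ↔ ¬ RLt (M.eval e y) (M.eval e x) := by
  simp [realLe]

@[simp] theorem sat_mem (x : Term one) (A : Term (one ⇒ one)) :
    M.sat (mem x A) e ↔ Mem (M.eval e x) (M.eval e A) := by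
  simp [mem, Mem]

@[simp] theorem sat_binary (f : Term one) : M.sat (binary f) e ↔ Bin (M.eval e f) := by
  simp [binary, Bin]

@[simp] theorem sat_lexLe (f g : Term one) : M.sat (lexLe f g) e ↔
    LexLt (M.eval e f) (M.eval e g) ∨ M.eval e f = M.eval e g := by
  simp [lexLe, lexLt, LexLt]

theorem sat_BWC1 : M.sat BWC1 e ↔ BWC M := by
  simp [BWC1, BWC, isSubsetCantor, bijectiveOnCantor, isLexSup, isLexUpperBound, push_of_ne,
    SubsetCantor, BijCantor, LexSup]

theorem sat_BWC1pwo : M.sat BWC1pwo e ↔ PWO M := by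
  simp [BWC1pwo, PWO, isSubsetCantor, bijectiveOnCantor, isPointwiseSup, push_of_ne,
    SubsetCantor, BijCantor, PointwiseSup]

theorem sat_IND1 : M.sat IND1 e ↔ IND M := by
  simp [IND1, IND, push_of_ne]

theorem sat_cocode1 : M.sat cocode1 e ↔ Cocode M := by
  simp [cocode1, Cocode, isSubsetUnitInterval, bijectiveOnReals, push_of_ne,
    SubsetUnitInterval, BijReals]

end sat
end Model
end HOA

namespace HOA
open scoped Classical
open Model

variable {M : Model} {X Y Z : Type} [Obj M X] [Obj M Y] [Obj M Z] {ρ σ τ : FT}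

/-! ## Arithmetical comprehension -/

namespace Rep

@[fun_prop]
theorem pr {f g : X → M.D o} (hf : Rep M f) (hg : Rep M g) : Rep M fun x => pr (f x) (g x) := by
  unfold Model.pr
  fun_prop

@[fun_prop]
theorem tp {f : X → M.D o} (hf : Rep M f) : Rep M fun x => tp (f x) := by
  unfold Model.tp
  fun_prop

@[fun_prop]
theorem rc {f g h : X → M.D o} (hf : Rep M f) (hg : Rep M g) (hh : Rep M h) :
    Rep M fun x => rc (f x) (g x) (h x) := by
  unfold Model.rc
  fun_prop

end Rep

/-- The existence of the functional `∃²`. -/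
class HasE (M : Model) : Prop where
  ex : ∃ E : M.D two, ∀ h, E h = 0 ↔ ∀ n, h n = 0

theorem HasE.of_rep {P : M.D one → Prop} (hP : Rep M P) (h : ∀ f, P f ↔ ∀ n, f n = 0) :
    HasE M := by
  obtain ⟨E, hE⟩ := hP.chi.exists_one
  refine ⟨E, fun f => ?_⟩
  rw [hE, ← h]
  simp

theorem exists_ext_iff {f g : M.D one} : f = g ↔ ∀ n, f n = g n :=
  ⟨fun h _ => by rw [h], fun h => M.ext h⟩

namespace Rep
variable [HasE M]

@[fun_prop]
theorem all {P : X → M.D o → Prop} (h : Rep M fun p : X × M.D o => P p.1 p.2) :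
    Rep M fun x => ∀ n, P x n := by
  obtain ⟨E, hE⟩ := HasE.ex (M := M)
  obtain ⟨G, hG, hG'⟩ := exists_curry (F := fun x n => if P x n then (0 : M.D o) else 1) h.chi
  refine of_iff (f := fun x => E (G x)) (by fun_prop) fun x => ?_
  simp [hE, hG']

@[fun_prop]
theorem ex {P : X → M.D o → Prop} (h : Rep M fun p : X × M.D o => P p.1 p.2) :
    Rep M fun x => ∃ n, P x n := by
  simp only [← not_forall_not (p := P _)]
  fun_prop

@[fun_prop]
theorem eq_one {f g : X → M.D one} (hf : Rep M f) (hg : Rep M g) : Rep M fun x => f x = g x := by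
  simp only [exists_ext_iff]
  fun_prop

@[fun_prop]
theorem bin {f : X → M.D one} (hf : Rep M f) : Rep M fun x => Bin (f x) := by
  unfold Bin
  fun_prop

@[fun_prop]
theorem gap {f g h : X → M.D o} (k : ℕ) (hf : Rep M f) (hg : Rep M g) (hh : Rep M h) :
    Rep M fun x => Gap (f x) (g x) (h x) k := by
  unfold Gap
  fun_prop

@[fun_prop]
theorem isReal {f : X → M.D one} (hf : Rep M f) : Rep M fun x => IsReal (f x) := by
  unfold IsReal IsRat
  fun_prop

@[fun_prop]
theorem rEq {f g : X → M.D one} (hf : Rep M f) (hg : Rep M g) : Rep M fun x => REq (f x) (g x) := by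
  unfold REq
  fun_prop

@[fun_prop]
theorem rLt {f g : X → M.D one} (hf : Rep M f) (hg : Rep M g) : Rep M fun x => RLt (f x) (g x) := by
  unfold RLt
  fun_prop

@[fun_prop]
theorem mem {f : X → M.D one} {g : X → M.D (one ⇒ one)} (hf : Rep M f) (hg : Rep M g) :
    Rep M fun x => Mem (f x) (g x) := by
  unfold Mem
  fun_prop

end Rep

theorem exists_least [HasE M] {P : M.D o → Prop} (hP : Rep M P) (h : ∃ n, P n) :
    ∃ n, P n ∧ ∀ m < n, ¬ P m := by
  by_contra! H
  obtain ⟨n, hn⟩ := h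
  have : ∀ n, ∀ m < n, ¬ P m := by
    intro n
    induction n using ind' with
    | hP => fun_prop
    | h0 => exact fun m hm => (not_lt_zero hm).elim
    | h1 n ih =>
        intro m hm hPm
        obtain ⟨k, hk, hPk⟩ := H m hPm
        exact ih k (hk.trans_le (lt_add_one_iff.1 hm)) hPk
  exact this (n + 1) n (lt_add_one_iff.2 le_rfl) hn

/-- Choice of numbers, with the least number as value. -/
theorem exists_mu [HasE M] {P : X → M.D o → Prop} (hP : Rep M fun p : X × M.D o => P p.1 p.2) :
    ∃ F : X → M.D o, Rep M F ∧ ∀ x n, P x n → P x (F x) ∧ F x ≤ n := by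
  obtain ⟨g, hg⟩ := Rep.exists_two (M := M) (ρ := one) (σ := o)
    -- The second alternative makes the choice premise hold for sequences without zeros; the
    -- minimality clause fixes the value when there is a zero.
    (F := fun f n => if (f n = 0 ∧ ∀ m, m < n → f m ≠ 0) ∨ (∀ m, f m ≠ 0) then (0 : M.D o) else 1)
    (by fun_prop)
  obtain ⟨μ, hμ⟩ := M.choice g fun f => by
    by_cases h : ∃ n, f n = 0
    · obtain ⟨n, hn, hn'⟩ := exists_least (M := M) (P := fun n => f n = 0) (by fun_prop) h
      exact ⟨n, by rw [hg, if_pos (.inl ⟨hn, hn'⟩)]; rfl⟩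
    · exact ⟨0, by rw [hg, if_pos (.inr (by simpa using h))]; rfl⟩
  obtain ⟨G, hG, hG'⟩ := Rep.exists_curry (F := fun x n => if P x n then (0 : M.D o) else 1) hP.chi
  refine ⟨fun x => μ (G x), by fun_prop, fun x n hn => ?_⟩
  have h1 := hμ (G x)
  rw [hg, zero_def] at h1
  simp only [hG', ite_eq_left_iff, Rep.one_ne_zero', imp_false, not_not, ne_eq] at h1
  rcases h1 with h1 | h1
  · exact ⟨h1.1, not_lt.1 fun h => h1.2 _ h hn⟩
  · exact (h1 n hn).elim

theorem exists_first_ne [HasE M] {f g : M.D one} (h : f ≠ g) :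
    ∃ n, f n ≠ g n ∧ ∀ m < n, f m = g m := by
  obtain ⟨n, h1, h2⟩ := exists_least (M := M) (P := fun n => f n ≠ g n) (by fun_prop)
    (by rw [Ne, exists_ext_iff, not_forall] at h; exact h)
  exact ⟨n, h1, fun m hm => not_not.1 (h2 m hm)⟩

/-! ## Arithmetic of codes -/

namespace Model

/-- With s = a + b, the code lies between s² and s² + s, hence below (s + 1)². -/
theorem pr_lt {a b c d : M.D o} (h : a + b < c + d) : pr a b < pr c d := by
  have h1 : a + b + 1 ≤ c + d := add_one_le_iff.2 h
  calc pr a b ≤ (a + b) * (a + b) + (a + b) := add_le_add_right le_self_add _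
    _ < (a + b) * (a + b) + (a + b) + (a + b + 1) := lt_add_of_pos_right _
        (zero_le.trans_lt (lt_add_one_iff.2 le_rfl))
    _ = (a + b + 1) * (a + b + 1) := by ring
    _ ≤ (c + d) * (c + d) := mul_le_mul' h1 h1
    _ ≤ pr c d := le_self_add

theorem pr_inj {a b c d : M.D o} : pr a b = pr c d ↔ a = c ∧ b = d := by
  refine ⟨fun h => ?_, by rintro ⟨rfl, rfl⟩; rfl⟩
  rcases lt_trichotomy (a + b) (c + d) with h' | h' | h'
  · exact ((pr_lt h').ne h).elim
  · unfold pr at h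
    rw [h'] at h
    obtain rfl := add_left_cancel h
    exact ⟨rfl, add_left_cancel h'⟩
  · exact ((pr_lt h').ne' h).elim

theorem le_mul_self' (a : M.D o) : a ≤ a * a := by
  rcases eq_zero_or a with rfl | ⟨b, rfl⟩
  · simp
  · exact le_mul_of_one_le_right' le_add_self

theorem le_pr_left (a b : M.D o) : a ≤ pr a b := le_add_self

theorem le_pr_right (a b : M.D o) : b ≤ pr a b :=
  (le_add_self.trans (le_mul_self' (a + b))).trans le_self_add

theorem rc_inj {a b c a' b' c' : M.D o} : rc a b c = rc a' b' c' ↔ a = a' ∧ b = b' ∧ c = c' := by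
  simp [rc, pr_inj, and_assoc]

theorem gap_rc {a b c a' b' c' n : M.D o} {k : ℕ} : Gap (rc a b c) (rc a' b' c') n k ↔
    tp n * (a * (c' + 1) + b' * (c + 1)) + k * ((c + 1) * (c' + 1)) <
      tp n * (a' * (c + 1) + b * (c' + 1)) := by
  constructor
  · rintro ⟨a, b, c, a', b', c', h, h', H⟩
    obtain ⟨rfl, rfl, rfl⟩ := rc_inj.1 h
    obtain ⟨rfl, rfl, rfl⟩ := rc_inj.1 h'
    exact H
  · exact fun h => ⟨_, _, _, _, _, _, rfl, rfl, h⟩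

theorem tp_zero : tp (0 : M.D o) = 1 := rec_zero _ _

theorem tp_succ (n : M.D o) : tp (n + 1) = tp n + tp n :=
  (rec_succ _ _ _).trans (by rw [M.K_ap, M.S_ap, M.S_ap, M.K_ap]; rfl)

theorem isReal_rnum (k : ℕ) : IsReal (rnum M k) := by
  simp [IsReal, IsRat, rnum, M.K_ap, gap_rc, rc_inj]

theorem rLt_rnum : RLt (rnum M 0) (rnum M 1) := by
  refine ⟨1 + 1, ?_⟩
  have : tp (1 + 1 : M.D o) = 4 := by
    rw [tp_succ, ← zero_add (1 : M.D o), tp_succ, tp_zero]; norm_num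
  simp [rnum, M.K_ap, gap_rc, this]
  norm_num

theorem not_rLt_rnum : ¬ RLt (rnum M 0) (rnum M 0) := by
  simp [RLt, rnum, M.K_ap, gap_rc]

end Model

/-- The real-valued characteristic function takes just two values. The last clause, a literal
equality, later shows that such a set respects equality of reals. -/
theorem exists_set {P : M.D one → Prop} (hP : Rep M P) : ∃ A : M.D (one ⇒ one),
    (∀ f, IsReal (A f)) ∧ (∀ f, Mem f A ↔ P f) ∧ ∀ f g, (P f ↔ P g) → A f = A g := by
  obtain ⟨A, hA⟩ := Rep.exists_one (M := M) (F := fun f => if P f then rnum M 1 else rnum M 0)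
    (by fun_prop)
  refine ⟨A, fun f => ?_, fun f => ?_, fun f g h => by rw [hA, hA, h]⟩
  · rw [hA]; split_ifs <;> exact isReal_rnum _
  · rw [Mem, hA]; split_ifs with h <;> simp [h, rLt_rnum, not_rLt_rnum]

/-! ## Unique choice -/

/-- Choice of sequences that are uniquely determined. -/
def UAC (M : Model) : Prop :=
  ∀ W : M.D (o ⇒ one ⇒ o), (∀ n, ∃ f, W n f = 0 ∧ ∀ g, W n g = 0 → g = f) →
    ∃ x : M.D (o ⇒ one), ∀ n, W n (x n) = 0

theorem UAC.of_rep (H : UAC M) {P : M.D o → M.D one → Prop}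
    (hP : Rep M fun p : M.D o × M.D one => P p.1 p.2)
    (h : ∀ n, ∃ f, P n f ∧ ∀ g, P n g → g = f) : ∃ x : M.D (o ⇒ one), ∀ n, P n (x n) := by
  obtain ⟨W, hW⟩ := Rep.exists_two (F := fun n f => if P n f then (0 : M.D o) else 1) hP.chi
  have hW' : ∀ n f, W n f = 0 ↔ P n f := by simp [hW]
  simpa only [hW'] using H W (by simpa only [hW'] using h)

/-- The sequence h vanishes iff f + h = f, and `W` decides the latter. -/
theorem hasE_of_unique {W : M.D two} {f : M.D one} (h : W f = 0) (h' : ∀ g, W g = 0 → g = f) :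
    HasE M := by
  obtain ⟨G, hG⟩ := Rep.exists_two (M := M) (F := fun (h : M.D one) (n : M.D o) => f n + h n)
    (by fun_prop)
  refine .of_rep (P := fun h => W (G h) = 0) (by fun_prop) fun g => ⟨fun hg n => ?_, fun hg => ?_⟩
  · have := hG g n
    rw [h' _ hg] at this
    simpa using this
  · have : G g = f := M.ext fun n => by rw [hG, hg, add_zero]
    rw [this, h]

/-- To stay in Cantor space, `h` now flips the bits of `f` at the places where it is nonzero. -/
theorem hasE_of_unique_bin {P : M.D one → Prop} (hP : Rep M P) {f : M.D one} (hf : Bin f)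
    (h : P f) (h' : ∀ g, Bin g → P g → g = f) : HasE M := by
  obtain ⟨G, hG⟩ := Rep.exists_two (M := M)
    (F := fun (h : M.D one) (n : M.D o) => if h n = 0 then f n else 1 - f n) (by fun_prop)
  refine .of_rep (P := fun h => P (G h)) (by fun_prop) fun g => ⟨fun hg n => ?_, fun hg => ?_⟩
  · have hb : Bin (G g) := by
      intro n
      rw [hG]
      split_ifs
      · exact hf n
      · rcases hf n with h | h <;> simp [h]
    have := hG g n
    rw [h' _ hb hg] at this
    by_contra hne
    rw [if_neg hne] at this
    rcases hf n with h | h <;> simp [h] at this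
  · have : G g = f := M.ext fun n => by rw [hG, if_pos (hg n)]
    rwa [this]

/-- Membership is a Σ⁰₁ condition, not yet decidable. Fixing a stage `k` that witnesses it for `f`
replaces it by one equation between numbers, which is still sufficient for membership; injectivity
of `Y` then isolates `f`. -/
theorem hasE_of_bijCantor {A : M.D (one ⇒ one)} {Y : M.D two} (h : BijCantor A Y) : HasE M := by
  obtain ⟨f, hf, ⟨k, hk⟩, -⟩ := h.2 0
  refine hasE_of_unique_bin (P := fun g => A g k = A f k ∧ Y g = Y f) (by fun_prop) hf ⟨rfl, rfl⟩
    fun g hg hg' => h.1 g f hg hf ⟨k, ?_⟩ ⟨k, hk⟩ hg'.2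
  rwa [hg'.1]

theorem UAC.enum (H : UAC M) [HasE M] {A : M.D (one ⇒ one)} {Y : M.D two} (h : BijCantor A Y) :
    ∃ x : M.D (o ⇒ one), (∀ n, Bin (x n) ∧ Mem (x n) A) ∧
      ∀ f, Bin f → Mem f A → ∃ n, f = x n := by
  obtain ⟨x, hx⟩ := H.of_rep (P := fun n f => Bin f ∧ Mem f A ∧ Y f = n) (by fun_prop) fun n => by
    obtain ⟨f, hf⟩ := h.2 n
    exact ⟨f, hf, fun g hg => h.1 g f hg.1 hf.1 hg.2.1 hf.2.1 (hg.2.2.trans hf.2.2.symm)⟩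
  exact ⟨x, fun n => ⟨(hx n).1, (hx n).2.1⟩, fun f hf hA =>
    ⟨Y f, h.1 _ _ hf (hx _).1 hA (hx _).2.1 (hx _).2.2.symm⟩⟩

theorem UAC.pwo (H : UAC M) : PWO M := by
  intro A Y _ hY
  have := hasE_of_bijCantor hY
  obtain ⟨x, hx, hx'⟩ := H.enum hY
  obtain ⟨s, hs⟩ := Rep.exists_one (M := M)
    (F := fun k => if ∃ n, x n k = 1 then (1 : M.D o) else 0) (by fun_prop)
  refine ⟨s, fun k => ?_, fun f hf hA k => ?_, fun k hk => ?_⟩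
  · rw [hs]; split_ifs <;> simp
  · obtain ⟨n, rfl⟩ := hx' f hf hA
    rw [hs, not_lt]
    rcases hf k with h | h
    · simp [h]
    · rw [if_pos ⟨n, h⟩, h]
  · rw [hs] at hk
    obtain ⟨n, hn⟩ : ∃ n, x n k = 1 := by
      by_contra h
      simp [h] at hk
    exact ⟨x n, (hx n).1, (hx n).2, hn⟩

theorem UAC.ind (H : UAC M) : IND M := by
  intro Y hY n
  have : HasE M := by
    obtain ⟨⟨f, hf, hf'⟩, h⟩ := hY 0
    exact hasE_of_unique_bin (P := fun f => Y 0 f = 0) (by fun_prop) hf hf' fun g hg hg' =>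
      h g f hg hf hg' hf'
  obtain ⟨x, hx⟩ := H.of_rep (P := fun n f => Bin f ∧ Y n f = 0) (by fun_prop) fun n => by
    obtain ⟨⟨f, hf, hf'⟩, h⟩ := hY n
    exact ⟨f, ⟨hf, hf'⟩, fun g hg => h g f hg.1 hf hg.2 hf'⟩
  exact ⟨x, fun i _ => hx i⟩

/-- `f` is lexicographically smaller than `g` because of a place below `k`. -/
def LexLtBelow (k : M.D o) (f g : M.D one) : Prop :=
  ∃ j, j < k ∧ (∀ i < j, f i = g i) ∧ f j < g j

@[fun_prop]
theorem Rep.lexLtBelow [HasE M] {f g : X → M.D one} {k : X → M.D o} (hk : Rep M k)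
    (hf : Rep M f) (hg : Rep M g) : Rep M fun x => LexLtBelow (k x) (f x) (g x) := by
  unfold LexLtBelow
  fun_prop

theorem eq_of_not_lexLtBelow [HasE M] {k : M.D o} {f g : M.D one} (h : ¬ LexLtBelow k f g)
    (h' : ¬ LexLtBelow k g f) {j : M.D o} (hj : j < k) : f j = g j := by
  by_contra hne
  obtain ⟨i, h1, h2⟩ := exists_least (M := M) (P := fun i => i < k ∧ f i ≠ g i) (by fun_prop) ⟨j, hj, hne⟩
  have h3 : ∀ m < i, f m = g m := fun m hm => by
    by_contra h4
    exact h2 m hm ⟨hm.trans h1.1, h4⟩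
  rcases lt_or_gt_of_ne h1.2 with h4 | h4
  · exact h ⟨i, h1.1, h3, h4⟩
  · exact h' ⟨i, h1.1, fun m hm => (h3 m hm).symm, h4⟩

/-- The supremum is read off digit by digit: for each k some enumerated element is lexicographically
maximal as far as the first k digits are concerned, and all such elements agree on these digits. -/
theorem UAC.bwc (H : UAC M) : BWC M := by
  intro A Y _ hY
  have := hasE_of_bijCantor hY
  obtain ⟨x, hx, hx'⟩ := H.enum hY
  have hmax : ∀ k, ∃ n, ∀ m, ¬ LexLtBelow k (x n) (x m) := by
    intro k
    induction k using ind' with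
    | hP => fun_prop
    | h0 => exact ⟨0, fun m ⟨j, hj, _⟩ => not_lt_zero hj⟩
    | h1 k ih =>
        obtain ⟨n, hn⟩ := ih
        -- A maximal element for `k` digits stays maximal for one more, unless some element with the
        -- same first `k` digits has a larger next digit; that element then takes over.
        by_cases h : ∃ m, (∀ i < k, x n i = x m i) ∧ x n k < x m k
        · obtain ⟨m, h1, h2⟩ := h
          have h3 : x m k = 1 := ((hx m).1 k).resolve_left fun h => by
            rw [h] at h2; exact not_lt_zero h2
          refine ⟨m, fun m' ⟨j, hj, h4, h5⟩ => ?_⟩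
          rcases (lt_add_one_iff.1 hj).lt_or_eq with hj | rfl
          · exact hn m' ⟨j, hj, fun i hi => (h1 i (hi.trans hj)).trans (h4 i hi), by rwa [h1 j hj]⟩
          · rw [h3] at h5
            rcases (hx m').1 j with h6 | h6 <;> rw [h6] at h5
            · exact not_lt_zero h5
            · exact lt_irrefl _ h5
        · refine ⟨n, fun m' ⟨j, hj, h4, h5⟩ => ?_⟩
          rcases (lt_add_one_iff.1 hj).lt_or_eq with hj | rfl
          · exact hn m' ⟨j, hj, h4, h5⟩
          · exact h ⟨m', h4, h5⟩
  obtain ⟨s, hs⟩ := Rep.exists_one (M := M)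
    (F := fun k => if ∃ n, x n k = 1 ∧ ∀ m, ¬ LexLtBelow (k + 1) (x n) (x m) then (1 : M.D o) else 0)
    (by fun_prop)
  have hsb : Bin s := fun k => by rw [hs]; split_ifs <;> simp
  have hmono : ∀ {j k : M.D o} {f g : M.D one}, j ≤ k → LexLtBelow j f g → LexLtBelow k f g :=
    fun h ⟨i, hi, h'⟩ => ⟨i, hi.trans_le h, h'⟩
  have hag : ∀ k n, (∀ m, ¬ LexLtBelow k (x n) (x m)) → ∀ j < k, s j = x n j := by
    intro k n hn j hj
    have hn' : ∀ m, ¬ LexLtBelow (j + 1) (x n) (x m) := fun m h =>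
      hn m (hmono (add_one_le_iff.2 hj) h)
    rw [hs]
    split_ifs with h
    · obtain ⟨n', h1, h2⟩ := h
      rw [← h1]
      exact eq_of_not_lexLtBelow (h2 n) (hn' n') (lt_add_one_iff.2 le_rfl)
    · rcases (hx n).1 j with h1 | h1
      · exact h1.symm
      · exact (h ⟨n, h1, hn'⟩).elim
  refine ⟨s, hsb, fun f hf hA => ?_, fun g hg hA => ?_⟩
  · by_cases hfs : f = s
    · exact .inr hfs
    obtain ⟨k, h1, h2⟩ := exists_first_ne hfs
    obtain ⟨m, rfl⟩ := hx' f hf hA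
    obtain ⟨n, hn⟩ := hmax (k + 1)
    have h3 := hag _ n hn
    refine .inl ⟨k, h2, lt_of_le_of_ne (not_lt.1 fun h4 => hn m ⟨k, lt_add_one_iff.2 le_rfl,
      fun i hi => ?_, ?_⟩) h1⟩
    · rw [← h3 i (hi.trans (lt_add_one_iff.2 le_rfl)), h2 i hi]
    · rwa [← h3 k (lt_add_one_iff.2 le_rfl)]
  · by_cases hgs : s = g
    · exact .inr hgs
    obtain ⟨k, h1, h2⟩ := exists_first_ne hgs
    obtain ⟨n, hn⟩ := hmax (k + 1)
    have h3 := hag _ n hn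
    refine .inl ⟨k, h2, lt_of_le_of_ne (not_lt.1 fun h4 => ?_) h1⟩
    rcases hA _ (hx n).1 (hx n).2 with ⟨j, h5, h6⟩ | h5
    · rcases lt_trichotomy j k with h7 | rfl | h7
      · rw [← h3 j (h7.trans (lt_add_one_iff.2 le_rfl)), h2 j h7] at h6
        exact lt_irrefl _ h6
      · rw [← h3 j (lt_add_one_iff.2 le_rfl)] at h6
        exact lt_asymm h6 h4
      · have := h5 k h7
        rw [← h3 k (lt_add_one_iff.2 le_rfl)] at this
        exact h1 this
    · rw [← h5, ← h3 k (lt_add_one_iff.2 le_rfl)] at h4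
      exact lt_irrefl _ h4

end HOA

namespace HOA
open scoped Classical
open Model

variable {M : Model} {X Y Z : Type} [Obj M X] [Obj M Y] [Obj M Z] {ρ σ τ : FT}

/-! ## Columns -/

/-- Unique choice for nonzero binary sequences. -/
def BinUAC (M : Model) : Prop :=
  ∀ W : M.D (o ⇒ one ⇒ o), (∀ n, ∃ f, W n f = 0 ∧ ∀ g, W n g = 0 → g = f) →
    (∀ n f, W n f = 0 → Bin f ∧ ∃ k, f k = 1) → ∃ x : M.D (o ⇒ one), ∀ n, W n (x n) = 0

theorem bin_ext {f g : M.D one} (hf : Bin f) (hg : Bin g) (h : ∀ n, f n = 1 ↔ g n = 1) : f = g := by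
  refine M.ext fun n => ?_
  have := h n
  rcases hf n with h1 | h1 <;> rcases hg n with h2 | h2 <;> simp_all

theorem exists_charFun {P : X → M.D o → Prop} (hP : Rep M fun p : X × M.D o => P p.1 p.2) :
    ∃ F : X → M.D one, Rep M F ∧ (∀ x, Bin (F x)) ∧ ∀ x n, F x n = 1 ↔ P x n := by
  obtain ⟨F, hF, hF'⟩ := Rep.exists_curry (F := fun x n => if P x n then (1 : M.D o) else 0)
    (by fun_prop)
  refine ⟨F, hF, fun x n => ?_, fun x n => ?_⟩
  · rw [hF']; split_ifs <;> simp
  · rw [hF']; split_ifs with h <;> simp [h]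

/-- A sequence is replaced by the characteristic function of its graph, which is binary and never
zero. -/
theorem BinUAC.uac [HasE M] (H : BinUAC M) : UAC M := by
  intro W hW
  obtain ⟨d, hd, hd'⟩ := exists_mu (M := M) (X := M.D one × M.D o)
    (P := fun p v => p.1 (pr p.2 v) = 1) (by fun_prop)
  obtain ⟨dec, hdec, hdec'⟩ := Rep.exists_curry (F := fun f k => d (f, k)) hd
  obtain ⟨enc, henc, hencb, henc'⟩ := exists_charFun (M := M) (X := M.D one)
    (P := fun g p => ∃ k, p = pr k (g k)) (by fun_prop)
  have hde : ∀ g, dec (enc g) = g := fun g => M.ext fun k => by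
    have h1 := (hd' (enc g, k) (g k) ((henc' _ _).2 ⟨k, rfl⟩)).1
    obtain ⟨k', h2⟩ := (henc' _ _).1 h1
    obtain ⟨rfl, h3⟩ := pr_inj.1 h2
    rw [hdec', h3]
  obtain ⟨W', hW'⟩ := Rep.exists_two (M := M)
    -- Requiring `f` to be the characteristic function of a graph preserves uniqueness.
    (F := fun n f => if W n (dec f) = 0 ∧ f = enc (dec f) then (0 : M.D o) else 1) (by fun_prop)
  have hW'' : ∀ n f, W' n f = 0 ↔ W n (dec f) = 0 ∧ f = enc (dec f) := by simp [hW']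
  obtain ⟨x, hx⟩ := H W'
    (fun n => by
      obtain ⟨f, hf, hf'⟩ := hW n
      refine ⟨enc f, by rw [hW'', hde]; exact ⟨hf, rfl⟩, fun g hg => ?_⟩
      rw [hW''] at hg
      rw [hg.2, hf' _ hg.1])
    (fun n f hf => by
      rw [hW''] at hf
      rw [hf.2]
      exact ⟨hencb _, _, (henc' _ _).2 ⟨0, rfl⟩⟩)
  obtain ⟨y, hy⟩ := Rep.exists_one (M := M) (F := fun n => dec (x n)) (by fun_prop)
  exact ⟨y, fun n => by rw [hy]; exact ((hW'' _ _).1 (hx n)).1⟩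

theorem exists_col (M : Model) :
    ∃ C : M.D one → M.D o → M.D one, Rep M (fun p : M.D one × M.D o => C p.1 p.2) ∧
      ∀ F n k, C F n k = F (pr n k) := by
  obtain ⟨C, hC, hC'⟩ := Rep.exists_curry (M := M) (X := M.D one × M.D o)
    (F := fun p k => p.1 (pr p.2 k)) (by fun_prop)
  exact ⟨fun F n => C (F, n), hC, fun F n k => hC' _ _⟩

/-- The unique sequences `f_n`, spread over the columns of a matrix, form a strongly countable
set. -/
theorem exists_columns [HasE M] {W : M.D (o ⇒ one ⇒ o)}
    (hW : ∀ n, ∃ f, W n f = 0 ∧ ∀ g, W n g = 0 → g = f)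
    (hb : ∀ n f, W n f = 0 → Bin f ∧ ∃ k, f k = 1) :
    ∃ (C : M.D one → M.D o → M.D one) (B : M.D one → Prop) (Y : M.D two),
      Rep M (fun p : M.D one × M.D o => C p.1 p.2) ∧ (∀ F n k, C F n k = F (pr n k)) ∧
      Rep M B ∧ (∀ n, ∃ F, B F ∧ Y F = n) ∧ (∀ F G, B F → B G → Y F = Y G → F = G) ∧
      ∀ F, B F → Bin F ∧ W (Y F) (C F (Y F)) = 0 ∧ ∀ p, F p = 1 → ∃ k, p = pr (Y F) k := by
  obtain ⟨C, hC, hC'⟩ := exists_col M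
  -- The index of the first nonempty column. It recovers `n` from the n-th matrix because the
  -- sequences `f_n` are nonzero.
  obtain ⟨y, hy, hy'⟩ := exists_mu (M := M) (X := M.D one)
    (P := fun F n => ∃ k, F (pr n k) = 1) (by fun_prop)
  obtain ⟨Y, hY⟩ := hy.exists_one
  let B : M.D one → Prop := fun F => Bin F ∧ ∃ n, W n (C F n) = 0 ∧ ∀ p, F p = 1 → ∃ k, p = pr n k
  have hYn : ∀ {F n}, W n (C F n) = 0 → (∀ p, F p = 1 → ∃ k, p = pr n k) → Y F = n := by
    intro F n h h'
    obtain ⟨k, hk⟩ := (hb _ _ h).2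
    rw [hC'] at hk
    obtain ⟨k', hk'⟩ := (hy' F n ⟨k, hk⟩).1
    obtain ⟨_, h1⟩ := h' _ hk'
    rw [hY, (pr_inj.1 h1).1]
  have hBY : ∀ F, B F →
      Bin F ∧ W (Y F) (C F (Y F)) = 0 ∧ ∀ p, F p = 1 → ∃ k, p = pr (Y F) k := by
    rintro F ⟨hF, n, h1, h2⟩
    rw [hYn h1 h2]
    exact ⟨hF, h1, h2⟩
  have hB : Rep M B := by
    simp only [B]
    fun_prop
  refine ⟨C, B, Y, hC, hC', hB, fun n => ?_, fun F G hF hG h => ?_, hBY⟩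
  · obtain ⟨f, hf, -⟩ := hW n
    obtain ⟨F, -, hFb, hF⟩ := exists_charFun (M := M) (X := M.D o)
      (P := fun n p => ∃ k, p = pr n k ∧ f k = 1) (by fun_prop)
    have h1 : C (F n) n = f := by
      refine bin_ext (fun k => ?_) (hb _ _ hf).1 fun k => ?_
      · rw [hC']; exact hFb _ _
      · rw [hC', hF]
        simp [pr_inj]
    have h2 : ∀ p, F n p = 1 → ∃ k, p = pr n k := fun p hp =>
      ((hF _ _).1 hp).imp fun _ h => h.1
    have h3 : W n (C (F n) n) = 0 := by rw [h1, hf]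
    exact ⟨F n, ⟨hFb n, n, h3, h2⟩, hYn h3 h2⟩
  · obtain ⟨hF1, hF2, hF3⟩ := hBY F hF
    obtain ⟨hG1, hG2, hG3⟩ := hBY G hG
    rw [← h] at hG2 hG3
    obtain ⟨f, -, hf⟩ := hW (Y F)
    have h1 : C F (Y F) = C G (Y F) := (hf _ hF2).trans (hf _ hG2).symm
    refine bin_ext hF1 hG1 fun p => ⟨fun hp => ?_, fun hp => ?_⟩
    · obtain ⟨k, rfl⟩ := hF3 p hp
      rw [← hC', ← h1, hC', hp]
    · obtain ⟨k, rfl⟩ := hG3 p hp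
      rw [← hC', h1, hC', hp]

/-- Column n is occupied by only one member of the set, so the supremum shows exactly that member's
column there. -/
theorem Model.PWO.binUAC [HasE M] (H : PWO M) : BinUAC M := by
  intro W hW hb
  obtain ⟨C, B, Y, hC, hC', hB, hsurj, hinj, hBY⟩ := exists_columns hW hb
  obtain ⟨A, hA, hmem, -⟩ := exists_set hB
  obtain ⟨s, hs, hs1, hs2⟩ := H A Y (fun f _ => hA f)
    ⟨fun f g _ _ hf hg => hinj f g ((hmem f).1 hf) ((hmem g).1 hg), fun n => by
      obtain ⟨F, hF, hF'⟩ := hsurj n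
      exact ⟨F, (hBY F hF).1, (hmem F).2 hF, hF'⟩⟩
  obtain ⟨x, hx⟩ := Rep.exists_one (M := M) (F := fun n => C s n) (by fun_prop)
  refine ⟨x, fun n => ?_⟩
  obtain ⟨F, hF, rfl⟩ := hsurj n
  obtain ⟨h1, h2, h3⟩ := hBY F hF
  suffices C s (Y F) = C F (Y F) by rw [hx, this, h2]
  refine bin_ext (fun k => ?_) (hb _ _ h2).1 fun k => ?_
  · rw [hC']; exact hs _
  · rw [hC', hC']
    refine ⟨fun h => ?_, fun h => ?_⟩
    · obtain ⟨G, -, hG, hG'⟩ := hs2 _ h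
      rw [hmem] at hG
      obtain ⟨k', hk'⟩ := (hBY G hG).2.2 _ hG'
      have h4 := hinj F G hF hG (pr_inj.1 hk').1
      rwa [← h4] at hG'
    · have := hs1 F h1 ((hmem F).2 hF) (pr (Y F) k)
      rw [h, not_lt] at this
      rcases hs (pr (Y F) k) with h' | h'
      · rw [h'] at this
        simp at this
      · exact h'

theorem Model.PWO.uac (H : PWO M) : UAC M := by
  intro W hW
  obtain ⟨f, hf, hf'⟩ := hW 0
  have := hasE_of_unique hf hf'
  exact H.binUAC.uac W hW

/-! ## Lexicographic suprema and finite choice -/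

/-- Single columns would not do, since a lexicographic supremum sees only the largest members.
Cumulative matrices increase pointwise and stabilize on every initial segment, so their supremum is
their union. -/
theorem binUAC_of_bwc_ind [HasE M] (H : BWC M) (H' : IND M) : BinUAC M := by
  intro W hW hb
  obtain ⟨C, hC, hC'⟩ := exists_col M
  have huniq : ∀ {n f g}, W n f = 0 → W n g = 0 → f = g := fun {n f g} hf hg => by
    obtain ⟨_, -, h⟩ := hW n
    rw [h f hf, h g hg]
  let B : M.D o → M.D one → Prop := fun n F => Bin F ∧ (∀ i < n, W i (C F i) = 0) ∧
    ∀ p, F p = 1 → ∃ i < n, ∃ k, p = pr i k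
  have hBrep : Rep M fun p : M.D o × M.D one => B p.1 p.2 := by
    simp only [B]
    fun_prop
  have hBex : ∀ n, ∃ F, B n F := by
    intro n
    -- Finite choice is needed exactly here, to assemble the first `n` columns.
    obtain ⟨w, hw⟩ := H' W (fun n => by
      obtain ⟨f, hf, -⟩ := hW n
      exact ⟨⟨f, (hb _ _ hf).1, hf⟩, fun f g _ _ => huniq⟩) n
    obtain ⟨F, -, hFb, hF⟩ := exists_charFun (M := M) (X := M.D o)
      (P := fun n p => ∃ i < n, ∃ k, p = pr i k ∧ w i k = 1) (by fun_prop)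
    refine ⟨F n, hFb n, fun i hi => ?_, fun p hp => ?_⟩
    · have : C (F n) i = w i := by
        refine bin_ext (fun k => ?_) (hw i hi).1 fun k => ?_
        · rw [hC']; exact hFb _ _
        · rw [hC', hF]
          simp only [pr_inj]
          exact ⟨fun ⟨_, _, _, h, h'⟩ => by rwa [h.1, h.2], fun h => ⟨i, hi, k, ⟨rfl, rfl⟩, h⟩⟩
      rw [this, (hw i hi).2]
    · obtain ⟨i, hi, k, hk, -⟩ := (hF _ _).1 hp
      exact ⟨i, hi, k, hk⟩
  -- A place `p` lies in a column with index at most `p`, so every matrix carrying more than `p`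
  -- columns already has its final value at `p`.
  have hBle : ∀ {n m F G}, B n F → B m G → ∀ p < m, F p = 1 → G p = 1 := by
    intro n m F G hF hG p hp h
    obtain ⟨i, hi, k, rfl⟩ := hF.2.2 p h
    rw [← hC', ← huniq (hF.2.1 i hi) (hG.2.1 i ((le_pr_left i k).trans_lt hp)), hC', h]
  -- The first empty column counts the columns that are filled, as every `f_i` is nonzero.
  obtain ⟨y, hy, hy'⟩ := exists_mu (M := M) (X := M.D one)
    (P := fun F n => ¬ ∃ k, F (pr n k) = 1) (by fun_prop)
  obtain ⟨Y, hY⟩ := hy.exists_one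
  have hYn : ∀ {n F}, B n F → Y F = n := by
    intro n F hF
    have h0 : ¬ ∃ k, F (pr n k) = 1 := by
      rintro ⟨k, hk⟩
      obtain ⟨i, hi, k', h⟩ := hF.2.2 _ hk
      rw [(pr_inj.1 h).1] at hi
      exact lt_irrefl _ hi
    obtain ⟨h1, h2⟩ := hy' F n h0
    rw [hY]
    refine h2.eq_of_not_lt fun h3 => h1 ?_
    obtain ⟨k, hk⟩ := (hb _ _ (hF.2.1 _ h3)).2
    exact ⟨k, by rw [← hC', hk]⟩
  have hBuniq : ∀ {n F G}, B n F → B n G → F = G := by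
    intro n F G hF hG
    refine bin_ext hF.1 hG.1 fun p => ⟨fun h => ?_, fun h => ?_⟩
    · obtain ⟨i, hi, k, rfl⟩ := hF.2.2 _ h
      rw [← hC', huniq (hG.2.1 i hi) (hF.2.1 i hi), hC', h]
    · obtain ⟨i, hi, k, rfl⟩ := hG.2.2 _ h
      rw [← hC', huniq (hF.2.1 i hi) (hG.2.1 i hi), hC', h]
  obtain ⟨A, hA, hmem, -⟩ := exists_set (P := fun F => ∃ n, B n F) (by fun_prop)
  obtain ⟨s, hs, hs1, hs2⟩ := H A Y (fun f _ => hA f)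
    ⟨fun F G _ _ hF hG h => by
      obtain ⟨n, hF⟩ := (hmem F).1 hF
      obtain ⟨m, hG⟩ := (hmem G).1 hG
      rw [hYn hF, hYn hG] at h
      subst h
      exact hBuniq hF hG, fun n => by
      obtain ⟨F, hF⟩ := hBex n
      exact ⟨F, hF.1, (hmem F).2 ⟨n, hF⟩, hYn hF⟩⟩
  have hag : ∀ {k G}, B k G → ∀ j < k, G j = s j := by
    intro k G hG j hj
    by_contra hne
    obtain ⟨j, h1, h2⟩ := exists_least (M := M) (P := fun j => j < k ∧ G j ≠ s j) (by fun_prop) ⟨j, hj, hne⟩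
    have h3 : ∀ i < j, G i = s i := fun i hi => by
      by_contra h
      exact h2 i hi ⟨hi.trans h1.1, h⟩
    -- As `s` is an upper bound, the first disagreement can only go upward.
    have h4 : G j = 0 ∧ s j = 1 := by
      have h5 : G j < s j := by
        rcases hs1 G hG.1 ((hmem G).2 ⟨k, hG⟩) with ⟨l, h5, h6⟩ | h5
        · rcases lt_trichotomy l j with h7 | rfl | h7
          · rw [h3 l h7] at h6
            exact (lt_irrefl _ h6).elim
          · exact h6
          · exact (h1.2 (h5 j h7)).elim
        · exact (h1.2 (by rw [h5])).elim
      rcases hs j with h7 | h7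
      · rw [h7] at h5
        exact (not_lt_zero h5).elim
      · refine ⟨(hG.1 j).resolve_right fun h6 => ?_, h7⟩
        rw [h6, h7] at h5
        exact lt_irrefl _ h5
    -- This `t` copies `G` below `j`, has 0 at `j` and 1 afterwards. It is lexicographically smaller
    -- than `s`, yet still an upper bound, since no member exceeds `G` below `k`; this contradicts
    -- leastness.
    obtain ⟨t, ht⟩ := Rep.exists_one (M := M)
      (F := fun p => if p < j then G p else if p = j then 0 else 1) (by fun_prop)
    have htb : Bin t := fun p => by
      rw [ht]
      split_ifs
      · exact hG.1 p
      · simp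
      · simp
    have hub : ∀ F, Bin F → Mem F A → LexLt F t ∨ F = t := by
      intro F hFb hF
      obtain ⟨n, hF⟩ := (hmem F).1 hF
      by_cases hFt : F = t
      · exact .inr hFt
      obtain ⟨q, h5, h6⟩ := exists_first_ne hFt
      refine .inl ⟨q, h6, ?_⟩
      have h7 : q < k → G q = 0 → F q = 0 := fun hq hq' => (hFb q).resolve_right fun h => by
        rw [hBle hF hG q hq h] at hq'
        simp at hq'
      rw [ht] at h5 ⊢
      rcases lt_trichotomy q j with h8 | h8 | h8
      · rw [if_pos h8] at h5 ⊢
        rcases hG.1 q with h9 | h9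
        · exact (h5 ((h7 (h8.trans h1.1) h9).trans h9.symm)).elim
        · rw [h9] at h5 ⊢
          rw [(hFb q).resolve_right h5]
          exact zero_lt_one
      · subst h8
        rw [if_neg (lt_irrefl _), if_pos rfl] at h5
        exact (h5 (h7 h1.1 h4.1)).elim
      · rw [if_neg h8.not_gt, if_neg h8.ne'] at h5 ⊢
        rw [(hFb q).resolve_right h5]
        exact zero_lt_one
    have htj : t j = 0 := by rw [ht, if_neg (lt_irrefl _), if_pos rfl]
    rcases hs2 t htb hub with ⟨l, h5, h6⟩ | h5
    · rcases lt_trichotomy l j with h7 | rfl | h7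
      · rw [ht, if_pos h7, h3 l h7] at h6
        exact lt_irrefl _ h6
      · rw [htj] at h6
        exact not_lt_zero h6
      · have := h5 j h7
        rw [htj, h4.2] at this
        simp at this
    · rw [← h5, h4.2] at htj
      simp at htj
  obtain ⟨x, hx⟩ := Rep.exists_one (M := M) (F := fun n => C s n) (by fun_prop)
  refine ⟨x, fun n => ?_⟩
  obtain ⟨f, hf, -⟩ := hW n
  suffices C s n = f by rw [hx, this, hf]
  refine M.ext fun k => ?_
  -- With this many columns, both the place `pr n k` and the column `n` are covered.
  obtain ⟨G, hG⟩ := hBex (pr n k + 1)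
  have h1 := lt_add_one_iff.2 (le_refl (pr n k))
  rw [hC', ← hag hG _ h1, ← hC', huniq (hG.2.1 n ((le_pr_left n k).trans_lt h1)) hf]

theorem uac_of_bwc_ind (H : BWC M) (H' : IND M) : UAC M := by
  intro W hW
  obtain ⟨f, hf, hf'⟩ := hW 0
  have := hasE_of_unique hf hf'
  exact (binUAC_of_bwc_ind H H').uac W hW

end HOA

namespace HOA

/-! ## The ordered field of fractions of an ordered semiring -/

section fractions
variable (N : Type) [CommSemiring N] [LinearOrder N] [IsStrictOrderedRing N]

/-- Pairs `(a, b)`, read as differences `a - b`. -/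
def diffSetoid : Setoid (N × N) where
  r p q := p.1 + q.2 = q.1 + p.2
  iseqv := ⟨fun _ => rfl, fun h => h.symm, fun h h' => by grind⟩

/-- The ring of differences of `N`. -/
def Diff : Type := Quotient (diffSetoid N)

variable {N}

/-- The difference `a - b`. -/
def Diff.mk (a b : N) : Diff N := Quotient.mk (diffSetoid N) (a, b)

namespace Diff

theorem mk_eq {a b c d : N} : mk a b = mk c d ↔ a + d = c + b := Quotient.eq (r := diffSetoid N)

theorem ind {P : Diff N → Prop} (h : ∀ a b, P (mk a b)) (x : Diff N) : P x :=
  Quotient.inductionOn x fun p => h p.1 p.2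

instance : Zero (Diff N) := ⟨mk 0 0⟩
instance : One (Diff N) := ⟨mk 1 0⟩
instance : Add (Diff N) := ⟨Quotient.map₂ (fun p q => (p.1 + q.1, p.2 + q.2)) fun p p' h q q' h' => by
  change p.1 + p'.2 = p'.1 + p.2 at h
  change q.1 + q'.2 = q'.1 + q.2 at h'
  change p.1 + q.1 + (p'.2 + q'.2) = p'.1 + q'.1 + (p.2 + q.2)
  grind⟩
instance : Mul (Diff N) := ⟨Quotient.map₂
  (fun p q => (p.1 * q.1 + p.2 * q.2, p.1 * q.2 + p.2 * q.1)) fun p p' h q q' h' => by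
    change p.1 + p'.2 = p'.1 + p.2 at h
    change q.1 + q'.2 = q'.1 + q.2 at h'
    change p.1 * q.1 + p.2 * q.2 + (p'.1 * q'.2 + p'.2 * q'.1) =
      p'.1 * q'.1 + p'.2 * q'.2 + (p.1 * q.2 + p.2 * q.1)
    grind⟩
instance : Neg (Diff N) := ⟨Quotient.map (fun p => (p.2, p.1)) fun p q h => by
  change p.1 + q.2 = q.1 + p.2 at h
  change p.2 + q.1 = q.2 + p.1
  grind⟩

theorem add_mk (a b c d : N) : mk a b + mk c d = mk (a + c) (b + d) := rfl
theorem mul_mk (a b c d : N) : mk a b * mk c d = mk (a * c + b * d) (a * d + b * c) := rfl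
theorem neg_mk (a b : N) : -mk a b = mk b a := rfl
theorem zero_eq : (0 : Diff N) = mk 0 0 := rfl
theorem one_eq : (1 : Diff N) = mk 1 0 := rfl

instance : CommRing (Diff N) where
  add_assoc x y z := by
    induction x using ind; induction y using ind; induction z using ind
    simp only [add_mk, add_assoc]
  zero_add x := by
    induction x using ind
    simp only [zero_eq, add_mk, zero_add]
  add_zero x := by
    induction x using ind
    simp only [zero_eq, add_mk, add_zero]
  add_comm x y := by
    induction x using ind; induction y using ind
    simp only [add_mk, mk_eq]; ring
  nsmul := nsmulRec
  zsmul := zsmulRec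
  neg_add_cancel x := by
    induction x using ind
    simp only [zero_eq, add_mk, neg_mk, mk_eq]; ring
  mul_assoc x y z := by
    induction x using ind; induction y using ind; induction z using ind
    simp only [mul_mk, mk_eq]; ring
  one_mul x := by
    induction x using ind
    simp only [one_eq, mul_mk, mk_eq]; ring
  mul_one x := by
    induction x using ind
    simp only [one_eq, mul_mk, mk_eq]; ring
  mul_comm x y := by
    induction x using ind; induction y using ind
    simp only [mul_mk, mk_eq]; ring
  left_distrib x y z := by
    induction x using ind; induction y using ind; induction z using ind
    simp only [add_mk, mul_mk, mk_eq]; ring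
  right_distrib x y z := by
    induction x using ind; induction y using ind; induction z using ind
    simp only [add_mk, mul_mk, mk_eq]; ring
  zero_mul x := by
    induction x using ind
    simp only [zero_eq, mul_mk, mk_eq]; ring
  mul_zero x := by
    induction x using ind
    simp only [zero_eq, mul_mk, mk_eq]; ring

/-- The embedding of `N` into its ring of differences. -/
def of : N →+* Diff N where
  toFun a := mk a 0
  map_zero' := rfl
  map_one' := rfl
  map_add' a b := by simp [add_mk]
  map_mul' a b := by simp [mul_mk]

theorem of_injective : Function.Injective (of : N → Diff N) := fun a b h => by
  simpa using mk_eq.1 h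

theorem mk_eq_sub (a b : N) : mk a b = of a - of b := by
  rw [sub_eq_add_neg]
  change _ = mk a 0 + -mk b 0
  simp [neg_mk, add_mk]

variable [CanonicallyOrderedAdd N]

/-- In a canonically ordered semiring the smaller of two elements can be subtracted from the larger.
-/
theorem exists_of (x : Diff N) : (∃ a, x = of a) ∨ ∃ a, x = -of a := by
  induction x using ind with
  | h a b =>
    rcases le_total a b with h | h <;> obtain ⟨c, rfl⟩ := exists_add_of_le h
    · exact .inr ⟨c, by rw [mk_eq_sub, map_add]; ring⟩
    · exact .inl ⟨c, by rw [mk_eq_sub, map_add]; ring⟩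

instance : Nontrivial (Diff N) := of_injective.nontrivial

instance : IsDomain (Diff N) := by
  have : NoZeroDivisors N := inferInstance
  have h0 : ∀ a b : N, of a * of b = 0 → of a = 0 ∨ of b = 0 := by
    intro a b h
    rw [← map_mul, ← map_zero of, of_injective.eq_iff, mul_eq_zero] at h
    exact h.imp (fun h => by rw [h, map_zero]) fun h => by rw [h, map_zero]
  have : NoZeroDivisors (Diff N) := ⟨fun {x y} h => by
    rcases exists_of x with ⟨a, rfl⟩ | ⟨a, rfl⟩ <;> rcases exists_of y with ⟨b, rfl⟩ | ⟨b, rfl⟩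
    · exact h0 a b h
    · simpa using h0 a b (by simpa using h)
    · simpa using h0 a b (by simpa using h)
    · simpa using h0 a b (by simpa using h)⟩
  exact NoZeroDivisors.to_isDomain _

end Diff

variable (N) in
/-- The field of fractions of `N`. -/
abbrev Frac : Type := FractionRing (Diff N)

namespace Frac

variable (N) in
/-- The embedding of `N` into its field of fractions. -/
noncomputable def of : N →+* Frac N := (algebraMap (Diff N) (Frac N)).comp Diff.of

theorem of_injective : Function.Injective (of N) :=
  (IsFractionRing.injective (Diff N) (Frac N)).comp Diff.of_injective

theorem of_ne_zero {a : N} (h : a ≠ 0) : of N a ≠ 0 := by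
  rwa [← map_zero (of N), of_injective.ne_iff]

variable [CanonicallyOrderedAdd N]

theorem exists_mul_of (x : Frac N) : ∃ a b c, c ≠ 0 ∧ x * of N c = of N a - of N b := by
  obtain ⟨p, q, hq, rfl⟩ := IsFractionRing.div_surjective (A := Diff N) x
  have hq0 : algebraMap (Diff N) (Frac N) q ≠ 0 := by
    simpa using nonZeroDivisors.ne_zero hq
  induction p using Diff.ind with
  | h a b =>
    rcases Diff.exists_of q with ⟨c, rfl⟩ | ⟨c, rfl⟩
    · refine ⟨a, b, c, ?_, ?_⟩
      · rintro rfl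
        simp at hq0
      · rw [Diff.mk_eq_sub, map_sub]
        exact div_mul_cancel₀ _ hq0
    · refine ⟨b, a, c, ?_, ?_⟩
      · rintro rfl
        simp at hq0
      · rw [Diff.mk_eq_sub, map_sub, map_neg] at *
        change (of N a - of N b) / -of N c * of N c = _
        change -of N c ≠ 0 at hq0
        field_simp [neg_ne_zero.1 hq0]
        ring

variable (N) in
/-- The nonnegative fractions. -/
noncomputable def cone : RingCone (Frac N) where
  carrier := {x | ∃ a b, b ≠ 0 ∧ x * of N b = of N a}
  zero_mem' := ⟨0, 1, one_ne_zero, by simp⟩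
  one_mem' := ⟨1, 1, one_ne_zero, by simp⟩
  add_mem' := by
    rintro x y ⟨a, b, hb, h⟩ ⟨c, d, hd, h'⟩
    exact ⟨a * d + c * b, b * d, mul_ne_zero hb hd, by
      rw [map_add, map_mul, map_mul, map_mul, ← h, ← h']; ring⟩
  mul_mem' := by
    rintro x y ⟨a, b, hb, h⟩ ⟨c, d, hd, h'⟩
    exact ⟨a * c, b * d, mul_ne_zero hb hd, by rw [map_mul, map_mul, ← h, ← h']; ring⟩
  eq_zero_of_mem_of_neg_mem' := by
    rintro x ⟨a, b, hb, h⟩ ⟨c, d, hd, h'⟩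
    have h1 : a * d + c * b = 0 := by
      apply of_injective
      rw [map_add, map_mul, map_mul, ← h, ← h', map_zero]; ring
    have h2 : a = 0 := by
      rw [add_eq_zero] at h1
      exact (mul_eq_zero.1 h1.1).resolve_right hd
    rw [h2, map_zero] at h
    exact (mul_eq_zero.1 h).resolve_right (of_ne_zero hb)

instance : HasMemOrNegMem (cone N) := ⟨fun x => by
  obtain ⟨a, b, c, hc, h⟩ := exists_mul_of x
  rcases le_total a b with hab | hab <;> obtain ⟨d, rfl⟩ := exists_add_of_le hab
  · exact .inr ⟨d, c, hc, by rw [neg_mul, h, map_add]; ring⟩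
  · exact .inl ⟨d, c, hc, by rw [h, map_add]; ring⟩⟩

open scoped Classical in
noncomputable instance : LinearOrder (Frac N) := .mkOfAddGroupCone (cone N)

instance : IsOrderedRing (Frac N) := .mkOfCone (cone N)

instance : IsStrictOrderedRing (Frac N) := IsOrderedRing.toIsStrictOrderedRing _

theorem le_iff {x y : Frac N} : x ≤ y ↔ ∃ a b, b ≠ 0 ∧ (y - x) * of N b = of N a := Iff.rfl

theorem of_strictMono : StrictMono (of N) := by
  refine Monotone.strictMono_of_injective (fun a b h => ?_) of_injective
  obtain ⟨c, rfl⟩ := exists_add_of_le h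
  exact le_iff.2 ⟨c, 1, one_ne_zero, by simp⟩

@[simp] theorem of_le_of {a b : N} : of N a ≤ of N b ↔ a ≤ b := of_strictMono.le_iff_le
@[simp] theorem of_lt_of {a b : N} : of N a < of N b ↔ a < b := of_strictMono.lt_iff_lt

theorem of_nonneg (a : N) : 0 ≤ of N a := by
  rw [← map_zero (of N), of_le_of]; exact zero_le

end Frac

end fractions
end HOA

namespace HOA
open scoped Classical
open Model

variable {M : Model} {X Y Z : Type} [Obj M X] [Obj M Y] [Obj M Z] {ρ σ τ : FT}

/-! ## Real numbers in a model -/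

namespace Model

/-- The value of the code of a rational number. -/
noncomputable def val (q : M.D o) : Frac (M.D o) :=
  if h : ∃ p : M.D o × M.D o × M.D o, q = rc p.1 p.2.1 p.2.2 then
    (Frac.of _ h.choose.1 - Frac.of _ h.choose.2.1) / (Frac.of _ h.choose.2.2 + 1) else 0

/-- `2 ^ (-n)` -/
noncomputable def tinv (n : M.D o) : Frac (M.D o) := (Frac.of _ (tp n))⁻¹

theorem val_rc (a b c : M.D o) :
    val (rc a b c) = (Frac.of _ a - Frac.of _ b) / (Frac.of _ c + 1) := by
  have h : ∃ p : M.D o × M.D o × M.D o, rc a b c = rc p.1 p.2.1 p.2.2 := ⟨(a, b, c), rfl⟩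
  rw [val, dif_pos h]
  obtain ⟨h1, h2, h3⟩ := rc_inj.1 h.choose_spec
  rw [← h1, ← h2, ← h3]

theorem lt_tp (n : M.D o) : n < tp n := by
  induction n using ind' with
  | hP => fun_prop
  | h0 => rw [tp_zero]; exact zero_lt_one
  | h1 n ih =>
      rw [tp_succ]
      exact add_lt_add_of_lt_of_le ih (le_add_self.trans (add_one_le_iff.2 ih))

theorem tp_pos (n : M.D o) : 0 < tp n := zero_le.trans_lt (lt_tp n)

theorem of_pos {a : M.D o} (h : 0 < a) : 0 < Frac.of _ a := by
  rwa [← map_zero (Frac.of (M.D o)), Frac.of_lt_of]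

theorem tinv_pos (n : M.D o) : 0 < tinv n := inv_pos.2 (of_pos (tp_pos n))

theorem tinv_succ (n : M.D o) : tinv n = 2 * tinv (n + 1) := by
  have := of_pos (tp_pos n)
  rw [tinv, tinv, tp_succ, map_add]
  field_simp
  norm_num

theorem tinv_zero : tinv (0 : M.D o) = 1 := by simp [tinv, tp_zero]

theorem tp_mono {m n : M.D o} (h : m ≤ n) : tp m ≤ tp n := by
  obtain ⟨i, rfl⟩ := h
  induction i using ind' with
  | hP => fun_prop
  | h0 => simp
  | h1 i ih => rw [← add_assoc, tp_succ]; exact ih.trans le_self_add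

theorem tinv_anti {m n : M.D o} (h : m ≤ n) : tinv n ≤ tinv m :=
  inv_anti₀ (of_pos (tp_pos m)) (Frac.of_le_of.2 (tp_mono h))

/-- An Archimedean property relative to the model's own numbers: a positive fraction (a − b)/c is at
least 1/c, which exceeds 2^(−c). -/
theorem exists_tinv_lt {ε : Frac (M.D o)} (h : 0 < ε) : ∃ m, tinv m < ε := by
  obtain ⟨a, b, c, hc, h'⟩ := Frac.exists_mul_of ε
  have hc' : 0 < Frac.of _ c := of_pos (zero_le.lt_of_ne' hc)
  have h1 : 0 < ε * Frac.of _ c := mul_pos h hc'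
  have h2 : b + 1 ≤ a := by
    rw [h', sub_pos, Frac.of_lt_of] at h1
    exact add_one_le_iff.2 h1
  rw [← Frac.of_le_of, map_add, map_one] at h2
  refine ⟨c, (inv_strictAnti₀ hc' (Frac.of_lt_of.2 (lt_tp c))).trans_le ?_⟩
  rw [inv_le_iff_one_le_mul₀ hc']
  linarith

/-- Multiplication by the positive denominators leads back to the cleared form, so statements about
codes become inequalities in an ordered field. -/
theorem gap_iff {q r n : M.D o} {k : ℕ} (hq : IsRat q) (hr : IsRat r) :
    Gap q r n k ↔ k * tinv n < val r - val q := by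
  obtain ⟨a, b, c, rfl⟩ := hq
  obtain ⟨a', b', c', rfl⟩ := hr
  have h1 := of_pos (tp_pos n)
  have h2 : 0 < Frac.of _ c + 1 := add_pos_of_nonneg_of_pos (Frac.of_nonneg c) one_pos
  have h3 : 0 < Frac.of _ c' + 1 := add_pos_of_nonneg_of_pos (Frac.of_nonneg c') one_pos
  rw [gap_rc, ← Frac.of_lt_of, val_rc, val_rc, tinv, ← sub_pos, ← sub_pos (b := (k : Frac (M.D o)) * _)]
  simp only [map_add, map_mul, map_one, map_natCast]
  refine .trans (iff_of_eq ?_) (mul_pos_iff_of_pos_right (mul_pos h1 (mul_pos h2 h3)))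
  refine congrArg _ ?_
  field_simp
  ring

theorem isReal_iff {x : M.D one} :
    IsReal x ↔ (∀ n, IsRat (x n)) ∧ ∀ n m, n ≤ m → |val (x n) - val (x m)| ≤ tinv n := by
  refine and_congr_right fun h => ⟨fun H n m hm => ?_, fun H n i => ?_⟩
  · obtain ⟨i, rfl⟩ := hm
    have := H n i
    rw [gap_iff (h _) (h _), gap_iff (h _) (h _), Nat.cast_one, one_mul, not_lt, not_lt] at this
    exact abs_le.2 ⟨by linarith, by linarith⟩
  · have := abs_le.1 (H n (n + i) le_self_add)
    rw [gap_iff (h _) (h _), gap_iff (h _) (h _), Nat.cast_one, one_mul, not_lt, not_lt]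
    exact ⟨by linarith, by linarith⟩

theorem IsReal.abs_sub_le {x : M.D one} (h : IsReal x) {n m : M.D o} (hm : n ≤ m) :
    |val (x n) - val (x m)| ≤ tinv n := (isReal_iff.1 h).2 n m hm

theorem rEq_iff {x y : M.D one} (hx : IsReal x) (hy : IsReal y) :
    REq x y ↔ ∀ n, |val (x n) - val (y n)| ≤ 2 * tinv n := by
  refine forall_congr' fun n => ?_
  rw [gap_iff (hx.1 _) (hy.1 _), gap_iff (hy.1 _) (hx.1 _), Nat.cast_two, not_lt, not_lt, abs_le]
  constructor <;> rintro ⟨h, h'⟩ <;> constructor <;> linarith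

theorem rLt_iff {x y : M.D one} (hx : IsReal x) (hy : IsReal y) :
    RLt x y ↔ ∃ n, 2 * tinv n < val (y n) - val (x n) := by
  refine exists_congr fun n => ?_
  rw [gap_iff (hx.1 _) (hy.1 _), Nat.cast_two]

/-- The standard limit argument: an error that tends to zero along all large stages may be dropped.
-/
theorem le_of_forall_tinv {a b : Frac (M.D o)} (c : Frac (M.D o)) (m : M.D o) (hc : 0 < c)
    (h : ∀ n, m ≤ n → a ≤ b + c * tinv n) : a ≤ b := by
  refine le_of_forall_pos_le_add fun ε hε => ?_
  obtain ⟨k, hk⟩ := exists_tinv_lt (div_pos hε hc)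
  rw [lt_div_iff₀ hc] at hk
  have h1 := h (m + k) le_self_add
  have h2 := mul_le_mul_of_nonneg_left (tinv_anti (le_add_self : k ≤ m + k)) hc.le
  linarith

/-- The weaker constant 4 suffices because comparing at a late stage N costs only about 2^(−n) for
each sequence. -/
theorem rEq_of_le {x y : M.D one} (hx : IsReal x) (hy : IsReal y)
    (h : ∀ n, |val (x n) - val (y n)| ≤ 4 * tinv n) : REq x y := by
  refine (rEq_iff hx hy).2 fun n => le_of_forall_tinv 4 n (by norm_num) fun N hN => ?_
  have h1 := abs_le.1 (hx.abs_sub_le hN)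
  have h2 := abs_le.1 (hy.abs_sub_le hN)
  have h3 := abs_le.1 (h N)
  exact abs_le.2 ⟨by linarith, by linarith⟩

theorem REq.refl {x : M.D one} (hx : IsReal x) : REq x x :=
  (rEq_iff hx hx).2 fun n => by
    rw [sub_self, abs_zero]
    exact mul_nonneg zero_le_two (tinv_pos n).le

theorem REq.symm {x y : M.D one} (h : REq x y) : REq y x := fun n => (h n).symm

theorem REq.trans {x y z : M.D one} (hx : IsReal x) (hy : IsReal y) (hz : IsReal z)
    (h : REq x y) (h' : REq y z) : REq x z := by
  refine rEq_of_le hx hz fun n => ?_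
  have h1 := abs_le.1 ((rEq_iff hx hy).1 h n)
  have h2 := abs_le.1 ((rEq_iff hy hz).1 h' n)
  exact abs_le.2 ⟨by linarith, by linarith⟩

theorem RLt.congr {x y x' y' : M.D one} (hx : IsReal x) (hy : IsReal y) (hx' : IsReal x')
    (hy' : IsReal y') (h1 : REq x x') (h2 : REq y y') (h : RLt x y) : RLt x' y' := by
  rw [rLt_iff hx hy] at h
  rw [rLt_iff hx' hy']
  obtain ⟨n, hn⟩ := h
  by_contra! H
  refine hn.not_ge (le_of_forall_tinv 6 n (by norm_num) fun N hN => ?_)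
  have h3 := abs_le.1 (hx.abs_sub_le hN)
  have h4 := abs_le.1 (hy.abs_sub_le hN)
  have h5 := abs_le.1 ((rEq_iff hx hx').1 h1 N)
  have h6 := abs_le.1 ((rEq_iff hy hy').1 h2 N)
  have h7 := H N
  linarith

theorem RLt.val_le {x y : M.D one} (hx : IsReal x) (hy : IsReal y) (h : RLt x y) (n : M.D o) :
    val (x n) ≤ val (y n) + 2 * tinv n := by
  obtain ⟨m, hm⟩ := (rLt_iff hx hy).1 h
  refine le_of_forall_tinv 1 (n + m) one_pos fun N hN => ?_
  have h1 := abs_le.1 (hx.abs_sub_le (le_self_add.trans hN))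
  have h2 := abs_le.1 (hx.abs_sub_le (le_add_self.trans hN))
  have h3 := abs_le.1 (hy.abs_sub_le (le_self_add.trans hN))
  have h4 := abs_le.1 (hy.abs_sub_le (le_add_self.trans hN))
  have := tinv_pos N
  linarith

theorem val_le_of_not_rLt {x y : M.D one} (hx : IsReal x) (hy : IsReal y) (h : ¬ RLt x y)
    (n : M.D o) : val (y n) ≤ val (x n) + 2 * tinv n := by
  rw [rLt_iff hx hy] at h
  push Not at h
  have := h n
  linarith

theorem not_rLt_of_le {x y : M.D one} (hx : IsReal x) (hy : IsReal y)
    (h : ∀ n, val (y n) ≤ val (x n)) : ¬ RLt x y := by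
  rw [rLt_iff hx hy]
  rintro ⟨n, hn⟩
  have := h n
  have := tinv_pos n
  linarith

/-- A rational number as a real number. -/
def cst (q : M.D o) : M.D one := M.K o o q

theorem cst_ap (q n : M.D o) : cst q n = q := M.K_ap _ _

theorem isReal_cst {q : M.D o} (h : IsRat q) : IsReal (cst q) := by
  refine isReal_iff.2 ⟨fun n => by rwa [cst_ap], fun n m _ => ?_⟩
  rw [cst_ap, cst_ap, sub_self, abs_zero]
  exact (tinv_pos n).le

theorem mem_congr {A : M.D (one ⇒ one)} (hA : SubsetUnitInterval A) {x y : M.D one}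
    (hx : IsReal x) (hy : IsReal y) (h : REq x y) (h' : Mem x A) : Mem y A :=
  RLt.congr (isReal_rnum 0) (hA.1 x hx) (isReal_rnum 0) (hA.1 y hy) (REq.refl (isReal_rnum 0))
    (hA.2.1 x y hx hy h) h'

end Model

@[fun_prop]
theorem Rep.cst {f : X → M.D o} (hf : Rep M f) : Rep M fun x => cst (f x) := by
  unfold Model.cst
  fun_prop

namespace Model

/-! ### Dyadic approximations -/

/-- The code of `i / 2 ^ n`. -/
def dy (i n : M.D o) : M.D o := rc i 0 (tp n - 1)

theorem val_dy (i n : M.D o) : val (dy i n) = Frac.of _ i * tinv n := by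
  have h : Frac.of _ (tp n - 1) + 1 = Frac.of _ (tp n) := by
    rw [← map_one (Frac.of (M.D o)), ← map_add]
    congr 1
    obtain ⟨c, hc⟩ := le_def.1 (add_one_le_iff.2 (tp_pos n))
    rw [hc, zero_add, add_tsub_cancel_left, add_comm]
  rw [dy, val_rc, h, tinv, map_zero, sub_zero, div_eq_mul_inv]

theorem isRat_dy (i n : M.D o) : IsRat (dy i n) := ⟨_, _, _, rfl⟩

end Model

@[fun_prop]
theorem Rep.dy {f g : X → M.D o} (hf : Rep M f) (hg : Rep M g) :
    Rep M fun x => dy (f x) (g x) := by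
  unfold Model.dy
  fun_prop

/-- `F x n` is the integral part of `2 ^ n * x`. -/
def IsFloor (F : M.D one → M.D o → M.D o) : Prop :=
  ∀ x n i, RLt x (cst (dy (i + 1) n)) → RLt x (cst (dy (F x n + 1) n)) ∧ F x n ≤ i

theorem exists_floor (M : Model) [HasE M] : ∃ F : M.D one → M.D o → M.D o,
    Rep M (fun p : M.D one × M.D o => F p.1 p.2) ∧ IsFloor F := by
  obtain ⟨F, hF, hF'⟩ := exists_mu (M := M) (X := M.D one × M.D o)
    (P := fun p i => RLt p.1 (cst (dy (i + 1) p.2))) (by fun_prop)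
  exact ⟨fun x n => F (x, n), hF, fun x n i h => hF' (x, n) i h⟩

namespace IsFloor
variable {F : M.D one → M.D o → M.D o} (hF : IsFloor F)
include hF

theorem eq_of {x : M.D one} {n i : M.D o} (h : RLt x (cst (dy (i + 1) n)))
    (h' : ∀ j < i, ¬ RLt x (cst (dy (j + 1) n))) : F x n = i := by
  obtain ⟨h1, h2⟩ := hF x n i h
  exact h2.eq_of_not_lt fun h3 => h' _ h3 h1

variable {x y : M.D one} (hx : IsReal x) (hx1 : ¬ RLt (rnum M 1) x)

include hx hx1 in
theorem rLt (n : M.D o) : RLt x (cst (dy (F x n + 1) n)) := by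
  -- The candidate `tp n` works because x ≤ 1 < (2ⁿ + 1)/2ⁿ.
  refine (hF x n (tp n) ?_).1
  by_contra h
  have h1 : ∀ N, Frac.of _ (tp n + 1) * tinv n ≤ 1 + 4 * tinv N := fun N => by
    have h1 := val_le_of_not_rLt hx (isReal_cst (isRat_dy _ _)) h N
    have h2 := val_le_of_not_rLt (isReal_rnum 1) hx hx1 N
    rw [cst_ap, val_dy] at h1
    rw [rnum, M.K_ap, val_rc] at h2
    simp only [Nat.cast_one, map_one, map_zero, sub_zero, zero_add, div_one] at h2
    linarith
  have h2 := le_of_forall_tinv 4 0 (by norm_num) fun n _ => h1 n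
  rw [tinv, map_add, map_one, ← div_eq_mul_inv, div_le_one (of_pos (tp_pos n))] at h2
  linarith

include hx hx1 in
theorem congr (hy : IsReal y) (hy1 : ¬ RLt (rnum M 1) y) (h : REq x y) (n : M.D o) :
    F x n = F y n :=
  le_antisymm
    (hF x n _ (RLt.congr hy (isReal_cst (isRat_dy _ _)) hx (isReal_cst (isRat_dy _ _)) h.symm
      (REq.refl (isReal_cst (isRat_dy _ _))) (hF.rLt hy hy1 n))).2
    (hF y n _ (RLt.congr hx (isReal_cst (isRat_dy _ _)) hy (isReal_cst (isRat_dy _ _)) h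
      (REq.refl (isReal_cst (isRat_dy _ _))) (hF.rLt hx hx1 n))).2

include hx in
theorem le_val (hx0 : ¬ RLt x (rnum M 0)) (n N : M.D o) :
    Frac.of _ (F x n) * tinv n ≤ val (x N) + 2 * tinv N := by
  -- For floor 0 the bound is nonnegativity of `x`; otherwise it is the failure of the preceding
  -- candidate.
  rcases eq_zero_or (F x n) with h | ⟨i, h⟩
  · have := val_le_of_not_rLt hx (isReal_rnum 0) hx0 N
    rw [rnum, M.K_ap, val_rc] at this
    simpa [h] using this
  · have h1 : ¬ RLt x (cst (dy (i + 1) n)) := fun h' => by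
      have := (hF x n i h').2
      rw [h, add_one_le_iff] at this
      exact lt_irrefl _ this
    have := val_le_of_not_rLt hx (isReal_cst (isRat_dy _ _)) h1 N
    rwa [cst_ap, val_dy, ← h] at this

include hx hx1 in
theorem val_le (n N : M.D o) :
    val (x N) ≤ Frac.of _ (F x n) * tinv n + tinv n + 2 * tinv N := by
  have := (hF.rLt hx hx1 n).val_le hx (isReal_cst (isRat_dy _ _)) N
  rw [cst_ap, val_dy, map_add, map_one] at this
  linarith

end IsFloor

/-- Floors depend only on the real number and not on the Cauchy sequence that presents it. Dyadic
approximations by floors therefore turn equality of reals into equality of sequences, which is what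
unique choice needs. -/
theorem exists_canonical (M : Model) [HasE M] : ∃ c : M.D one → M.D one, Rep M c ∧
    (∀ x, IsReal x → ¬ RLt x (rnum M 0) → ¬ RLt (rnum M 1) x → IsReal (c x) ∧ REq x (c x)) ∧
    ∀ x y, IsReal x → ¬ RLt (rnum M 1) x → IsReal y → ¬ RLt (rnum M 1) y → REq x y →
      c x = c y := by
  obtain ⟨F, hF, hF'⟩ := exists_floor M
  obtain ⟨c, hc, hc'⟩ := Rep.exists_curry (F := fun x n => dy (F x n) n) (by fun_prop)
  refine ⟨c, hc, fun x hx hx0 hx1 => ?_, fun x y hx hx1 hy hy1 h => M.ext fun n => ?_⟩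
  · have h1 : IsReal (c x) := by
      refine isReal_iff.2 ⟨fun n => by rw [hc']; exact isRat_dy _ _, fun n m hm => ?_⟩
      rw [hc', hc', val_dy, val_dy]
      refine le_of_forall_tinv 4 0 (by norm_num) fun N _ => ?_
      have h1 := hF'.le_val hx hx0 n N
      have h2 := hF'.le_val hx hx0 m N
      have h3 := hF'.val_le hx hx1 n N
      have h4 := hF'.val_le hx hx1 m N
      have := tinv_anti hm
      exact abs_le.2 ⟨by linarith, by linarith⟩
    refine ⟨h1, rEq_of_le hx h1 fun n => ?_⟩
    rw [hc', val_dy]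
    have h1 := hF'.le_val hx hx0 n n
    have h3 := hF'.val_le hx hx1 n n
    have := tinv_pos n
    exact abs_le.2 ⟨by linarith, by linarith⟩
  · rw [hc', hc', hF'.congr hx hx1 hy hy1 h]

end HOA

namespace HOA
open scoped Classical
open Model

variable {M : Model} {X Y Z : Type} [Obj M X] [Obj M Y] [Obj M Z] {ρ σ τ : FT}

/-! ## Enumerations of strongly countable sets of reals -/

/-- Every real number is the limit of rational numbers different from it. -/
theorem exists_rat_ne {x : M.D one} (hx : IsReal x) :
    ∃ y, IsReal y ∧ REq x y ∧ ∀ p, ¬ REq (cst (y p)) y := by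
  by_cases h : ∀ p, ¬ REq (cst (x p)) x
  · exact ⟨x, hx, .refl hx, h⟩
  push Not at h
  obtain ⟨p, hp⟩ := h
  obtain ⟨a, b, c, hq⟩ := hx.1 p
  rw [hq] at hp
  have hc := isReal_cst (M := M) ⟨a, b, c, rfl⟩
  -- If `x` equals the rational q, represent it by the sequence q + 2^(−n), no term of which equals
  -- q. Denominators are coded by their predecessors, hence the final −1.
  obtain ⟨y, hy⟩ := Rep.exists_one (M := M)
    (F := fun n => rc (a * tp n + (c + 1)) (b * tp n) ((c + 1) * tp n - 1)) (by fun_prop)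
  have hval : ∀ n, val (y n) = val (rc a b c) + tinv n := by
    intro n
    have h2 : 0 < Frac.of _ c + 1 := add_pos_of_nonneg_of_pos (Frac.of_nonneg c) one_pos
    have h3 := of_pos (tp_pos n)
    have h : Frac.of _ ((c + 1) * tp n - 1) + 1 = (Frac.of _ c + 1) * Frac.of _ (tp n) := by
      rw [← map_one (Frac.of (M.D o)), ← map_add, ← map_add, ← map_mul]
      congr 1
      obtain ⟨d, hd⟩ := le_def.1 (add_one_le_iff.2
        (mul_pos (lt_of_lt_of_le one_pos (le_add_self : 1 ≤ c + 1)) (tp_pos n)))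
      rw [hd, zero_add, add_tsub_cancel_left, add_comm]
    rw [hy, val_rc, h, val_rc, tinv]
    simp only [map_add, map_mul, map_one]
    field_simp
    ring
  have hyr : IsReal y := by
    refine isReal_iff.2 ⟨fun n => by rw [hy]; exact ⟨_, _, _, rfl⟩, fun n m hm => ?_⟩
    rw [hval, hval]
    have := tinv_anti hm
    have := tinv_pos m
    exact abs_le.2 ⟨by linarith, by linarith⟩
  have hcy : REq (cst (rc a b c)) y := rEq_of_le hc hyr fun n => by
    rw [hval, cst_ap]
    have := tinv_pos n
    exact abs_le.2 ⟨by linarith, by linarith⟩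
  refine ⟨y, hyr, .trans hx hc hyr hp.symm hcy, fun n hn => ?_⟩
  have hn' := isReal_cst (hyr.1 n)
  have h1 := (rEq_iff hn' hc).1 (hn.trans hn' hyr hc hcy.symm)
  refine (tinv_pos n).not_ge (le_of_forall_tinv 2 0 two_pos fun N _ => ?_)
  have := (abs_le.1 (h1 N)).2
  rw [cst_ap, cst_ap, hval] at this
  linarith

/-- A functional singling out a real number gives `∃²`. -/
theorem hasE_of_unique_real {P : M.D one → Prop} (hP : Rep M P) {y : M.D one} (hy : IsReal y)
    (h : P y) (h' : ∀ x, IsReal x → P x → REq x y) (hne : ∀ p, ¬ REq (cst (y p)) y) :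
    HasE M := by
  -- The pointer `p h n` advances with `n` until it reaches a place where `h` is nonzero, and stays
  -- there. So `x h` is `y` itself if `h` vanishes, and is eventually frozen at some approximation
  -- of `y` otherwise.
  obtain ⟨s, hs⟩ := Rep.exists_three (M := M) (F := fun (h : M.D one) (_ p : M.D o) =>
    if h p = 0 then p + 1 else p) (by fun_prop)
  obtain ⟨p, hp⟩ := Rep.exists_two (M := M) (F := fun (h : M.D one) (n : M.D o) => M.R (s h) 0 n)
    (by fun_prop)
  obtain ⟨x, hx⟩ := Rep.exists_two (M := M) (F := fun (h : M.D one) (n : M.D o) => y (p h n))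
    (by fun_prop)
  have hp0 : ∀ h, p h 0 = 0 := fun h => by rw [hp, rec_zero]
  have hp1 : ∀ h n, p h (n + 1) = if h (p h n) = 0 then p h n + 1 else p h n := fun h n => by
    rw [hp, rec_succ, hs, ← hp]
  have hpn : ∀ h n, p h n = n ∨ h (p h n) ≠ 0 := by
    intro h n
    induction n using ind' with
    | hP => fun_prop
    | h0 => exact .inl (hp0 h)
    | h1 n ih =>
        rw [hp1]
        split_ifs with h1
        · exact .inl (by rw [ih.resolve_right (not_not.2 h1)])
        · exact .inr h1
  have hconst : ∀ h n i, h (p h n) ≠ 0 → p h (n + i) = p h n := by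
    intro h n i hn
    induction i using ind' with
    | hP => fun_prop
    | h0 => rw [add_zero]
    | h1 i ih => rw [← add_assoc, hp1, ih, if_neg hn]
  have hle : ∀ h n i, p h n ≤ p h (n + i) := by
    intro h n i
    induction i using ind' with
    | hP => fun_prop
    | h0 => rw [add_zero]
    | h1 i ih =>
        rw [← add_assoc, hp1]
        split_ifs
        · exact ih.trans le_self_add
        · exact ih
  have hxr : ∀ h, IsReal (x h) := by
    refine fun h => isReal_iff.2 ⟨fun n => by rw [hx]; exact hy.1 _, fun n m hm => ?_⟩
    obtain ⟨i, rfl⟩ := hm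
    rw [hx, hx]
    rcases hpn h n with h1 | h1
    · have := hle h n i
      rw [h1] at this ⊢
      exact hy.abs_sub_le this
    · rw [hconst h n i h1, sub_self, abs_zero]
      exact (tinv_pos n).le
  refine .of_rep (P := fun h => P (x h)) (by fun_prop) fun h => ⟨fun hh n => ?_, fun hh => ?_⟩
  · by_contra hn
    have h1 : h (p h n) ≠ 0 := by
      rcases hpn h n with h1 | h1
      · rwa [h1]
      · exact h1
    -- A frozen sequence presents the rational `y (p h n)`. By uniqueness it would equal `y`,
    -- contrary to the choice of `y`.
    refine hne (p h n) (.trans (isReal_cst (hy.1 _)) (hxr h) hy (rEq_of_le (isReal_cst (hy.1 _))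
      (hxr h) fun N => ?_) (h' _ (hxr h) hh))
    have h2 := (hxr h).abs_sub_le (le_self_add : N ≤ N + n)
    have h3 : x h (N + n) = y (p h n) := by rw [hx, add_comm, hconst h n N h1]
    rw [h3, abs_sub_comm] at h2
    rw [cst_ap]
    have := tinv_pos N
    linarith
  · have : x h = y := M.ext fun n => by
      rw [hx, (hpn h n).resolve_right (not_not.2 (hh _))]
    rwa [this]

/-- As in `hasE_of_bijCantor`, one approximation certifies membership; the representative is first
changed so that it differs from all its own approximations. -/
theorem hasE_of_bijReals {A : M.D (one ⇒ one)} {Y : M.D two} (hA : SubsetUnitInterval A)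
    (h : BijReals A Y) : HasE M := by
  obtain ⟨x, hx, hxA, -⟩ := h.2.2 0
  obtain ⟨y, hy, hxy, hne⟩ := exists_rat_ne hx
  obtain ⟨k, hk⟩ := mem_congr hA hx hy hxy hxA
  refine hasE_of_unique_real (P := fun z => A z k = A y k ∧ Y z = Y y) (by fun_prop) hy ⟨rfl, rfl⟩
    (fun z hz hz' => h.2.1 z y hz hy ⟨k, ?_⟩ ⟨k, hk⟩ hz'.2) hne
  rwa [hz'.1]

theorem UAC.cocode (H : UAC M) : Cocode M := by
  intro A Y hA hY
  have := hasE_of_bijReals hA hY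
  obtain ⟨c, hc, hc1, hc2⟩ := exists_canonical M
  -- Only fixed points of `c` are admitted, so each value of `Y` determines a single sequence and
  -- not merely a real.
  obtain ⟨x, hx⟩ := H.of_rep (P := fun n f => IsReal f ∧ c f = f ∧ Mem f A ∧ Y f = n)
    (by fun_prop) fun n => by
    obtain ⟨f, hf, hfA, hfY⟩ := hY.2.2 n
    obtain ⟨h0, h1⟩ := hA.2.2 f hf hfA
    obtain ⟨h2, h3⟩ := hc1 f hf h0 h1
    have h4 := mem_congr hA hf h2 h3 hfA
    refine ⟨c f, ⟨h2, (hc2 _ _ hf h1 h2 (hA.2.2 _ h2 h4).2 h3).symm, h4,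
      (hY.1 _ _ hf h2 h3).symm.trans hfY⟩, fun g ⟨hg, hg', hgA, hgY⟩ => ?_⟩
    rw [← hg']
    exact hc2 g f hg (hA.2.2 g hg hgA).2 hf h1 (hY.2.1 g f hg hf hgA hfA (hgY.trans hfY.symm))
  refine ⟨x, fun n => ⟨(hx n).1, (hx n).2.2.1⟩, fun y hy => ⟨fun h => ⟨Y y, ?_⟩, ?_⟩⟩
  · exact hY.2.1 _ _ (hx _).1 hy (hx _).2.2.1 h (hx _).2.2.2
  · rintro ⟨n, hn⟩
    exact mem_congr hA (hx n).1 hy hn (hx n).2.2.1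

/-! ## Unique choice from enumerations -/

/-- The real number with a given binary expansion. -/
theorem exists_binExpansion (M : Model) [HasE M] : ∃ (enc bits : M.D one → M.D one),
    Rep M enc ∧ Rep M bits ∧ (∀ F, Bin F → IsReal (enc F) ∧
      ¬ RLt (enc F) (rnum M 0) ∧ ¬ RLt (rnum M 1) (enc F)) ∧
    (∀ F, Bin F → (∀ k, ∃ j, k ≤ j ∧ F j = 0) → bits (enc F) = F) ∧
    ∀ x y, IsReal x → ¬ RLt (rnum M 1) x → IsReal y → ¬ RLt (rnum M 1) y → REq x y →
      bits x = bits y := by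
  obtain ⟨I, hI, hI'⟩ := exists_floor M
  -- The iteration of this step from 0 gives the number `a F n` whose binary digits are the first
  -- `n` bits of `F`.
  obtain ⟨s, hs⟩ := Rep.exists_three (M := M)
    (F := fun (F : M.D one) (k a : M.D o) => a + a + F k) (by fun_prop)
  obtain ⟨a, ha⟩ := Rep.exists_two (M := M) (F := fun (F : M.D one) (n : M.D o) => M.R (s F) 0 n)
    (by fun_prop)
  have ha0 : ∀ F, a F 0 = 0 := fun F => by rw [ha, rec_zero]
  have ha1 : ∀ F n, a F (n + 1) = a F n + a F n + F n := fun F n => by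
    rw [ha, rec_succ, hs, ← ha]
  obtain ⟨enc, henc, henc'⟩ := Rep.exists_curry (M := M) (X := M.D one)
    (F := fun F n => dy (a F n) n) (by fun_prop)
  obtain ⟨bits, hbits, hbits'⟩ := Rep.exists_curry (M := M) (X := M.D one)
    (F := fun x n => I x (n + 1) - (I x n + I x n)) (by fun_prop)
  have hval : ∀ F n, val (enc F n) = Frac.of _ (a F n) * tinv n := fun F n => by
    rw [henc', val_dy]
  have hsucc : ∀ F n, val (enc F (n + 1)) = val (enc F n) + Frac.of _ (F n) * tinv (n + 1) := by
    intro F n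
    rw [hval, hval, ha1, tinv_succ n, map_add, map_add]
    ring
  have hlow : ∀ F : M.D one, Bin F → ∀ n i, a F n * tp i ≤ a F (n + i) ∧
      a F (n + i) + 1 ≤ a F n * tp i + tp i := by
    intro F hF n i
    induction i using ind' with
    | hP => fun_prop
    | h0 => simp [tp_zero]
    | h1 i ih =>
        rw [← add_assoc, ha1, tp_succ, mul_add]
        refine ⟨(add_le_add ih.1 ih.1).trans le_self_add, ?_⟩
        have h1 : F (n + i) ≤ 1 := by rcases hF (n + i) with h | h <;> simp [h]
        calc a F (n + i) + a F (n + i) + F (n + i) + 1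
            ≤ a F (n + i) + a F (n + i) + 1 + 1 := by gcongr
          _ = (a F (n + i) + 1) + (a F (n + i) + 1) := by ring
          _ ≤ _ := add_le_add ih.2 ih.2
          _ = _ := by ring
  have htinv : ∀ n i : M.D o, Frac.of _ (tp i) * tinv (n + i) = tinv n := by
    intro n i
    have h : tp (n + i) = tp n * tp i := by
      induction i using ind' with
      | hP => fun_prop
      | h0 => simp [tp_zero]
      | h1 i ih => rw [← add_assoc, tp_succ, tp_succ, ih, mul_add]
    have h1 := of_pos (tp_pos n)
    have h2 := of_pos (tp_pos i)
    rw [tinv, tinv, h, map_mul]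
    field_simp
  have hbd : ∀ F : M.D one, Bin F → ∀ n i, val (enc F n) ≤ val (enc F (n + i)) ∧
      val (enc F (n + i)) + tinv (n + i) ≤ val (enc F n) + tinv n := by
    intro F hF n i
    obtain ⟨h1, h2⟩ := hlow F hF n i
    rw [← Frac.of_le_of] at h1 h2
    simp only [map_add, map_mul, map_one] at h1 h2
    have h3 := (tinv_pos (n + i)).le
    have h4 := mul_le_mul_of_nonneg_right h1 h3
    have h5 := mul_le_mul_of_nonneg_right h2 h3
    rw [mul_assoc, htinv] at h4
    rw [add_mul, add_mul, mul_assoc, htinv] at h5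
    rw [hval, hval]
    exact ⟨h4, by linarith⟩
  have hreal : ∀ F : M.D one, Bin F → IsReal (enc F) := by
    refine fun F hF => isReal_iff.2 ⟨fun n => by rw [henc']; exact isRat_dy _ _, fun n m hm => ?_⟩
    obtain ⟨i, rfl⟩ := hm
    obtain ⟨h1, h2⟩ := hbd F hF n i
    have := tinv_pos (n + i)
    exact abs_le.2 ⟨by linarith, by linarith⟩
  refine ⟨enc, bits, henc, hbits, fun F hF => ⟨hreal F hF, ?_, ?_⟩, fun F hF hz => ?_,
    fun x y hx hx1 hy hy1 h => M.ext fun n => ?_⟩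
  · refine not_rLt_of_le (hreal F hF) (isReal_rnum 0) fun n => ?_
    rw [hval, rnum, M.K_ap, val_rc]
    simpa using mul_nonneg (Frac.of_nonneg _) (tinv_pos n).le
  · refine not_rLt_of_le (isReal_rnum 1) (hreal F hF) fun n => ?_
    have h1 := (hbd F hF 0 n).2
    have := tinv_pos n
    rw [zero_add, hval F 0, ha0, map_zero, tinv_zero] at h1
    rw [rnum, M.K_ap, val_rc]
    simp only [Nat.cast_one, map_one, map_zero, sub_zero, zero_add, div_one]
    linarith
  · have hfl : ∀ k, I (enc F) k = a F k := by
      intro k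
      refine hI'.eq_of ?_ fun j hj => ?_
      · obtain ⟨j, hj, hFj⟩ := hz k
        obtain ⟨i, rfl⟩ := le_def.1 hj
        -- A zero at place k + i leaves a margin of 2^(−(k+i+1)) below the next dyadic; `N` makes
        -- the tolerance 2 · 2^(−N) smaller than this margin.
        obtain ⟨N, hN⟩ := exists_tinv_lt (half_pos (tinv_pos (k + i + 1)))
        refine (rLt_iff (hreal F hF) (isReal_cst (isRat_dy _ _))).2 ⟨k + i + 1 + N, ?_⟩
        have h1 := (hbd F hF k i).2
        have h2 := (hbd F hF (k + i + 1) N).2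
        have h3 := hsucc F (k + i)
        have h4 := tinv_succ (k + i)
        have h5 := tinv_anti (le_add_self : N ≤ k + i + 1 + N)
        have h6 := tinv_pos (k + i + 1 + N)
        rw [hFj, map_zero, zero_mul] at h3
        rw [cst_ap, val_dy, map_add, map_one, add_mul, ← hval]
        linarith
      · rw [rLt_iff (hreal F hF) (isReal_cst (isRat_dy _ _))]
        rintro ⟨N, hN⟩
        have h1 := (hbd F hF k N).1
        have h2 := abs_le.1 ((hreal F hF).abs_sub_le (le_add_self : N ≤ k + N))
        have h3 := mul_le_mul_of_nonneg_right (Frac.of_le_of.2 (add_one_le_iff.2 hj)) (tinv_pos k).le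
        rw [cst_ap, val_dy] at hN
        rw [← hval] at h3
        have := tinv_pos N
        linarith
    refine M.ext fun k => ?_
    rw [hbits', hfl, hfl, ha1, add_tsub_cancel_left]
  · rw [hbits', hbits', hI'.congr hx hx1 hy hy1 h, hI'.congr hx hx1 hy hy1 h]

/-- The one-column matrices become reals in the unit interval. Decoding the bits of an enumeration
of these reals returns the matrices, and with them the required sequences. -/
theorem Model.Cocode.binUAC [HasE M] (H : Cocode M) : BinUAC M := by
  intro W hW hb
  obtain ⟨C, B, Y, hC, hC', hB, hsurj, hinj, hBY⟩ := exists_columns hW hb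
  obtain ⟨enc, bits, henc, hbits, h01, hdec, hcongr⟩ := exists_binExpansion M
  have hBz : ∀ F, B F → ∀ k, ∃ j, k ≤ j ∧ F j = 0 := by
    intro F hF k
    obtain ⟨h1, -, h3⟩ := hBY F hF
    -- The column after the occupied one is empty and supplies zeros beyond any `k`.
    refine ⟨pr (Y F + 1) k, le_pr_right _ _, (h1 _).resolve_right fun h => ?_⟩
    obtain ⟨k', h⟩ := h3 _ h
    exact (lt_add_one_iff.2 (le_refl (Y F))).ne' (pr_inj.1 h).1
  have hencB : ∀ F, B F → IsReal (enc F) ∧ bits (enc F) = F := fun F hF =>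
    ⟨(h01 F (hBY F hF).1).1, hdec F (hBY F hF).1 (hBz F hF)⟩
  have hle : ∀ F x, B F → IsReal x → REq (enc F) x → ¬ RLt x (rnum M 0) ∧ ¬ RLt (rnum M 1) x := by
    intro F x hF hx h
    obtain ⟨h1, h2, h3⟩ := h01 F (hBY F hF).1
    exact ⟨fun h' => h2 (.congr hx (isReal_rnum 0) h1 (isReal_rnum 0) h.symm (.refl (isReal_rnum 0)) h'),
      fun h' => h3 (.congr (isReal_rnum 1) hx (isReal_rnum 1) h1 (.refl (isReal_rnum 1)) h.symm h')⟩
  have hPbits : ∀ F x, IsReal x → B F → REq (enc F) x → bits x = F := by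
    intro F x hx hF h
    obtain ⟨h1, h2⟩ := hencB F hF
    rw [← hcongr _ _ h1 (h01 F (hBY F hF).1).2.2 hx (hle F x hF hx h).2 h, h2]
  obtain ⟨A, hA, hmem, hAeq⟩ := exists_set
    (P := fun x => IsReal x ∧ B (bits x) ∧ REq (enc (bits x)) x) (by fun_prop)
  have hmem' : ∀ x, IsReal x → (Mem x A ↔ ∃ F, B F ∧ REq (enc F) x) := by
    intro x hx
    rw [hmem]
    constructor
    · exact fun ⟨_, h⟩ => ⟨_, h⟩
    · rintro ⟨F, hF, h⟩
      rw [hPbits F x hx hF h]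
      exact ⟨hx, hF, h⟩
  have hiff : ∀ x y, IsReal x → IsReal y → REq x y → Mem x A → Mem y A := by
    intro x y hx hy h
    rw [hmem' x hx, hmem' y hy]
    exact fun ⟨F, hF, h'⟩ => ⟨F, hF, h'.trans (hencB F hF).1 hx hy h⟩
  -- The default value 0 outside the set makes the functional respect equality of reals everywhere.
  obtain ⟨Y', hY'⟩ := Rep.exists_one (M := M)
    (F := fun x => if IsReal x ∧ B (bits x) ∧ REq (enc (bits x)) x then Y (bits x) else 0)
    (by fun_prop)
  have hY'F : ∀ F x, IsReal x → B F → REq (enc F) x → Y' x = Y F := by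
    intro F x hx hF h
    rw [hY', hPbits F x hx hF h, if_pos ⟨hx, hF, h⟩]
  have hsub : SubsetUnitInterval A := by
    refine ⟨fun x _ => hA x, fun x y hx hy h => ?_, fun x hx hxA => ?_⟩
    · rw [hAeq x y]
      · exact .refl (hA y)
      · rw [← hmem, ← hmem]
        exact ⟨hiff x y hx hy h, hiff y x hy hx h.symm⟩
    · obtain ⟨F, hF, h⟩ := (hmem' x hx).1 hxA
      exact hle F x hF hx h
  have hbij : BijReals A Y' := by
    refine ⟨fun x y hx hy h => ?_, fun x y hx hy hxA hyA h => ?_, fun n => ?_⟩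
    · by_cases hxA : Mem x A
      · obtain ⟨F, hF, h'⟩ := (hmem' x hx).1 hxA
        rw [hY'F F x hx hF h', hY'F F y hy hF (h'.trans (hencB F hF).1 hx hy h)]
      · have hyA : ¬ Mem y A := fun h' => hxA (hiff y x hy hx h.symm h')
        rw [hmem] at hxA hyA
        rw [hY', hY', if_neg hxA, if_neg hyA]
    · obtain ⟨F, hF, h1⟩ := (hmem' x hx).1 hxA
      obtain ⟨G, hG, h2⟩ := (hmem' y hy).1 hyA
      rw [hY'F F x hx hF h1, hY'F G y hy hG h2] at h
      obtain rfl := hinj F G hF hG h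
      exact h1.symm.trans hx (hencB F hF).1 hy h2
    · obtain ⟨F, hF, hn⟩ := hsurj n
      have hr := (hencB F hF).1
      exact ⟨enc F, hr, (hmem' _ hr).2 ⟨F, hF, .refl hr⟩, by rw [hY'F F _ hr hF (.refl hr), hn]⟩
  obtain ⟨x, hx, hx'⟩ := H A Y' hsub hbij
  -- The enumeration comes in no particular order, so the index of the real with value `n` is found
  -- by minimization.
  obtain ⟨m, hm, hm'⟩ := exists_mu (M := M) (X := M.D o) (P := fun n m => Y' (x m) = n)
    (by fun_prop)
  obtain ⟨z, hz⟩ := Rep.exists_one (M := M) (F := fun n => C (bits (x (m n))) n) (by fun_prop)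
  refine ⟨z, fun n => ?_⟩
  obtain ⟨y, hy, hyA, hyn⟩ := hbij.2.2 n
  obtain ⟨i, hi⟩ := (hx' y hy).1 hyA
  have h1 := (hm' n i ((hbij.1 _ _ (hx i).1 hy hi).trans hyn)).1
  obtain ⟨F, hF, h2⟩ := (hmem' _ (hx (m n)).1).1 (hx (m n)).2
  rw [hY'F F _ (hx _).1 hF h2] at h1
  rw [hz, hPbits F _ (hx _).1 hF h2, ← h1]
  exact (hBY F hF).2.1

theorem Model.Cocode.uac (H : Cocode M) : UAC M := by
  intro W hW
  obtain ⟨f, hf, hf'⟩ := hW 0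
  have := hasE_of_unique hf hf'
  exact H.binUAC.uac W hW

end HOA

open HOA in
theorem theorem2p3 :
    (RCA0ω ⊩ (BWC1 ⋏ IND1) ⟺ BWC1pwo) ∧ (RCA0ω ⊩ BWC1pwo ⟺ cocode1) := by
  constructor <;> refine proves_of_sat fun M e => ?_ <;>
    simp only [Struct.sat_iff, Struct.sat_and, Model.sat_BWC1, Model.sat_IND1, Model.sat_BWC1pwo,
      Model.sat_cocode1]
  · exact ⟨fun h => (uac_of_bwc_ind h.1 h.2).pwo, fun h => ⟨h.uac.bwc, h.uac.ind⟩⟩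
  · exact ⟨fun h => h.uac.cocode, fun h => h.uac.pwo⟩
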